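/- Let $d\ge 1$. For $n\in\mathbb Z^d$ let $|n|$ be the Euclidean norm and $\langle n\rangle=(1+|n|^2)^{1/2}$. Distributions $u$ on $\mathbb T^d=\mathbb R^d/2\pi\mathbb Z^d$ are identified with their Fourier coefficients $(u_n)_{n\in\mathbb Z^d}$; $\|u\|_{h^s}^2=\sum_n\langle n\rangle^{2s}|u_n|^2$, and $\Pi_{\ge N}$ is the projection onto the modes $|n|\ge N$. A flat torus is given by a real symmetric positive definite $d\times d$ matrix $G$, with frequencies $\lambda_n^2={}^t n\,G\,n$, and the equation is $$i\partial_t u+\operatorname{div}G\nabla u=f(|u|^2)u\qquad\text{(NLS)}$$ with $f\in C^\infty(\mathbb R;\mathbb R)$, $f(0)=0$, $f'(0)\neq 0$. For $\delta\in(0,1)$ and $C\ge 2$, a *cluster decomposition* of $\mathbb Z^d$ is a partition $\mathbb Z^d=\bigcup_\upsilon\mathscr C_\upsilon$ into finite sets such that (i) there is an index $\upsilon_0$ with $|n|\le C$ for all $n\in\mathscr C_{\upsilon_0}$ and with $n\in\mathscr C_{\upsilon_0}$ whenever $|n|<2$; (ii) $\max_{n\in\mathscr C_\upsilon}|n|\le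 2m_\upsilon$ for all $\upsilon\ne\upsilon_0$, where $m_\upsilon:=\min_{n\in\mathscr C_\upsilon}|n|$ for every $\upsilon$; (iii) if $n_1,n_2$ belong to different clusters, then $|n_1-n_2|+|\lambda_{n_1}^2-\lambda_{n_2}^2|>(|n_1|+|n_2|)^{\delta}$. The super-actions are $S_\upsilon(u)=\sum_{n\in\mathscr C_\upsilon}|u_n|^2$. **Statement.** There is $\delta\in(0,1)$ depending only on $d$, and there are $C\ge2$ and $N_0\ge 2$ depending only on $d$ and $G$, such that a cluster decomposition with parameters $\delta$, $C$ exists and such that the following holds for all $f$ as above, all real $r\ge 2$, $s>d$, $c>1$, $T>0$, $\rho>0$, and every solution $u\in C([0,T];h^s)$ of (NLS) with $\|u(0)\|_{h^s}\le\rho$ and $\sup_{t\in[0,T]}\|u(t)\|_{h^s}\le c\rho$. 1. There are $\rho_1>0$ depending only on $(d,G,f,r)$ and $K>0$ depending only on $(d,G,f,r,s,c)$ such that, if $\rho\le\rho_1$, then for every cluster decomposition with parameters $\delta$, $C$, every real $M\ge2$ and every $t\in[0,T]$, $$\sum_{m_\upsilon\ge M}m_\upsilon^{2s}\,\big|S_\upsilon(u(t))-S_\upsilon(u(0))\big|\le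 K\Big(\rho^4+T M^{-\frac\delta2(s-d)}\rho^4+T\rho^{2(r+1)}\Big),$$ the series being convergent. 2. There is $\rho_0>0$ depending only on $(d,G,f,r,s,c)$ such that, if $\rho\le\rho_0$, then for every real $N\ge N_0$ and every $t\in[0,T]$, $$\|\Pi_{\ge N}u(t)\|_{h^s}^2\le 2^{2s}\|u(0)\|_{h^s}^2+\rho^3+T N^{-\frac\delta2(s-d)}\rho^3+T\rho^{2r+1}.$$ -/

import Mathlib

open scoped ContDiff Topology

namespace NLSTorus

noncomputable section

/-- The Euclidean norm `|n|` of an integer vector. -/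
def nrm {d : ℕ} (n : Fin d → ℤ) : ℝ := Real.sqrt (∑ i, (n i : ℝ) ^ 2)

/-- The bracket `⟨n⟩ = (1 + |n|^2)^(1/2)`. -/
def bracket {d : ℕ} (n : Fin d → ℤ) : ℝ := Real.sqrt (1 + nrm n ^ 2)

/-- The frequency `λ_n^2 = g(n, n) = ᵗn G n`; it is the eigenvalue of `- div G ∇` on `e^{i n·x}`. -/
def freq {d : ℕ} (G : Matrix (Fin d) (Fin d) ℝ) (n : Fin d → ℤ) : ℝ :=
  (fun i => (n i : ℝ)) ⬝ᵥ (G.mulVec (fun i => (n i : ℝ)))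

/-- Membership in `h^s(ℤ^d)`. A distribution on the torus `ℝ^d / 2πℤ^d` is identified with the
sequence of its Fourier coefficients. -/
def MemHs {d : ℕ} (s : ℝ) (v : (Fin d → ℤ) → ℂ) : Prop :=
  Summable fun n => bracket n ^ (2 * s) * ‖v n‖ ^ 2

/-- The norm of `h^s(ℤ^d)` (meaningful for sequences satisfying `MemHs s`). -/
def hsNorm {d : ℕ} (s : ℝ) (v : (Fin d → ℤ) → ℂ) : ℝ :=
  Real.sqrt (∑' n, bracket n ^ (2 * s) * ‖v n‖ ^ 2)

/-- The projection `Π_{≥ N}` onto the modes with `|n| ≥ N`. -/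
def projHigh {d : ℕ} (N : ℝ) (v : (Fin d → ℤ) → ℂ) : (Fin d → ℤ) → ℂ :=
  Set.indicator {n | N ≤ nrm n} v

/-- The function with Fourier coefficients `v`. The torus `ℝ^d / 2πℤ^d` is parametrized by
`x = 2πθ` with `θ` in `(ℝ/ℤ)^d`, so that `mFourier k θ = e^{2πi k·θ} = e^{i k·x}`, and the Haar
probability measure of `(ℝ/ℤ)^d` is the normalized measure `(2π)^{-d} dx`. -/
def toFun {d : ℕ} (v : (Fin d → ℤ) → ℂ) (θ : UnitAddTorus (Fin d)) : ℂ :=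
  ∑' k, v k * UnitAddTorus.mFourier k θ

/-- The `n`-th Fourier coefficient of `f(|v|^2) v`. -/
def nonlin {d : ℕ} (f : ℝ → ℝ) (v : (Fin d → ℤ) → ℂ) (n : Fin d → ℤ) : ℂ :=
  UnitAddTorus.mFourierCoeff (fun θ => (f (‖toFun v θ‖ ^ 2) : ℂ) * toFun v θ) n

/-- `u ∈ C([0,T]; h^s)` solves `i ∂_t u + div G ∇ u = f(|u|^2) u` on `[0,T]`: tested against each
exponential `e^{i n·x}`, the equation reads
`i ∂_t u_n = λ_n^2 u_n + (f(|u|^2) u)_n`. (For `s > d/2` this is the equation in the sense of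
distributions.) -/
structure IsNLSSolution {d : ℕ} (G : Matrix (Fin d) (Fin d) ℝ) (f : ℝ → ℝ) (s T : ℝ)
    (u : ℝ → (Fin d → ℤ) → ℂ) : Prop where
  mem : ∀ t ∈ Set.Icc 0 T, MemHs s (u t)
  cont : ∀ t₀ ∈ Set.Icc 0 T,
    Filter.Tendsto (fun t => hsNorm s (u t - u t₀)) (𝓝[Set.Icc 0 T] t₀) (𝓝 0)
  eqn : ∀ n, ∀ t ∈ Set.Icc 0 T,
    HasDerivWithinAt (fun τ => u τ n)
      (-Complex.I * ((freq G n : ℂ) * u t n + nonlin f (u t) n)) (Set.Icc 0 T) t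

/-- The cluster with index `υ`. A partition of `ℤ^d` is given by an equivalence relation, and
the indices of the clusters are the equivalence classes. -/
def cluster {d : ℕ} (P : Setoid (Fin d → ℤ)) (υ : Quotient P) : Set (Fin d → ℤ) :=
  {n | Quotient.mk P n = υ}

/-- `m_υ`, the minimum of `|n|` over the cluster `υ`. -/
def clusterMin {d : ℕ} (P : Setoid (Fin d → ℤ)) (υ : Quotient P) : ℝ :=
  ⨅ n : cluster P υ, nrm (n : Fin d → ℤ)

/-- The super-action `S_υ(v)`, the sum of `|v_n|^2` over the (finite) cluster `υ`. -/
def superAction {d : ℕ} (P : Setoid (Fin d → ℤ)) (υ : Quotient P) (v : (Fin d → ℤ) → ℂ) : ℝ :=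
  ∑' n : cluster P υ, ‖v (n : Fin d → ℤ)‖ ^ 2

/-- Bourgain cluster decompositions of `ℤ^d` for the metric `G`, with exponent `δ` and
low-frequency bound `C`. -/
structure IsClusterDecomposition {d : ℕ} (G : Matrix (Fin d) (Fin d) ℝ) (δ C : ℝ)
    (P : Setoid (Fin d → ℤ)) : Prop where
  finite : ∀ υ, (cluster P υ).Finite
  dyadic : ∃ υ₀ : Quotient P,
    (∀ n ∈ cluster P υ₀, nrm n ≤ C) ∧
    (∀ n, nrm n < 2 → n ∈ cluster P υ₀) ∧
    ∀ υ, υ ≠ υ₀ → ∀ n ∈ cluster P υ, nrm n ≤ 2 * clusterMin P υ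
  separated : ∀ n₁ n₂, Quotient.mk P n₁ ≠ Quotient.mk P n₂ →
    (nrm n₁ + nrm n₂) ^ δ < nrm (n₁ - n₂) + |freq G n₁ - freq G n₂|

end

end NLSTorus

/-! On a general flat torus single actions |u_n|^2 need not be almost conserved, but their sums over
clusters are. Let ϖ be a weight constant on clusters, supported in |n| ≥ M and bounded by ⟨n⟩^{2s},
and let J = Σ ϖ_n |u_n|^2. A Birkhoff normal form writes the Hamiltonian H, order by order up to
degree 2D + 2, as a formal Lie transform T of a Hamiltonian K whose monomials beyond the quadratic
part all have frequency modulation less than one (`exists_normalForm`). The removed monomials have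
divisors of modulus at least 1, so neither a Diophantine condition on `G` nor a loss of derivatives
occurs.

Consider a monomial of K of zero momentum, with two largest modes n_i, n_j and third mode n_l. If
⟨n_l⟩ < c M^{δ/2}, then either every weight in it vanishes, or momentum and modulation force n_i and
n_j to have opposite signs and to be so close, in position and in frequency, that the separation
condition puts them in one cluster; in both cases the monomial commutes with J
(`weight_eq_zero_or`). If ⟨n_l⟩ ≥ c M^{δ/2}, summing over the third mode gains M^{-(δ/2)(s-d)} by
the embedding of h^d in ℓ¹. Hence {J, K} is small (`exists_isForm_poisson_resonant`). Since T is a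
morphism for the bracket, E = TJ, cut at order D, satisfies E = J + O(R^4), and {E, H} equals T{J,
K} up to terms of degree at least 2D + 4 (`exists_modifiedEnergy`).

No change of variables is performed: the polynomial E is evaluated along the solution itself,
restricted to the modes |n| ≤ L. The Taylor remainder of f is of size b^{2D+3} in h^s; the error
from discarding high modes is small only in h^d, but for a finitely supported ϖ it disappears as L →
∞ (`exists_nonlin_splitting`, `exists_weighted_action_bound`). Choosing the signs of ϖ yields the
first estimate (`exists_superAction_variation_bound`), and the dyadic shape of the clusters yields
the second (`hsNorm_projHigh_sq_le`).

The clusters are essentially the components of the graph of close pairs. A chain of distinct lattice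
points with increments at most Γ in position and in frequency has length at most polynomial in Γ,
with an exponent depending only on d (`exists_chain_bound`). For δ small in terms of this exponent,
components stay in dyadic shells (`nrm_le_of_chain`). -/

namespace NLSTorus
noncomputable section

/-! ### Poisson algebra of polynomials in the u_n and their conjugates -/

open MvPolynomial in
/-- The Poisson bracket on polynomials in the conjugate variables `X (n, true)`, `X (n, false)`. -/
def poisson {ι : Type*} [Fintype ι] (F G : MvPolynomial (ι × Bool) ℂ) :
    MvPolynomial (ι × Bool) ℂ :=
  ∑ n : ι, (pderiv (n, true) F * pderiv (n, false) G - pderiv (n, false) F * pderiv (n, true) G)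

section Poisson

open MvPolynomial

lemma pderiv_comm {ι : Type*} (i j : ι × Bool) (F : MvPolynomial (ι × Bool) ℂ) :
    pderiv i (pderiv j F) = pderiv j (pderiv i F) := by
  classical
  induction F using MvPolynomial.induction_on with
  | C a => simp
  | add p q hp hq => simp [hp, hq]
  | mul_X p n hp =>
    simp only [Derivation.leibniz, pderiv_X, smul_eq_mul, map_add, hp]
    have h : ∀ a b : ι × Bool,
        pderiv a (Pi.single (M := fun _ => MvPolynomial (ι × Bool) ℂ) b 1 n) = 0 := by
      intro a b
      by_cases hb : n = b
      · subst hb; simp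
      · rw [Pi.single_eq_of_ne hb]; simp
    simp only [h]
    ring

variable {ι : Type*} [Fintype ι]

local notation "𝓟" => MvPolynomial (ι × Bool) ℂ

lemma poisson_add_left (F F' G : 𝓟) : poisson (F + F') G = poisson F G + poisson F' G := by
  simp only [poisson, map_add, ← Finset.sum_add_distrib]
  exact Finset.sum_congr rfl fun n _ => by ring

lemma poisson_add_right (F G G' : 𝓟) : poisson F (G + G') = poisson F G + poisson F G' := by
  simp only [poisson, map_add, ← Finset.sum_add_distrib]
  exact Finset.sum_congr rfl fun n _ => by ring

lemma poisson_smul_left (c : ℂ) (F G : 𝓟) : poisson (c • F) G = c • poisson F G := by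
  simp only [poisson, Derivation.map_smul, Finset.smul_sum, smul_sub, smul_mul_assoc]

lemma poisson_smul_right (c : ℂ) (F G : 𝓟) : poisson F (c • G) = c • poisson F G := by
  simp only [poisson, Derivation.map_smul, Finset.smul_sum, smul_sub, mul_smul_comm]

/-- The Poisson bracket as a bilinear map. -/
def poissonL : 𝓟 →ₗ[ℂ] 𝓟 →ₗ[ℂ] 𝓟 :=
  LinearMap.mk₂ ℂ poisson poisson_add_left poisson_smul_left poisson_add_right poisson_smul_right

@[simp] lemma poissonL_apply (F G : 𝓟) : poissonL F G = poisson F G := rfl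

lemma poisson_antisymm (F G : 𝓟) : poisson F G = -poisson G F := by
  simp only [poisson, ← Finset.sum_neg_distrib]
  exact Finset.sum_congr rfl fun n _ => by ring

/-- The three double brackets become double sums over pairs of modes. With the two indices exchanged
in the last two, the summand of the difference is antisymmetric in (n, m), because second partial
derivatives commute; the sum thus equals its opposite. -/
lemma poisson_jacobi (E F G : 𝓟) :
    poisson E (poisson F G) = poisson (poisson E F) G + poisson F (poisson E G) := by
  have key : poisson E (poisson F G) - (poisson (poisson E F) G + poisson F (poisson E G)) =
      ∑ n : ι, ∑ m : ι,
        ((pderiv (n, true) E * pderiv (n, false) (pderiv (m, true) F * pderiv (m, false) G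
            - pderiv (m, false) F * pderiv (m, true) G)
          - pderiv (n, false) E * pderiv (n, true) (pderiv (m, true) F * pderiv (m, false) G
            - pderiv (m, false) F * pderiv (m, true) G))
        - (pderiv (m, true) (pderiv (n, true) E * pderiv (n, false) F
            - pderiv (n, false) E * pderiv (n, true) F) * pderiv (m, false) G
          - pderiv (m, false) (pderiv (n, true) E * pderiv (n, false) F
            - pderiv (n, false) E * pderiv (n, true) F) * pderiv (m, true) G)
        - (pderiv (m, true) F * pderiv (m, false) (pderiv (n, true) E * pderiv (n, false) G
            - pderiv (n, false) E * pderiv (n, true) G)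
          - pderiv (m, false) F * pderiv (m, true) (pderiv (n, true) E * pderiv (n, false) G
            - pderiv (n, false) E * pderiv (n, true) G))) := by
    have h1 : poisson E (poisson F G) = ∑ n : ι, ∑ m : ι,
        (pderiv (n, true) E * pderiv (n, false) (pderiv (m, true) F * pderiv (m, false) G
            - pderiv (m, false) F * pderiv (m, true) G)
          - pderiv (n, false) E * pderiv (n, true) (pderiv (m, true) F * pderiv (m, false) G
            - pderiv (m, false) F * pderiv (m, true) G)) := by
      unfold poisson
      simp only [map_sum, Finset.mul_sum, ← Finset.sum_sub_distrib]
    have h2 : poisson (poisson E F) G = ∑ n : ι, ∑ m : ι,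
        (pderiv (m, true) (pderiv (n, true) E * pderiv (n, false) F
            - pderiv (n, false) E * pderiv (n, true) F) * pderiv (m, false) G
          - pderiv (m, false) (pderiv (n, true) E * pderiv (n, false) F
            - pderiv (n, false) E * pderiv (n, true) F) * pderiv (m, true) G) := by
      rw [Finset.sum_comm]
      unfold poisson
      simp only [map_sum, Finset.sum_mul, ← Finset.sum_sub_distrib]
    have h3 : poisson F (poisson E G) = ∑ n : ι, ∑ m : ι,
        (pderiv (m, true) F * pderiv (m, false) (pderiv (n, true) E * pderiv (n, false) G
            - pderiv (n, false) E * pderiv (n, true) G)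
          - pderiv (m, false) F * pderiv (m, true) (pderiv (n, true) E * pderiv (n, false) G
            - pderiv (n, false) E * pderiv (n, true) G)) := by
      rw [Finset.sum_comm]
      unfold poisson
      simp only [map_sum, Finset.mul_sum, ← Finset.sum_sub_distrib]
    rw [h1, h2, h3, ← sub_sub]
    simp only [← Finset.sum_sub_distrib]
  have swap : ∀ f : ι → ι → 𝓟, (∀ n m, f n m = - f m n) → ∑ n, ∑ m, f n m = 0 := by
    intro f hf
    have h : ∑ n, ∑ m, f n m = - ∑ n, ∑ m, f n m := by
      conv_lhs => rw [Finset.sum_comm]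
      simp only [← Finset.sum_neg_distrib]
      exact Finset.sum_congr rfl fun n _ => Finset.sum_congr rfl fun m _ => hf m n
    exact CharZero.eq_neg_self_iff.mp h
  rw [← sub_eq_zero, key]
  apply swap
  intro n m
  simp only [map_sub, Derivation.leibniz, smul_eq_mul]
  rw [pderiv_comm (n, true) (m, true) E, pderiv_comm (n, true) (m, false) E,
    pderiv_comm (n, false) (m, true) E, pderiv_comm (n, false) (m, false) E,
    pderiv_comm (n, true) (m, true) F, pderiv_comm (n, true) (m, false) F,
    pderiv_comm (n, false) (m, true) F, pderiv_comm (n, false) (m, false) F,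
    pderiv_comm (n, true) (m, true) G, pderiv_comm (n, true) (m, false) G,
    pderiv_comm (n, false) (m, true) G, pderiv_comm (n, false) (m, false) G]
  ring

end Poisson

/-! ### Formal Lie transforms by Deprit's recursion -/

section Deprit

variable {L : Type*} [AddCommGroup L] [Module ℂ L] (b : L →ₗ[ℂ] L →ₗ[ℂ] L) (χ : ℕ → L)

/-- The homogeneous components of the formal Lie transform generated by the sequence `χ`. -/
def lieTransform : ℕ → (L →ₗ[ℂ] L)
  | 0 => LinearMap.id
  | k + 1 => ((k + 1 : ℂ)⁻¹) • ∑ j : Fin (k + 1), lieTransform (k - j) ∘ₗ b (χ (j + 1))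

lemma lieTransform_zero : lieTransform b χ 0 = LinearMap.id := by rw [lieTransform]

lemma lieTransform_succ (k : ℕ) : lieTransform b χ (k + 1) =
    ((k + 1 : ℂ)⁻¹) • ∑ j ∈ Finset.range (k + 1), lieTransform b χ (k - j) ∘ₗ b (χ (j + 1)) := by
  rw [lieTransform, Finset.sum_range (fun j => lieTransform b χ (k - j) ∘ₗ b (χ (j + 1)))]

/-- Locality in the order: this lets the generators be chosen one after the other without disturbing
what is already constructed. -/
lemma lieTransform_congr {χ χ' : ℕ → L} {k : ℕ} (h : ∀ j, 1 ≤ j → j ≤ k → χ j = χ' j) :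
    lieTransform b χ k = lieTransform b χ' k := by
  induction k using Nat.strong_induction_on with
  | _ k ih =>
    cases k with
    | zero => simp [lieTransform_zero]
    | succ k =>
      rw [lieTransform_succ, lieTransform_succ]
      congr 1
      refine Finset.sum_congr rfl fun j hj => ?_
      have hj := Finset.mem_range.mp hj
      rw [ih (k - j) (by omega) (fun i h1 h2 => h i h1 (by omega)), h (j + 1) (by omega) (by omega)]

/-- Coefficient form of dT/dε = T ∘ ad χ(ε), where T(ε) = Σ ε^k T_k and χ(ε) = Σ ε^j χ_{j+1}.
Multiplying by k keeps the inductions free of denominators. -/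
lemma smul_lieTransform (k : ℕ) (F : L) : (k : ℂ) • lieTransform b χ k F =
    ∑ j ∈ Finset.range k, lieTransform b χ (k - 1 - j) (b (χ (j + 1)) F) := by
  cases k with
  | zero => simp
  | succ k =>
    have hk : ((k : ℂ) + 1) ≠ 0 := by exact_mod_cast Nat.succ_ne_zero k
    rw [lieTransform_succ]
    simp only [LinearMap.smul_apply, LinearMap.sum_apply, LinearMap.comp_apply]
    rw [smul_smul, Nat.cast_succ, mul_inv_cancel₀ hk, one_smul]
    rfl

variable {b}

/-- The Lie transform is a morphism for the bracket. -/
lemma lieTransform_bracket (hb : ∀ x y z, b x (b y z) = b (b x y) z + b y (b x z)) (k : ℕ)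
    (F G : L) : lieTransform b χ k (b F G) =
      ∑ p ∈ Finset.HasAntidiagonal.antidiagonal k, b (lieTransform b χ p.1 F) (lieTransform b χ p.2 G) := by
  induction k using Nat.strong_induction_on generalizing F G with
  | _ k ih =>
    rcases Nat.eq_zero_or_pos k with rfl | hk
    · simp [lieTransform_zero]
    have hk0 : (k : ℂ) ≠ 0 := by exact_mod_cast hk.ne'
    -- After multiplication by k the claim is the product rule for T(ε): on the right k = p.1 + p.2
    -- is shared between the two factors, and on the left each ad χ is a derivation by `hb`.
    apply smul_right_injective L hk0
    simp only
    rw [smul_lieTransform]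
    have h1 : ∀ j ∈ Finset.range k, lieTransform b χ (k - 1 - j) (b (χ (j + 1)) (b F G)) =
        ∑ p ∈ Finset.HasAntidiagonal.antidiagonal (k - 1 - j),
          (b (lieTransform b χ p.1 (b (χ (j + 1)) F)) (lieTransform b χ p.2 G) +
            b (lieTransform b χ p.1 F) (lieTransform b χ p.2 (b (χ (j + 1)) G))) := by
      intro j hj
      have hj := Finset.mem_range.mp hj
      rw [hb, map_add, ih _ (by omega), ih _ (by omega), Finset.sum_add_distrib]
    rw [Finset.sum_congr rfl h1]
    have h2 : (k : ℂ) • ∑ p ∈ Finset.HasAntidiagonal.antidiagonal k,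
        b (lieTransform b χ p.1 F) (lieTransform b χ p.2 G) =
        ∑ p ∈ Finset.HasAntidiagonal.antidiagonal k, (b ((p.1 : ℂ) • lieTransform b χ p.1 F)
          (lieTransform b χ p.2 G) + b (lieTransform b χ p.1 F)
            ((p.2 : ℂ) • lieTransform b χ p.2 G)) := by
      rw [Finset.smul_sum]
      refine Finset.sum_congr rfl fun p hp => ?_
      have hp := Finset.HasAntidiagonal.mem_antidiagonal.mp hp
      rw [map_smul, map_smul, LinearMap.smul_apply, ← add_smul, ← hp]
      push_cast; rfl
    rw [h2]
    simp only [smul_lieTransform, map_sum, LinearMap.sum_apply, Finset.sum_add_distrib]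
    congr 1
    · rw [Finset.sum_sigma', Finset.sum_sigma']
      refine Finset.sum_bij' (fun x _ => ⟨(x.2.1 + x.1 + 1, x.2.2), x.1⟩)
        (fun x _ => ⟨x.2, (x.1.1 - 1 - x.2, x.1.2)⟩) ?_ ?_ ?_ ?_ ?_
      · rintro ⟨j, a, c⟩ h
        simp only [Finset.mem_sigma, Finset.mem_range, Finset.HasAntidiagonal.mem_antidiagonal] at h ⊢
        omega
      · rintro ⟨⟨a, c⟩, j⟩ h
        simp only [Finset.mem_sigma, Finset.mem_range, Finset.HasAntidiagonal.mem_antidiagonal] at h ⊢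
        omega
      · rintro ⟨j, a, c⟩ h
        simp only [Sigma.mk.injEq, heq_eq_eq, Prod.mk.injEq, and_true, true_and]
        omega
      · rintro ⟨⟨a, c⟩, j⟩ h
        simp only [Finset.mem_sigma, Finset.mem_range, Finset.HasAntidiagonal.mem_antidiagonal] at h
        simp only [Sigma.mk.injEq, heq_eq_eq, Prod.mk.injEq, and_true]
        omega
      · rintro ⟨j, a, c⟩ h
        simp only
        rw [show a + j + 1 - 1 - j = a by omega]
    · rw [Finset.sum_sigma', Finset.sum_sigma']
      refine Finset.sum_bij' (fun x _ => ⟨(x.2.1, x.2.2 + x.1 + 1), x.1⟩)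
        (fun x _ => ⟨x.2, (x.1.1, x.1.2 - 1 - x.2)⟩) ?_ ?_ ?_ ?_ ?_
      · rintro ⟨j, a, c⟩ h
        simp only [Finset.mem_sigma, Finset.mem_range, Finset.HasAntidiagonal.mem_antidiagonal] at h ⊢
        omega
      · rintro ⟨⟨a, c⟩, j⟩ h
        simp only [Finset.mem_sigma, Finset.mem_range, Finset.HasAntidiagonal.mem_antidiagonal] at h ⊢
        omega
      · rintro ⟨j, a, c⟩ h
        simp only [Sigma.mk.injEq, heq_eq_eq, Prod.mk.injEq, true_and]
        omega
      · rintro ⟨⟨a, c⟩, j⟩ h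
        simp only [Finset.mem_sigma, Finset.mem_range, Finset.HasAntidiagonal.mem_antidiagonal] at h
        simp only [Sigma.mk.injEq, heq_eq_eq, Prod.mk.injEq, and_true, true_and]
        omega
      · rintro ⟨j, a, c⟩ h
        simp only
        rw [show c + j + 1 - 1 - j = c by omega]

/-- A bound for the components of the Lie transform, in terms of bounds for the brackets with
the generators. -/
def lieBound (κ : ℕ → ℕ → ℝ) : ℕ → ℕ → ℝ
  | 0, _ => 1
  | k + 1, m => ∑ j : Fin (k + 1), κ m (j + 1) * lieBound κ (k - j) (m + (j + 1))

lemma lieBound_nonneg {κ : ℕ → ℕ → ℝ} (hκ : ∀ m j, 0 ≤ κ m j) (k m : ℕ) : 0 ≤ lieBound κ k m := by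
  induction k using Nat.strong_induction_on generalizing m with
  | _ k ih =>
    cases k with
    | zero => simp [lieBound]
    | succ k =>
      rw [lieBound]
      exact Finset.sum_nonneg fun j _ => mul_nonneg (hκ _ _) (ih _ (by omega) _)

/-- Graded bounds are propagated by the Lie transform. -/
lemma lieTransform_bound {κ : ℕ → ℕ → ℝ} (Q : ℕ → ℝ → L → Prop)
    (hzero : ∀ m, Q m 0 0)
    (hadd : ∀ m B B' F F', Q m B F → Q m B' F' → Q m (B + B') (F + F'))
    (hsmul : ∀ m B F (c : ℂ), ‖c‖ ≤ 1 → Q m B F → Q m B (c • F)) {k : ℕ}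
    (hbr : ∀ m j B F, 1 ≤ j → j ≤ k → 0 ≤ B → Q m B F → Q (m + j) (κ m j * B) (b (χ j) F))
    (hκ : ∀ m j, 0 ≤ κ m j)
    {m : ℕ} {B : ℝ} (hB : 0 ≤ B) {F : L} (hF : Q m B F) :
    Q (m + k) (lieBound κ k m * B) (lieTransform b χ k F) := by
  induction k using Nat.strong_induction_on generalizing m B F with
  | _ k ih =>
    cases k with
    | zero => simpa [lieTransform_zero, lieBound] using hF
    | succ k =>
      rw [lieTransform, lieBound, LinearMap.smul_apply]
      -- The gain 1/(k + 1) is discarded: only the uniformity of the bounds over finite sets of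
      -- modes matters, not their growth in k.
      have hc : ‖((k + 1 : ℂ)⁻¹)‖ ≤ 1 := by
        rw [norm_inv]
        apply inv_le_one_of_one_le₀
        have : ‖((k + 1 : ℕ) : ℂ)‖ = (k + 1 : ℕ) := Complex.norm_natCast _
        push_cast at this
        rw [this]
        linarith [(Nat.cast_nonneg k : (0 : ℝ) ≤ k)]
      apply hsmul _ _ _ _ hc
      rw [LinearMap.sum_apply, Finset.sum_mul]
      have hsum : ∀ (s : Finset (Fin (k + 1))) (β : Fin (k + 1) → ℝ) (P : Fin (k + 1) → L),
          (∀ j, Q (m + (k + 1)) (β j) (P j)) → Q (m + (k + 1)) (∑ j ∈ s, β j) (∑ j ∈ s, P j) := by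
        classical
        intro s β P h
        induction s using Finset.induction_on with
        | empty => simpa using hzero _
        | insert j s hj hs => rw [Finset.sum_insert hj, Finset.sum_insert hj]; exact hadd _ _ _ _ _ (h j) hs
      refine hsum _ _ _ fun j => ?_
      have hj := j.2
      have h1 := hbr m (j + 1) B F (by omega) (by omega) hB hF
      have h2 := ih (k - j) (by omega) (fun m i B F h1 h2 => hbr m i B F h1 (by omega))
        (mul_nonneg (hκ _ _) hB) h1
      rw [show m + (k + 1) = m + (↑j + 1) + (k - ↑j) by omega]
      rw [LinearMap.comp_apply]
      convert h2 using 1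
      ring

end Deprit

end

noncomputable section

/-! ### Lattice norms, truncated Sobolev norms and the metric -/

section Norms

variable {d : ℕ}

/-- An integer vector, as a point of Euclidean space. -/
def vec (n : Fin d → ℤ) : EuclideanSpace ℝ (Fin d) := WithLp.toLp 2 fun i => (n i : ℝ)

@[simp] lemma vec_apply (n : Fin d → ℤ) (i : Fin d) : vec n i = n i := rfl

lemma vec_add (m n : Fin d → ℤ) : vec (m + n) = vec m + vec n := by
  ext i; simp

lemma vec_sub (m n : Fin d → ℤ) : vec (m - n) = vec m - vec n := by
  ext i; simp

lemma nrm_eq_norm (n : Fin d → ℤ) : nrm n = ‖vec n‖ := by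
  simp [nrm, EuclideanSpace.norm_eq]

lemma nrm_nonneg (n : Fin d → ℤ) : 0 ≤ nrm n := Real.sqrt_nonneg _

@[simp] lemma nrm_zero : nrm (0 : Fin d → ℤ) = 0 := by simp [nrm]

@[simp] lemma nrm_neg (n : Fin d → ℤ) : nrm (-n) = nrm n := by simp [nrm]

lemma nrm_add_le (m n : Fin d → ℤ) : nrm (m + n) ≤ nrm m + nrm n := by
  simp only [nrm_eq_norm, vec_add]; exact norm_add_le _ _

lemma nrm_sub_comm (m n : Fin d → ℤ) : nrm (m - n) = nrm (n - m) := by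
  rw [← nrm_neg, neg_sub]

lemma nrm_sum_le {α : Type*} (t : Finset α) (f : α → Fin d → ℤ) :
    nrm (∑ i ∈ t, f i) ≤ ∑ i ∈ t, nrm (f i) := by
  classical
  induction t using Finset.induction_on with
  | empty => simp
  | insert a t ha ih =>
    rw [Finset.sum_insert ha, Finset.sum_insert ha]
    exact (nrm_add_le _ _).trans (by linarith)

lemma abs_apply_le_nrm (n : Fin d → ℤ) (i : Fin d) : |(n i : ℝ)| ≤ nrm n := by
  rw [nrm_eq_norm]
  simpa using PiLp.norm_apply_le (vec n) i

lemma bracket_sq (n : Fin d → ℤ) : bracket n ^ 2 = 1 + nrm n ^ 2 :=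
  Real.sq_sqrt (by positivity)

lemma bracket_nonneg (n : Fin d → ℤ) : 0 ≤ bracket n := Real.sqrt_nonneg _

lemma one_le_bracket (n : Fin d → ℤ) : 1 ≤ bracket n := by
  nlinarith [bracket_sq n, bracket_nonneg n, sq_nonneg (nrm n)]

lemma bracket_pos (n : Fin d → ℤ) : 0 < bracket n := zero_lt_one.trans_le (one_le_bracket n)

lemma nrm_le_bracket (n : Fin d → ℤ) : nrm n ≤ bracket n :=
  abs_le_of_sq_le_sq' (by linarith [bracket_sq n]) (bracket_nonneg n) |>.2

@[simp] lemma bracket_neg (n : Fin d → ℤ) : bracket (-n) = bracket n := by simp [bracket]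

lemma bracket_mono {m n : Fin d → ℤ} (h : nrm m ≤ nrm n) : bracket m ≤ bracket n :=
  Real.sqrt_le_sqrt (by nlinarith [nrm_nonneg m])

lemma bracket_le_mul {m n : Fin d → ℤ} {a : ℝ} (ha : 1 ≤ a) (h : nrm m ≤ a * nrm n) :
    bracket m ≤ a * bracket n := by
  refine abs_le_of_sq_le_sq' ?_ (mul_nonneg (by linarith) (bracket_nonneg n)) |>.2
  rw [mul_pow, bracket_sq, bracket_sq]
  have := pow_le_pow_left₀ (nrm_nonneg m) h 2
  rw [mul_pow] at this
  nlinarith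

lemma bracket_rpow_pos (n : Fin d → ℤ) (s : ℝ) : 0 < bracket n ^ s :=
  Real.rpow_pos_of_pos (bracket_pos n) s

lemma bracket_rpow_two_mul (n : Fin d → ℤ) (s : ℝ) : bracket n ^ (2 * s) = (bracket n ^ s) ^ 2 := by
  rw [mul_comm, Real.rpow_mul (bracket_nonneg n)]; norm_cast

/-- ⟨n⟩^{2d} = (1 + |n|^2)^d dominates the product of the 1 + n_i^2, and the sum of the inverse
product factors over the coordinates. -/
lemma summable_bracket :
    Summable fun n : Fin d → ℤ => bracket n ^ (-(2 * d : ℝ)) := by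
  have hZ : Summable fun k : ℤ => (1 + (k : ℝ) ^ 2)⁻¹ := by
    have h := (Real.summable_one_div_int_pow (p := 2)).mpr (by norm_num)
    refine Summable.of_norm_bounded_eventually h ?_
    rw [Filter.eventually_cofinite]
    refine (Set.finite_singleton (0 : ℤ)).subset fun k hk => ?_
    by_contra h0
    apply hk
    have hk0 : (0 : ℝ) < (k : ℝ) ^ 2 := by
      have : (k : ℝ) ≠ 0 := by exact_mod_cast h0
      positivity
    rw [Real.norm_of_nonneg (by positivity), one_div]
    exact inv_anti₀ hk0 (by linarith)
  refine summable_of_sum_le (c := (∑' k : ℤ, (1 + (k : ℝ) ^ 2)⁻¹) ^ d)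
    (fun n => (bracket_rpow_pos n _).le) fun u => ?_
  classical
  let t : Finset ℤ := u.biUnion fun n => Finset.univ.image n
  calc ∑ n ∈ u, bracket n ^ (-(2 * d : ℝ))
      ≤ ∑ n ∈ u, ∏ i, (1 + (n i : ℝ) ^ 2)⁻¹ := by
        refine Finset.sum_le_sum fun n _ => ?_
        rw [Real.rpow_neg (bracket_nonneg n), Finset.prod_inv_distrib]
        apply inv_anti₀ (Finset.prod_pos fun i _ => by positivity)
        have : bracket n ^ (2 * d : ℝ) = ∏ _i : Fin d, (1 + nrm n ^ 2) := by
          rw [Finset.prod_const, Finset.card_univ, Fintype.card_fin, ← bracket_sq, ← pow_mul]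
          norm_cast
        rw [this]
        refine Finset.prod_le_prod (fun i _ => by positivity) fun i _ => ?_
        have := pow_le_pow_left₀ (abs_nonneg _) (abs_apply_le_nrm n i) 2
        rw [sq_abs] at this
        linarith
    _ ≤ ∑ n ∈ Fintype.piFinset fun _ : Fin d => t, ∏ i, (1 + (n i : ℝ) ^ 2)⁻¹ := by
        refine Finset.sum_le_sum_of_subset_of_nonneg (fun n hn => ?_)
          fun n _ _ => Finset.prod_nonneg fun i _ => by positivity
        rw [Fintype.mem_piFinset]
        intro i
        exact Finset.mem_biUnion.mpr ⟨n, hn, Finset.mem_image_of_mem _ (Finset.mem_univ _)⟩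
    _ = ∏ _i : Fin d, ∑ k ∈ t, (1 + (k : ℝ) ^ 2)⁻¹ := by
        rw [Finset.prod_univ_sum]
    _ ≤ ∏ _i : Fin d, ∑' k : ℤ, (1 + (k : ℝ) ^ 2)⁻¹ := by
        refine Finset.prod_le_prod (fun i _ => Finset.sum_nonneg fun k _ => by positivity)
          fun i _ => hZ.sum_le_tsum _ fun k _ => by positivity
    _ = _ := by simp

/-- The norm of `h^s`, restricted to the modes in a finite set. -/
def sobNorm (s : ℝ) (S : Finset (Fin d → ℤ)) (a : (Fin d → ℤ) → ℝ) : ℝ :=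
  Real.sqrt (∑ n ∈ S, bracket n ^ (2 * s) * a n ^ 2)

lemma sobNorm_nonneg (s : ℝ) (S : Finset (Fin d → ℤ)) (a : (Fin d → ℤ) → ℝ) :
    0 ≤ sobNorm s S a := Real.sqrt_nonneg _

lemma sobNorm_sq (s : ℝ) (S : Finset (Fin d → ℤ)) (a : (Fin d → ℤ) → ℝ) :
    sobNorm s S a ^ 2 = ∑ n ∈ S, bracket n ^ (2 * s) * a n ^ 2 :=
  Real.sq_sqrt (Finset.sum_nonneg fun n _ => mul_nonneg (bracket_rpow_pos n _).le (sq_nonneg _))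

/-- The constant of the embedding of `h^d` in `ℓ¹`. -/
def embConst (d : ℕ) : ℝ := Real.sqrt (∑' n : Fin d → ℤ, bracket n ^ (-(2 * d : ℝ))) + 1

lemma embConst_ge_one : 1 ≤ embConst d := by
  unfold embConst; linarith [Real.sqrt_nonneg (∑' n : Fin d → ℤ, bracket n ^ (-(2 * d : ℝ)))]

/-- Cauchy-Schwarz with ⟨n⟩^{-d} ⟨n⟩^d, then ⟨n⟩^d ≤ Q^{-(s-d)} ⟨n⟩^s on `S`. This gain on high
modes is the source of the negative power of M in the theorem. -/
lemma sum_le_sobNorm {s Q : ℝ} (hs : (d : ℝ) ≤ s) (hQ : 0 < Q)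
    {S : Finset (Fin d → ℤ)} (hS : ∀ n ∈ S, Q ≤ bracket n) {a : (Fin d → ℤ) → ℝ}
    (S' : Finset (Fin d → ℤ)) (hSS : S ⊆ S') :
    ∑ n ∈ S, a n ≤ embConst d * Q ^ (-(s - d)) * sobNorm s S' a := by
  have h1 : (∑ n ∈ S, a n) ^ 2 ≤
      (∑ n ∈ S, bracket n ^ (-(2 * d : ℝ))) * ∑ n ∈ S, bracket n ^ (2 * d : ℝ) * a n ^ 2 := by
    refine Finset.sum_sq_le_sum_mul_sum_of_sq_le_mul S (fun n _ => (bracket_rpow_pos n _).le)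
      (fun n _ => mul_nonneg (bracket_rpow_pos n _).le (sq_nonneg _)) fun n _ => le_of_eq ?_
    rw [← mul_assoc, ← Real.rpow_add (bracket_pos n)]; simp
  have h2 : ∑ n ∈ S, bracket n ^ (-(2 * d : ℝ)) ≤ (embConst d) ^ 2 := by
    have h3 := summable_bracket.sum_le_tsum S fun n _ => (bracket_rpow_pos n _).le
    have h4 : 0 ≤ ∑' n : Fin d → ℤ, bracket n ^ (-(2 * d : ℝ)) :=
      tsum_nonneg fun n => (bracket_rpow_pos n _).le
    refine h3.trans ?_
    unfold embConst
    nlinarith [Real.sq_sqrt h4, Real.sqrt_nonneg (∑' n : Fin d → ℤ, bracket n ^ (-(2 * d : ℝ)))]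
  have h5 : ∑ n ∈ S, bracket n ^ (2 * d : ℝ) * a n ^ 2 ≤ (Q ^ (-(s - d))) ^ 2 * sobNorm s S' a ^ 2 := by
    rw [sobNorm_sq, Finset.mul_sum]
    refine (Finset.sum_le_sum fun n hn => ?_).trans (Finset.sum_le_sum_of_subset_of_nonneg hSS
      fun n _ _ => mul_nonneg (sq_nonneg _) (mul_nonneg (bracket_rpow_pos n _).le (sq_nonneg _)))
    rw [← mul_assoc]
    refine mul_le_mul_of_nonneg_right ?_ (sq_nonneg _)
    rw [bracket_rpow_two_mul, bracket_rpow_two_mul, ← mul_pow]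
    refine pow_le_pow_left₀ (bracket_rpow_pos n _).le ?_ 2
    rw [Real.rpow_neg hQ.le, inv_mul_eq_div, le_div_iff₀ (Real.rpow_pos_of_pos hQ _)]
    calc bracket n ^ (d : ℝ) * Q ^ (s - d) ≤ bracket n ^ (d : ℝ) * bracket n ^ (s - d) :=
          mul_le_mul_of_nonneg_left (Real.rpow_le_rpow hQ.le (hS n hn) (by linarith))
            (bracket_rpow_pos n _).le
      _ = bracket n ^ s := by rw [← Real.rpow_add (bracket_pos n)]; congr 1; ring
  refine abs_le_of_sq_le_sq' ?_ ?_ |>.2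
  · rw [mul_pow, mul_pow, mul_assoc]
    exact h1.trans (mul_le_mul h2 h5 (Finset.sum_nonneg fun n _ =>
      mul_nonneg (bracket_rpow_pos n _).le (sq_nonneg _)) (sq_nonneg _))
  · have := embConst_ge_one (d := d)
    exact mul_nonneg (mul_nonneg (by linarith) (Real.rpow_nonneg hQ.le _)) (sobNorm_nonneg _ _ _)

lemma sum_le_sobNorm_of_subset {s : ℝ} (hs : (d : ℝ) ≤ s) {S : Finset (Fin d → ℤ)}
    {a : (Fin d → ℤ) → ℝ} : ∑ n ∈ S, a n ≤ embConst d * sobNorm s S a := by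
  simpa using sum_le_sobNorm hs one_pos (fun n _ => one_le_bracket n) (a := a) S subset_rfl

/-- The bilinear form of the metric. -/
def metric (G : Matrix (Fin d) (Fin d) ℝ) (x y : EuclideanSpace ℝ (Fin d)) : ℝ :=
  (x : Fin d → ℝ) ⬝ᵥ (G.mulVec (y : Fin d → ℝ))

lemma freq_eq_metric (G : Matrix (Fin d) (Fin d) ℝ) (n : Fin d → ℤ) :
    freq G n = metric G (vec n) (vec n) := rfl

lemma metric_add_left (G : Matrix (Fin d) (Fin d) ℝ) (x x' y : EuclideanSpace ℝ (Fin d)) :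
    metric G (x + x') y = metric G x y + metric G x' y := by
  simp [metric, add_dotProduct]

lemma metric_add_right (G : Matrix (Fin d) (Fin d) ℝ) (x y y' : EuclideanSpace ℝ (Fin d)) :
    metric G x (y + y') = metric G x y + metric G x y' := by
  simp [metric, Matrix.mulVec_add, dotProduct_add]

lemma metric_smul_right (G : Matrix (Fin d) (Fin d) ℝ) (c : ℝ) (x y : EuclideanSpace ℝ (Fin d)) :
    metric G x (c • y) = c * metric G x y := by
  simp [metric, Matrix.mulVec_smul, dotProduct_smul]

lemma metric_smul_left (G : Matrix (Fin d) (Fin d) ℝ) (c : ℝ) (x y : EuclideanSpace ℝ (Fin d)) :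
    metric G (c • x) y = c * metric G x y := by
  simp [metric, smul_dotProduct]

lemma metric_sub_left (G : Matrix (Fin d) (Fin d) ℝ) (x x' y : EuclideanSpace ℝ (Fin d)) :
    metric G (x - x') y = metric G x y - metric G x' y := by
  simp [metric, sub_dotProduct]

lemma metric_comm {G : Matrix (Fin d) (Fin d) ℝ} (hG : G.IsHermitian)
    (x y : EuclideanSpace ℝ (Fin d)) : metric G x y = metric G y x := by
  have hT : G.transpose = G := by simpa [Matrix.IsHermitian] using hG
  unfold metric
  rw [Matrix.dotProduct_mulVec, ← Matrix.mulVec_transpose, hT, dotProduct_comm]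

/-- The lower bound is the minimum over the compact unit sphere; when the sphere is empty the space
is zero and any constant serves. -/
lemma exists_metric_bounds {G : Matrix (Fin d) (Fin d) ℝ} (hG : G.PosDef) :
    ∃ g A : ℝ, 0 < g ∧ 1 ≤ A ∧ (∀ x, g * ‖x‖ ^ 2 ≤ metric G x x) ∧
      ∀ x y, |metric G x y| ≤ A * ‖x‖ * ‖y‖ := by
  have hcont : Continuous fun x : EuclideanSpace ℝ (Fin d) => metric G x x := by
    unfold metric dotProduct Matrix.mulVec dotProduct
    fun_prop
  have hlow : ∃ g : ℝ, 0 < g ∧ ∀ x : EuclideanSpace ℝ (Fin d), g * ‖x‖ ^ 2 ≤ metric G x x := by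
    by_cases hne : (Metric.sphere (0 : EuclideanSpace ℝ (Fin d)) 1).Nonempty
    · obtain ⟨x0, hx0, hmin⟩ := (isCompact_sphere _ _).exists_isMinOn hne hcont.continuousOn
      have hpos : 0 < metric G x0 x0 := by
        have h0 : (x0 : Fin d → ℝ) ≠ 0 := by
          intro h
          have : x0 = 0 := by ext i; exact congrFun h i
          simp [this] at hx0
        simpa [metric] using hG.dotProduct_mulVec_pos h0
      refine ⟨_, hpos, fun x => ?_⟩
      rcases eq_or_ne x 0 with rfl | hx
      · simp [metric]
      have hx' : 0 < ‖x‖ := norm_pos_iff.mpr hx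
      have h1 : metric G x0 x0 ≤ metric G (‖x‖⁻¹ • x) (‖x‖⁻¹ • x) := by
        apply hmin
        simp [norm_smul, hx'.ne']
      rw [metric_smul_left, metric_smul_right] at h1
      calc metric G x0 x0 * ‖x‖ ^ 2 ≤ (‖x‖⁻¹ * (‖x‖⁻¹ * metric G x x)) * ‖x‖ ^ 2 := by gcongr
        _ = metric G x x := by field_simp
    · refine ⟨1, one_pos, fun x => ?_⟩
      have hx : x = 0 := by
        by_contra hx
        have hx' : 0 < ‖x‖ := norm_pos_iff.mpr hx
        exact hne ⟨‖x‖⁻¹ • x, by simp [norm_smul, hx'.ne']⟩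
      simp [hx, metric]
  obtain ⟨g, hg, hlow⟩ := hlow
  refine ⟨g, 1 + ∑ i, ∑ j, |G i j|, hg, ?_, hlow, fun x y => ?_⟩
  · have : 0 ≤ ∑ i, ∑ j, |G i j| := Finset.sum_nonneg fun i _ => Finset.sum_nonneg fun j _ => abs_nonneg _
    linarith
  · have h1 : |metric G x y| ≤ ∑ i, ∑ j, |G i j| * ‖x‖ * ‖y‖ := by
      unfold metric dotProduct Matrix.mulVec dotProduct
      refine (Finset.abs_sum_le_sum_abs _ _).trans (Finset.sum_le_sum fun i _ => ?_)
      rw [Finset.mul_sum]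
      refine (Finset.abs_sum_le_sum_abs _ _).trans (Finset.sum_le_sum fun j _ => ?_)
      rw [abs_mul, abs_mul]
      have hx : |x i| ≤ ‖x‖ := by simpa using PiLp.norm_apply_le x i
      have hy : |y j| ≤ ‖y‖ := by simpa using PiLp.norm_apply_le y j
      calc |x i| * (|G i j| * |y j|) ≤ ‖x‖ * (|G i j| * ‖y‖) := by gcongr
        _ = _ := by ring
    refine h1.trans ?_
    simp only [← Finset.sum_mul]
    have := norm_nonneg x
    have := norm_nonneg y
    nlinarith [mul_nonneg (norm_nonneg x) (norm_nonneg y)]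

lemma exists_freq_bounds {G : Matrix (Fin d) (Fin d) ℝ} (hG : G.PosDef) :
    ∃ g A : ℝ, 0 < g ∧ 1 ≤ A ∧ ∀ n, g * nrm n ^ 2 ≤ freq G n ∧ |freq G n| ≤ A * nrm n ^ 2 := by
  obtain ⟨g, A, hg, hA, h1, h2⟩ := exists_metric_bounds hG
  refine ⟨g, A, hg, hA, fun n => ⟨?_, ?_⟩⟩
  · rw [nrm_eq_norm]; exact h1 _
  · rw [nrm_eq_norm, sq, ← mul_assoc]; exact h2 (vec n) (vec n)

end Norms

end

noncomputable section

/-! ### Homogeneous polynomials as sums over words of signed letters -/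

section Words

open MvPolynomial

/-- Derivatives are taken slot by slot, so coefficients indexed by words never have to be
symmetrised. -/
lemma pderiv_prod_X {ι : Type*} [DecidableEq ι] (a : ι × Bool) : ∀ {p : ℕ} (w : Fin (p + 1) → ι × Bool),
    pderiv a (∏ i, X (w i) : MvPolynomial (ι × Bool) ℂ) = ∑ i, if w i = a then ∏ j, X (w (i.succAbove j)) else 0
  | 0, w => by
    rw [Fin.prod_univ_succ, Fin.sum_univ_succ]
    simp [pderiv_X, Pi.single_apply]
  | p + 1, w => by
    rw [Fin.prod_univ_succ, Derivation.leibniz, pderiv_prod_X a (fun i => w i.succ),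
      Fin.sum_univ_succ (n := p + 1), smul_eq_mul, smul_eq_mul, Finset.mul_sum, add_comm]
    congr 1
    · rw [pderiv_X, Pi.single_apply]
      simp
    · refine Finset.sum_congr rfl fun i _ => ?_
      rw [mul_ite, mul_zero, Fin.prod_univ_succ]
      simp

variable {ι : Type*} [Fintype ι]

local notation "𝓟" => MvPolynomial (ι × Bool) ℂ

/-- Insertion of a letter in a word. -/
abbrev ins {α : Type*} {p : ℕ} (i : Fin (p + 1)) (c : α) (v : Fin p → α) : Fin (p + 1) → α :=
  Fin.insertNth (α := fun _ => α) i c v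

lemma sum_ins {α M : Type*} [Fintype α] [AddCommMonoid M] {p : ℕ} (i : Fin (p + 1))
    (f : (Fin (p + 1) → α) → M) : ∑ w, f w = ∑ c, ∑ v, f (ins i c v) := by
  rw [← Equiv.sum_comp (Fin.insertNthEquiv (fun _ => α) i) f, Fintype.sum_prod_type]
  rfl

lemma sum_append {α M : Type*} [Fintype α] [AddCommMonoid M] {p q : ℕ}
    (f : (Fin p → α) → (Fin q → α) → M) : ∑ v, ∑ v', f v v' =
      ∑ y : Fin (p + q) → α, f (fun i => y (Fin.castAdd q i)) (fun i => y (Fin.natAdd p i)) := by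
  rw [← Equiv.sum_comp (Fin.appendEquiv p q), Fintype.sum_prod_type]
  simp [Fin.appendEquiv]

/-- The homogeneous polynomial of degree `p` with coefficients `h`. -/
def poly {p : ℕ} (h : (Fin p → ι × Bool) → ℂ) : 𝓟 := ∑ w, C (h w) * ∏ i, X (w i)

lemma poly_add {p : ℕ} (h h' : (Fin p → ι × Bool) → ℂ) :
    poly (fun w => h w + h' w) = poly h + poly h' := by
  simp only [poly, ← Finset.sum_add_distrib, C_add, add_mul]

lemma poly_zero {p : ℕ} : poly (fun _ : Fin p → ι × Bool => 0) = 0 := by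
  simp [poly]

lemma poly_smul {p : ℕ} (c : ℂ) (h : (Fin p → ι × Bool) → ℂ) :
    poly (fun w => c * h w) = c • poly h := by
  simp only [poly, Finset.smul_sum, C_mul, smul_eq_C_mul, mul_assoc]

lemma poly_sum {p : ℕ} {β : Type*} (t : Finset β) (h : β → (Fin p → ι × Bool) → ℂ) :
    poly (fun w => ∑ b ∈ t, h b w) = ∑ b ∈ t, poly (h b) := by
  simp only [poly, map_sum, Finset.sum_mul]
  rw [Finset.sum_comm]

lemma eval_poly {p : ℕ} (h : (Fin p → ι × Bool) → ℂ) (x : ι × Bool → ℂ) :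
    eval x (poly h) = ∑ w, h w * ∏ i, x (w i) := by
  simp [poly, map_sum, map_prod]

lemma poly_mul {p q : ℕ} (h : (Fin p → ι × Bool) → ℂ) (h' : (Fin q → ι × Bool) → ℂ) :
    poly h * poly h' = poly (fun y : Fin (p + q) → ι × Bool =>
      h (fun i => y (Fin.castAdd q i)) * h' (fun i => y (Fin.natAdd p i))) := by
  simp only [poly, Finset.sum_mul_sum]
  rw [sum_append]
  refine Finset.sum_congr rfl fun y _ => ?_
  rw [C_mul, Fin.prod_univ_add]
  ring

/-- The coefficients of the contribution of a pair of slots to a Poisson bracket. -/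
def contract {p q : ℕ} (h : (Fin (p + 1) → ι × Bool) → ℂ) (h' : (Fin (q + 1) → ι × Bool) → ℂ)
    (i : Fin (p + 1)) (j : Fin (q + 1)) (y : Fin (p + q) → ι × Bool) : ℂ :=
  ∑ n : ι, (h (ins i (n, true) fun l => y (Fin.castAdd q l)) *
      h' (ins j (n, false) fun l => y (Fin.natAdd p l)) -
    h (ins i (n, false) fun l => y (Fin.castAdd q l)) *
      h' (ins j (n, true) fun l => y (Fin.natAdd p l)))

lemma norm_contract_le {p q : ℕ} (h : (Fin (p + 1) → ι × Bool) → ℂ)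
    (h' : (Fin (q + 1) → ι × Bool) → ℂ) (i : Fin (p + 1)) (j : Fin (q + 1))
    (y : Fin (p + q) → ι × Bool) : ‖contract h h' i j y‖ ≤
      ∑ c : ι × Bool, ‖h (ins i (c.1, !c.2) fun l => y (Fin.castAdd q l))‖ *
        ‖h' (ins j c fun l => y (Fin.natAdd p l))‖ := by
  unfold contract
  rw [Fintype.sum_prod_type]
  refine (norm_sum_le _ _).trans (Finset.sum_le_sum fun n _ => ?_)
  refine (norm_sub_le _ _).trans ?_
  simp only [Fintype.sum_bool, norm_mul, Bool.not_true, Bool.not_false]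
  linarith

lemma poisson_sum_left {β : Type*} (t : Finset β) (F : β → 𝓟) (G : 𝓟) :
    poisson (∑ b ∈ t, F b) G = ∑ b ∈ t, poisson (F b) G := by
  simp only [← poissonL_apply, map_sum, LinearMap.sum_apply]

lemma poisson_sum_right {β : Type*} (t : Finset β) (F : 𝓟) (G : β → 𝓟) :
    poisson F (∑ b ∈ t, G b) = ∑ b ∈ t, poisson F (G b) := by
  simp only [← poissonL_apply, map_sum]

variable [DecidableEq ι]

lemma pderiv_poly {p : ℕ} (a : ι × Bool) (h : (Fin (p + 1) → ι × Bool) → ℂ) :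
    pderiv a (poly h) = ∑ i, poly (fun v => h (ins i a v)) := by
  simp only [poly, map_sum, pderiv_C_mul, pderiv_prod_X, Finset.mul_sum]
  rw [Finset.sum_comm]
  refine Finset.sum_congr rfl fun i _ => ?_
  rw [sum_ins i, Finset.sum_eq_single a]
  · simp
  · intro b _ hb
    simp [hb]
  · simp

lemma poisson_poly {p q : ℕ} (h : (Fin (p + 1) → ι × Bool) → ℂ)
    (h' : (Fin (q + 1) → ι × Bool) → ℂ) :
    poisson (poly h) (poly h') = ∑ i, ∑ j, poly (contract h h' i j) := by
  have key : ∀ i j, poly (contract h h' i j) = ∑ n : ι,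
      (poly (fun v => h (ins i (n, true) v)) * poly (fun v => h' (ins j (n, false) v)) -
        poly (fun v => h (ins i (n, false) v)) * poly (fun v => h' (ins j (n, true) v))) := by
    intro i j
    unfold contract
    rw [poly_sum]
    refine Finset.sum_congr rfl fun n _ => ?_
    rw [poly_mul, poly_mul, sub_eq_add_neg, ← neg_one_smul ℂ (poly _), ← poly_smul, ← poly_add]
    congr 1
    ext y
    ring
  simp only [key]
  unfold poisson
  simp only [pderiv_poly, Finset.sum_mul_sum, ← Finset.sum_sub_distrib]
  rw [Finset.sum_comm]
  refine Finset.sum_congr rfl fun i _ => ?_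
  rw [Finset.sum_comm]

/-- The sign of a letter. -/
def sgn (b : Bool) : ℤ := if b then 1 else -1

@[simp] lemma sgn_true : sgn true = 1 := rfl
@[simp] lemma sgn_false : sgn false = -1 := rfl

/-- The quadratic Hamiltonian with diagonal coefficients. -/
def diagHam (μ : ι → ℝ) : 𝓟 := ∑ n, C (μ n : ℂ) * (X (n, true) * X (n, false))

lemma pderiv_diagHam (μ : ι → ℝ) (n : ι) (b : Bool) :
    pderiv (n, b) (diagHam μ) = C (μ n : ℂ) * X (n, !b) := by
  unfold diagHam
  rw [map_sum, Finset.sum_eq_single n]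
  · rw [pderiv_C_mul, Derivation.leibniz, pderiv_X, pderiv_X]
    cases b <;> simp
  · intro m _ hm
    rw [pderiv_C_mul, Derivation.leibniz, pderiv_X_of_ne, pderiv_X_of_ne] <;> simp [hm]
  · simp

/-- The bracket with a diagonal quadratic Hamiltonian is a derivation with every letter as an
eigenvector. Monomials are therefore eigenvectors and eigenvalues add; for μ = `freq G` the
eigenvalue is the divisor of the normal form. -/
lemma poisson_prod_X_diagHam (μ : ι → ℝ) {p : ℕ} (w : Fin p → ι × Bool) :
    poisson (∏ i, X (w i)) (diagHam μ) =
      C ((∑ i, (sgn (w i).2 : ℝ) * μ (w i).1 : ℝ) : ℂ) * ∏ i, X (w i) := by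
  have hX : ∀ c : ι × Bool, poisson (X c) (diagHam μ) =
      C (((sgn c.2 : ℝ) * μ c.1 : ℝ) : ℂ) * X c := by
    rintro ⟨n, b⟩
    unfold poisson
    simp only [pderiv_diagHam, pderiv_X, Pi.single_apply, Prod.mk.injEq]
    cases b <;> simp [Finset.sum_ite_eq]
  have hmul : ∀ F G : 𝓟, poisson (F * G) (diagHam μ) =
      F * poisson G (diagHam μ) + G * poisson F (diagHam μ) := by
    intro F G
    unfold poisson
    rw [Finset.mul_sum, Finset.mul_sum, ← Finset.sum_add_distrib]
    refine Finset.sum_congr rfl fun n _ => ?_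
    simp only [Derivation.leibniz, smul_eq_mul]
    ring
  induction p with
  | zero => simp [poisson]
  | succ p ih =>
    rw [Fin.prod_univ_succ, hmul, hX, ih, Fin.sum_univ_succ]
    push_cast
    rw [C_add]
    ring

lemma poisson_poly_diagHam (μ : ι → ℝ) {p : ℕ} (h : (Fin p → ι × Bool) → ℂ) :
    poisson (poly h) (diagHam μ) =
      poly (fun w => ((∑ i, (sgn (w i).2 : ℝ) * μ (w i).1 : ℝ) : ℂ) * h w) := by
  unfold poly
  rw [poisson_sum_left]
  refine Finset.sum_congr rfl fun w _ => ?_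
  rw [← smul_eq_C_mul, poisson_smul_left, poisson_prod_X_diagHam, smul_eq_C_mul, ← mul_assoc,
    ← C_mul, mul_comm (h w)]

/-- The coefficients of a diagonal quadratic Hamiltonian. -/
def diagCoeff (μ : ι → ℝ) (w : Fin 2 → ι × Bool) : ℂ :=
  if (w 0).1 = (w 1).1 ∧ (w 0).2 = true ∧ (w 1).2 = false then (μ (w 0).1 : ℂ) else 0

lemma diagHam_eq_poly (μ : ι → ℝ) : diagHam μ = poly (diagCoeff μ) := by
  unfold poly diagHam diagCoeff
  rw [sum_ins 0]
  rw [Fintype.sum_prod_type]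
  refine Finset.sum_congr rfl fun n _ => ?_
  rw [Fintype.sum_bool, sum_ins 0, Fintype.sum_prod_type]
  simp [ite_and]
  rw [Finset.sum_eq_single n (fun m _ hm => by simp [hm.symm]) (by simp)]
  simp

lemma poisson_diagHam_diagHam (μ ν : ι → ℝ) : poisson (diagHam μ) (diagHam ν) = 0 := by
  unfold poisson
  simp only [pderiv_diagHam]
  exact Finset.sum_eq_zero fun n _ => by simp; ring

end Words

end

noncomputable section

/-! ### Multilinear estimates for sums over words of zero momentum -/

section Estimates

variable {d : ℕ} {S : Finset (Fin d → ℤ)}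

/-- The momentum of a word. -/
def mom {p : ℕ} (w : Fin p → S × Bool) : Fin d → ℤ := ∑ i, sgn (w i).2 • ((w i).1 : Fin d → ℤ)

lemma mom_ins {p : ℕ} (i : Fin (p + 1)) (c : S × Bool) (v : Fin p → S × Bool) :
    mom (ins i c v) = sgn c.2 • (c.1 : Fin d → ℤ) + mom v := by
  unfold mom
  rw [Fin.sum_univ_succAbove _ i]
  simp

lemma sum_letters (x : (Fin d → ℤ) → ℝ) : ∑ c : S × Bool, x c.1 = 2 * ∑ n ∈ S, x n := by
  rw [Fintype.sum_prod_type]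
  simp only [Fintype.sum_bool]
  rw [← Finset.sum_coe_sort S, Finset.mul_sum]
  exact Finset.sum_congr rfl fun n _ => by ring

/-- For each of the two signs the momentum equation determines the mode. -/
lemma sum_ite_letter_le {z : Fin d → ℤ} {B : ℝ} (hB : 0 ≤ B) :
    (∑ c : S × Bool, if sgn c.2 • (c.1 : Fin d → ℤ) + z = 0 then B else 0) ≤ 2 * B := by
  have h1 : ∀ y : Fin d → ℤ, (∑ n : S, if (n : Fin d → ℤ) = y then B else 0) ≤ B := by
    intro y
    rw [Finset.sum_coe_sort S (fun n => if n = y then B else 0), Finset.sum_ite_eq']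
    split_ifs <;> simp [hB]
  rw [Fintype.sum_prod_type_right, Fintype.sum_bool, two_mul]
  refine add_le_add ((Finset.sum_le_sum fun n _ => le_of_eq ?_).trans (h1 (-z)))
    ((Finset.sum_le_sum fun n _ => le_of_eq ?_).trans (h1 z))
  · simp [eq_neg_iff_add_eq_zero]
  · simp only [sgn_false, neg_smul, one_smul, neg_add_eq_zero]

lemma sum_words_prod {p : ℕ} (x : Fin p → (Fin d → ℤ) → ℝ) :
    ∑ w : Fin p → S × Bool, ∏ l, x l (w l).1 = ∏ l, (2 * ∑ n ∈ S, x l n) := by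
  have := Finset.prod_univ_sum (fun _ : Fin p => (Finset.univ : Finset (S × Bool)))
    (fun l c => x l c.1)
  rw [Fintype.piFinset_univ] at this
  rw [← this]
  exact Finset.prod_congr rfl fun l _ => sum_letters _

/-- In a sum over words of zero momentum, one slot is determined by the others. -/
lemma sum_mom_eliminate {p : ℕ} (j : Fin p) (x : Fin p → (Fin d → ℤ) → ℝ)
    (hx : ∀ l n, 0 ≤ x l n) (hj : ∀ n, x j n = 1) :
    (∑ w : Fin p → S × Bool, if mom w = 0 then ∏ l, x l (w l).1 else 0) ≤
      2 * ∏ l ∈ Finset.univ.erase j, (2 * ∑ n ∈ S, x l n) := by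
  cases p with
  | zero => exact j.elim0
  | succ p =>
    rw [sum_ins j, Finset.sum_comm]
    have h1 : ∏ l ∈ Finset.univ.erase j, (2 * ∑ n ∈ S, x l n) =
        ∑ v : Fin p → S × Bool, ∏ l, x (j.succAbove l) (v l).1 := by
      rw [sum_words_prod (fun l => x (j.succAbove l))]
      have h2 := Fin.prod_univ_succAbove (fun l => if l = j then 1 else 2 * ∑ n ∈ S, x l n) j
      rw [← Finset.mul_prod_erase _ _ (Finset.mem_univ j)] at h2
      simp only [if_true, one_mul, Fin.succAbove_ne, if_false] at h2
      rw [← h2]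
      exact Finset.prod_congr rfl fun l hl => by rw [if_neg (Finset.ne_of_mem_erase hl)]
    rw [h1, Finset.mul_sum]
    refine Finset.sum_le_sum fun v _ => ?_
    have hv : 0 ≤ ∏ l, x (j.succAbove l) (v l).1 := Finset.prod_nonneg fun l _ => hx _ _
    refine (Finset.sum_le_sum fun c _ => ?_).trans (sum_ite_letter_le (z := mom v) hv)
    rw [mom_ins, Fin.prod_univ_succAbove _ j]
    simp [hj]

/-- Cauchy-Schwarz over words: the product is the geometric mean of the same product with x_i² in
slot i and nothing in slot j, and of the one with i and j exchanged. In each of them the empty slot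
is determined by the momentum, so that slots i and j end up in ℓ² and the others in ℓ¹. -/
lemma sum_mom_sq_le {p : ℕ} {i j : Fin p} (hij : i ≠ j) (x : Fin p → (Fin d → ℤ) → ℝ)
    (hx : ∀ l n, 0 ≤ x l n) :
    (∑ w : Fin p → S × Bool, if mom w = 0 then ∏ l, x l (w l).1 else 0) ^ 2 ≤
      16 * ((∑ n ∈ S, x i n ^ 2) * (∑ n ∈ S, x j n ^ 2)) *
        (∏ l ∈ (Finset.univ.erase i).erase j, (2 * ∑ n ∈ S, x l n)) ^ 2 := by
  have hji : j ∈ Finset.univ.erase i := by simp [hij.symm]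
  have hij' : i ∈ Finset.univ.erase j := by simp [hij]
  let f : Fin p → Fin p → Fin p → (Fin d → ℤ) → ℝ := fun i j l n =>
    if l = j then 1 else if l = i then x l n ^ 2 else x l n
  have hf : ∀ i j l n, 0 ≤ f i j l n := by
    intro i j l n
    simp only [f]
    split_ifs <;> [norm_num; exact sq_nonneg _; exact hx _ _]
  have hprod : ∀ i j : Fin p, i ≠ j → ∀ w : Fin p → S × Bool, ∏ l, f i j l (w l).1 =
      x i (w i).1 ^ 2 * ∏ l ∈ (Finset.univ.erase i).erase j, x l (w l).1 := by
    intro i j hij w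
    have hji : j ∈ Finset.univ.erase i := by simp [hij.symm]
    rw [← Finset.mul_prod_erase _ _ (Finset.mem_univ i), ← Finset.mul_prod_erase _ _ hji]
    simp only [f, if_neg hij, if_true, one_mul]
    congr 1
    refine Finset.prod_congr rfl fun l hl => ?_
    simp only [Finset.mem_erase] at hl
    rw [if_neg hl.1, if_neg hl.2.1]
  have h1 := Finset.sum_sq_le_sum_mul_sum_of_sq_le_mul (Finset.univ : Finset (Fin p → S × Bool))
    (r := fun w => if mom w = 0 then ∏ l, x l (w l).1 else 0)
    (f := fun w => if mom w = 0 then ∏ l, f i j l (w l).1 else 0)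
    (g := fun w => if mom w = 0 then ∏ l, f j i l (w l).1 else 0)
    (fun w _ => by split_ifs <;> [exact Finset.prod_nonneg fun l _ => hf _ _ _ _; exact le_rfl])
    (fun w _ => by split_ifs <;> [exact Finset.prod_nonneg fun l _ => hf _ _ _ _; exact le_rfl])
    (fun w _ => by
      split_ifs
      · rw [hprod i j hij, hprod j i hij.symm, Finset.erase_right_comm (a := j) (b := i),
          ← Finset.mul_prod_erase _ _ (Finset.mem_univ i), ← Finset.mul_prod_erase _ _ hji]
        apply le_of_eq; ring
      · simp)
  refine h1.trans ?_
  have h2 : ∀ i j : Fin p, i ≠ j →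
      (∑ w : Fin p → S × Bool, if mom w = 0 then ∏ l, f i j l (w l).1 else 0) ≤
        4 * (∑ n ∈ S, x i n ^ 2) * ∏ l ∈ (Finset.univ.erase i).erase j, (2 * ∑ n ∈ S, x l n) := by
    intro i j hij
    refine (sum_mom_eliminate j _ (hf i j) (by simp [f])).trans (le_of_eq ?_)
    have hij' : i ∈ Finset.univ.erase j := by simp [hij]
    rw [← Finset.mul_prod_erase _ _ hij', Finset.erase_right_comm]
    have h3 : ∏ l ∈ (Finset.univ.erase i).erase j, (2 * ∑ n ∈ S, f i j l n) =
        ∏ l ∈ (Finset.univ.erase i).erase j, (2 * ∑ n ∈ S, x l n) := by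
      refine Finset.prod_congr rfl fun l hl => ?_
      simp only [Finset.mem_erase] at hl
      simp only [f, if_neg hl.1, if_neg hl.2.1]
    rw [h3]
    simp only [f, if_neg hij, if_true]
    ring
  have h4 : ∀ i j : Fin p, 0 ≤ (∑ w : Fin p → S × Bool, if mom w = 0 then ∏ l, f i j l (w l).1 else 0) :=
    fun i j => Finset.sum_nonneg fun w _ => by
      split_ifs <;> [exact Finset.prod_nonneg fun l _ => hf _ _ _ _; exact le_rfl]
  refine (mul_le_mul (h2 i j hij) (h2 j i hij.symm) (h4 _ _) ((h4 _ _).trans (h2 i j hij))).trans ?_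
  rw [Finset.erase_right_comm (a := j) (b := i)]
  apply le_of_eq; ring

/-- The basic multilinear estimate: two slots are measured in `h^s`, the others are summable. -/
lemma sum_mom_pair_le {p : ℕ} {i j : Fin p} (hij : i ≠ j) {s : ℝ} (a x : Fin p → (Fin d → ℤ) → ℝ)
    (hx : ∀ l n, 0 ≤ x l n) (θ : Fin p → ℝ) (hθ : ∀ l, 0 ≤ θ l)
    (hi : ∀ n, x i n = bracket n ^ s * a i n) (hj : ∀ n, x j n = bracket n ^ s * a j n)
    (hl : ∀ l, l ≠ i → l ≠ j → ∑ n ∈ S, x l n ≤ embConst d * θ l * sobNorm s S (a l)) :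
    (∑ w : Fin p → S × Bool, if mom w = 0 then ∏ l, x l (w l).1 else 0) ≤
      (2 * embConst d) ^ p * (∏ l ∈ (Finset.univ.erase i).erase j, θ l) * ∏ l, sobNorm s S (a l) := by
  have hC := embConst_ge_one (d := d)
  have hji : j ∈ Finset.univ.erase i := by simp [hij.symm]
  have hN : ∀ l, 0 ≤ sobNorm s S (a l) := fun l => sobNorm_nonneg _ _ _
  have hsq : ∀ k : Fin p, (∀ n, x k n = bracket n ^ s * a k n) →
      ∑ n ∈ S, x k n ^ 2 = sobNorm s S (a k) ^ 2 := by
    intro k hk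
    rw [sobNorm_sq]
    exact Finset.sum_congr rfl fun n _ => by rw [hk, mul_pow, bracket_rpow_two_mul]
  have hp : 0 ≤ ∏ l ∈ (Finset.univ.erase i).erase j, θ l := Finset.prod_nonneg fun l _ => hθ l
  have hN' : 0 ≤ ∏ l, sobNorm s S (a l) := Finset.prod_nonneg fun l _ => hN l
  refine abs_le_of_sq_le_sq' ?_ (by positivity) |>.2
  refine (sum_mom_sq_le hij x hx).trans ?_
  rw [hsq i hi, hsq j hj]
  have h1 : ∏ l ∈ (Finset.univ.erase i).erase j, (2 * ∑ n ∈ S, x l n) ≤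
      (2 * embConst d) ^ (p - 2) * (∏ l ∈ (Finset.univ.erase i).erase j, θ l) *
        ∏ l ∈ (Finset.univ.erase i).erase j, sobNorm s S (a l) := by
    have hcard : ((Finset.univ.erase i).erase j).card = p - 2 := by
      rw [Finset.card_erase_of_mem hji, Finset.card_erase_of_mem (Finset.mem_univ i)]
      simp; omega
    rw [← hcard, ← Finset.prod_const, ← Finset.prod_mul_distrib, ← Finset.prod_mul_distrib]
    refine Finset.prod_le_prod (fun l _ => ?_) fun l hl' => ?_
    · exact mul_nonneg zero_le_two (Finset.sum_nonneg fun n _ => hx l n)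
    · simp only [Finset.mem_erase] at hl'
      have := hl l hl'.2.1 hl'.1
      linarith
  have h0 : 0 ≤ ∏ l ∈ (Finset.univ.erase i).erase j, (2 * ∑ n ∈ S, x l n) :=
    Finset.prod_nonneg fun l _ => mul_nonneg zero_le_two (Finset.sum_nonneg fun n _ => hx l n)
  have h2 : (2 * embConst d) ^ p = (2 * embConst d) ^ (p - 2) * (2 * embConst d) ^ 2 := by
    rw [← pow_add]; congr 1
    have := Finset.card_le_univ ({i, j} : Finset (Fin p))
    rw [Finset.card_pair hij] at this
    simp at this; omega
  have h3 : ∏ l, sobNorm s S (a l) = sobNorm s S (a i) * (sobNorm s S (a j) *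
      ∏ l ∈ (Finset.univ.erase i).erase j, sobNorm s S (a l)) := by
    rw [Finset.mul_prod_erase _ (fun l => sobNorm s S (a l)) hji,
      Finset.mul_prod_erase _ (fun l => sobNorm s S (a l)) (Finset.mem_univ i)]
  rw [h2, h3]
  set P := ∏ l ∈ (Finset.univ.erase i).erase j, sobNorm s S (a l)
  set Θ := ∏ l ∈ (Finset.univ.erase i).erase j, θ l
  have hP : 0 ≤ P := Finset.prod_nonneg fun l _ => hN l
  have hΘ : 0 ≤ Θ := hp
  have h4 := pow_le_pow_left₀ h0 h1 2
  calc 16 * (sobNorm s S (a i) ^ 2 * sobNorm s S (a j) ^ 2) *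
        (∏ l ∈ (Finset.univ.erase i).erase j, (2 * ∑ n ∈ S, x l n)) ^ 2
      ≤ 16 * (sobNorm s S (a i) ^ 2 * sobNorm s S (a j) ^ 2) *
        ((2 * embConst d) ^ (p - 2) * Θ * P) ^ 2 := by gcongr
    -- The inserted factor, at least 1, completes 16 to (2 `embConst d`)^4. The constant then no
    -- longer depends on the two distinguished slots.
    _ ≤ (16 * embConst d ^ 4) * (sobNorm s S (a i) ^ 2 * sobNorm s S (a j) ^ 2) *
        ((2 * embConst d) ^ (p - 2) * Θ * P) ^ 2 := by
        have : 1 ≤ embConst d ^ 4 := one_le_pow₀ hC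
        gcongr
        linarith
    _ = _ := by ring

/-- In a word of zero momentum, no letter is much larger than all the others. -/
lemma exists_ne_bracket_le {p : ℕ} (hp : 2 ≤ p) {w : Fin p → S × Bool} (hw : mom w = 0)
    (i : Fin p) : ∃ j, j ≠ i ∧ (∀ l, l ≠ i → nrm ((w l).1 : Fin d → ℤ) ≤ nrm ((w j).1 : Fin d → ℤ)) ∧
      nrm ((w i).1 : Fin d → ℤ) ≤ p * nrm ((w j).1 : Fin d → ℤ) ∧
      bracket ((w i).1 : Fin d → ℤ) ≤ p * bracket ((w j).1 : Fin d → ℤ) := by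
  have hne : (Finset.univ.erase i).Nonempty := by
    rw [← Finset.card_pos, Finset.card_erase_of_mem (Finset.mem_univ i)]
    simp; omega
  obtain ⟨j, hj, hmax⟩ := Finset.exists_max_image (Finset.univ.erase i)
    (fun l => nrm ((w l).1 : Fin d → ℤ)) hne
  have hji := Finset.ne_of_mem_erase hj
  have hp1 : (1 : ℝ) ≤ p := by exact_mod_cast (by omega : 1 ≤ p)
  have hsg : ∀ l, nrm (sgn (w l).2 • ((w l).1 : Fin d → ℤ)) = nrm ((w l).1 : Fin d → ℤ) := by
    intro l; cases (w l).2 <;> simp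
  have hle : nrm ((w i).1 : Fin d → ℤ) ≤ p * nrm ((w j).1 : Fin d → ℤ) := by
    have h1 : sgn (w i).2 • ((w i).1 : Fin d → ℤ) =
        -∑ l ∈ Finset.univ.erase i, sgn (w l).2 • ((w l).1 : Fin d → ℤ) := by
      rw [eq_neg_iff_add_eq_zero, Finset.add_sum_erase _
        (fun l => sgn (w l).2 • ((w l).1 : Fin d → ℤ)) (Finset.mem_univ i)]
      exact hw
    rw [← hsg i, h1, nrm_neg]
    refine (nrm_sum_le _ _).trans ?_
    calc ∑ l ∈ Finset.univ.erase i, nrm (sgn (w l).2 • ((w l).1 : Fin d → ℤ))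
        ≤ ∑ l ∈ Finset.univ.erase i, nrm ((w j).1 : Fin d → ℤ) :=
          Finset.sum_le_sum fun l hl => by rw [hsg]; exact hmax l hl
      _ ≤ ∑ l : Fin p, nrm ((w j).1 : Fin d → ℤ) :=
          Finset.sum_le_sum_of_subset_of_nonneg (Finset.erase_subset _ _) fun _ _ _ => nrm_nonneg _
      _ = _ := by simp
  exact ⟨j, hji, fun l hl => hmax l (by simp [hl]), hle, bracket_le_mul hp1 hle⟩

/-- The constant in `sum_mom_weight_le`. -/
def formConst (d : ℕ) (s : ℝ) (p : ℕ) : ℝ := (p : ℝ) ^ s * (p * (2 * embConst d) ^ p)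

lemma formConst_nonneg (d : ℕ) (s : ℝ) (p : ℕ) : 0 ≤ formConst d s p := by
  have := embConst_ge_one (d := d)
  unfold formConst; positivity

/-- Zero momentum makes the largest other letter j comparable to letter i, so half of the weight
⟨n_i⟩^{2s} can be moved to j at the price p^s. As j depends on the word, one sums over all choices
of j; each is a case of `sum_mom_pair_le`. -/
lemma sum_mom_weight_le {p : ℕ} (hp : 2 ≤ p) {s : ℝ} (hs : (d : ℝ) ≤ s) (i : Fin p)
    (a : Fin p → (Fin d → ℤ) → ℝ) (ha : ∀ l n, 0 ≤ a l n) :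
    (∑ w : Fin p → S × Bool, if mom w = 0 then
      bracket ((w i).1 : Fin d → ℤ) ^ (2 * s) * ∏ l, a l (w l).1 else 0) ≤
      formConst d s p * ∏ l, sobNorm s S (a l) := by
  have hs0 : 0 ≤ s := (Nat.cast_nonneg d).trans hs
  let x : Fin p → Fin p → (Fin d → ℤ) → ℝ := fun j l n =>
    if l = i ∨ l = j then bracket n ^ s * a l n else a l n
  have hx : ∀ j l n, 0 ≤ x j l n := fun j l n => by
    simp only [x]; split_ifs
    · exact mul_nonneg (bracket_rpow_pos _ _).le (ha _ _)
    · exact ha _ _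
  have h1 : ∀ w : Fin p → S × Bool, (if mom w = 0 then
      bracket ((w i).1 : Fin d → ℤ) ^ (2 * s) * ∏ l, a l (w l).1 else 0) ≤
      (p : ℝ) ^ s * ∑ j ∈ Finset.univ.erase i, if mom w = 0 then ∏ l, x j l (w l).1 else 0 := by
    intro w
    have hx' : ∀ j ∈ Finset.univ.erase i, 0 ≤ (if mom w = 0 then ∏ l, x j l (w l).1 else 0 : ℝ) :=
      fun j _ => by split_ifs <;> [exact Finset.prod_nonneg fun l _ => hx _ _ _; exact le_rfl]
    split_ifs with hw
    swap; · simp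
    obtain ⟨j, hji, -, -, hle⟩ := exists_ne_bracket_le hp hw i
    have hjm : j ∈ Finset.univ.erase i := by simp [hji]
    simp only [hw, if_true] at hx'
    refine le_trans ?_ (mul_le_mul_of_nonneg_left (Finset.single_le_sum hx' hjm)
      (Real.rpow_nonneg (Nat.cast_nonneg p) s))
    have hprod : ∏ l, x j l (w l).1 = bracket ((w i).1 : Fin d → ℤ) ^ s *
        bracket ((w j).1 : Fin d → ℤ) ^ s * ∏ l, a l (w l).1 := by
      rw [← Finset.mul_prod_erase _ _ (Finset.mem_univ i), ← Finset.mul_prod_erase _ _ hjm,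
        ← Finset.mul_prod_erase _ (fun l => a l (w l).1) (Finset.mem_univ i),
        ← Finset.mul_prod_erase _ (fun l => a l (w l).1) hjm]
      have : ∏ l ∈ (Finset.univ.erase i).erase j, x j l (w l).1 =
          ∏ l ∈ (Finset.univ.erase i).erase j, a l (w l).1 := by
        refine Finset.prod_congr rfl fun l hl => ?_
        simp only [Finset.mem_erase] at hl
        simp [x, hl.1, hl.2.1]
      rw [this]
      simp only [x, true_or, or_true, if_true]
      ring
    rw [hprod, ← mul_assoc]
    refine mul_le_mul_of_nonneg_right ?_ (Finset.prod_nonneg fun l _ => ha _ _)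
    rw [bracket_rpow_two_mul, sq]
    have := Real.rpow_le_rpow (bracket_nonneg _) hle hs0
    rw [Real.mul_rpow (Nat.cast_nonneg p) (bracket_nonneg _)] at this
    calc bracket ((w i).1 : Fin d → ℤ) ^ s * bracket ((w i).1 : Fin d → ℤ) ^ s
        ≤ bracket ((w i).1 : Fin d → ℤ) ^ s * ((p : ℝ) ^ s * bracket ((w j).1 : Fin d → ℤ) ^ s) :=
          mul_le_mul_of_nonneg_left this (bracket_rpow_pos _ _).le
      _ = _ := by ring
  refine (Finset.sum_le_sum fun w _ => h1 w).trans ?_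
  rw [← Finset.mul_sum, Finset.sum_comm, formConst, mul_assoc]
  refine mul_le_mul_of_nonneg_left ?_ (Real.rpow_nonneg (Nat.cast_nonneg p) s)
  have hC := embConst_ge_one (d := d)
  have hN' : 0 ≤ ∏ l, sobNorm s S (a l) := Finset.prod_nonneg fun l _ => sobNorm_nonneg _ _ _
  calc _ ≤ ∑ j ∈ Finset.univ.erase i, (2 * embConst d) ^ p * ∏ l, sobNorm s S (a l) := by
        refine Finset.sum_le_sum fun j hj => ?_
        have hji := Finset.ne_of_mem_erase hj
        have := sum_mom_pair_le (S := S) hji.symm (s := s) a (x j) (hx j) (fun _ => 1)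
          (fun _ => zero_le_one) (fun n => by simp [x]) (fun n => by simp [x]) (fun l h1 h2 => by
            simp only [x, h1, h2, or_self, if_false, mul_one]
            exact sum_le_sobNorm_of_subset hs)
        simpa using this
    _ ≤ ∑ j : Fin p, (2 * embConst d) ^ p * ∏ l, sobNorm s S (a l) :=
        Finset.sum_le_sum_of_subset_of_nonneg (Finset.erase_subset _ _) fun _ _ _ => by positivity
    _ = _ := by simp; ring

/-- The multilinear estimate in `h^s` for the vector field of a Hamiltonian with bounded
coefficients. -/
lemma sobNorm_vectorField_le {q : ℕ} (hq : 1 ≤ q) {s : ℝ} (hs : (d : ℝ) ≤ s)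
    (a : Fin q → (Fin d → ℤ) → ℝ) (ha : ∀ l n, 0 ≤ a l n) :
    sobNorm s S (fun n => ∑ v : Fin q → S × Bool,
      if mom v = n ∨ mom v = -n then ∏ l, a l (v l).1 else 0) ≤
      formConst d s (q + 1) * ∏ l, sobNorm s S (a l) := by
  -- Duality: the squared norm of `y` is at most the weighted form of degree q + 1 with `y` itself
  -- in slot 0, and `sum_mom_weight_le` is linear in the norm of `y`, which is then divided out. The
  -- alternative mom v = ±n covers both signs of that slot.
  set y : (Fin d → ℤ) → ℝ := fun n => ∑ v : Fin q → S × Bool,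
      if mom v = n ∨ mom v = -n then ∏ l, a l (v l).1 else 0 with hy
  have hP : ∀ v : Fin q → S × Bool, 0 ≤ ∏ l, a l (v l).1 :=
    fun v => Finset.prod_nonneg fun l _ => ha _ _
  have hy0 : ∀ n, 0 ≤ y n := fun n => Finset.sum_nonneg fun v _ => by
    split_ifs <;> [exact hP v; exact le_rfl]
  let a' : Fin (q + 1) → (Fin d → ℤ) → ℝ := Fin.cons y a
  have key := sum_mom_weight_le (S := S) (by omega : 2 ≤ q + 1) hs 0 a' (fun l n => by
    refine Fin.cases ?_ (fun l => ?_) l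
    · exact hy0 n
    · exact ha l n)
  rw [Fin.prod_univ_succ] at key
  simp only [a', Fin.cons_zero, Fin.cons_succ] at key
  have h1 : sobNorm s S y ^ 2 ≤ formConst d s (q + 1) *
      (sobNorm s S y * ∏ l, sobNorm s S (a l)) := by
    refine le_trans ?_ key
    rw [sobNorm_sq, sum_ins 0, Fintype.sum_prod_type, ← Finset.sum_coe_sort S]
    refine Finset.sum_le_sum fun n _ => ?_
    rw [Fintype.sum_bool, ← Finset.sum_add_distrib, sq, ← mul_assoc]
    have e0 : bracket (n : Fin d → ℤ) ^ (2 * s) * y n * y n = ∑ v : Fin q → S × Bool,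
        bracket (n : Fin d → ℤ) ^ (2 * s) * y n *
          if mom v = n ∨ mom v = -n then ∏ l, a l (v l).1 else 0 := by
      rw [← Finset.mul_sum]
    rw [e0]
    refine Finset.sum_le_sum fun v _ => ?_
    rw [mom_ins, mom_ins]
    simp only [Fin.insertNth_apply_same, sgn_true, sgn_false, one_smul, neg_smul]
    rw [Fin.prod_univ_succ, Fin.prod_univ_succ]
    simp only [Fin.insertNth_zero', Fin.cons_zero, Fin.cons_succ]
    have hnn : 0 ≤ bracket (n : Fin d → ℤ) ^ (2 * s) * (y n * ∏ l, a l (v l).1) :=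
      mul_nonneg (bracket_rpow_pos _ _).le (mul_nonneg (hy0 _) (hP v))
    have e1 : ((n : Fin d → ℤ) + mom v = 0) ↔ mom v = -(n : Fin d → ℤ) := by
      rw [add_comm, eq_neg_iff_add_eq_zero]
    have e2 : (-(n : Fin d → ℤ) + mom v = 0) ↔ mom v = n := by
      rw [neg_add_eq_zero, eq_comm]
    simp only [e1, e2]
    rw [mul_ite, mul_zero, mul_assoc]
    split_ifs <;> first | linarith | tauto
  rcases (sobNorm_nonneg s S y).eq_or_lt with h0 | h0
  · rw [← h0]
    exact mul_nonneg (formConst_nonneg _ _ _) (Finset.prod_nonneg fun l _ => sobNorm_nonneg _ _ _)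
  · refine le_of_mul_le_mul_left ?_ h0
    calc sobNorm s S y * sobNorm s S y = sobNorm s S y ^ 2 := by ring
      _ ≤ _ := h1
      _ = _ := by ring

end Estimates

end

noncomputable section

/-! ### Hamiltonians with bounded coefficients, with bounded majorants, and resonant ones -/

section Classes

variable {d : ℕ} {S : Finset (Fin d → ℤ)}

local notation "𝓟" => MvPolynomial (S × Bool) ℂ

/-- `F` is homogeneous of degree `p`, with coefficients bounded by `B` that preserve the momentum. -/
def IsRep (S : Finset (Fin d → ℤ)) (p : ℕ) (B : ℝ) (F : MvPolynomial (S × Bool) ℂ) : Prop :=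
  ∃ h : (Fin p → S × Bool) → ℂ, (∀ w, ‖h w‖ ≤ B) ∧ (∀ w, h w ≠ 0 → mom w = 0) ∧ F = poly h

/-- `F` is homogeneous of degree `p` and its majorant is bounded by `ε` on `h^s`. -/
def IsForm (s : ℝ) (S : Finset (Fin d → ℤ)) (p : ℕ) (ε : ℝ) (F : MvPolynomial (S × Bool) ℂ) :
    Prop :=
  ∃ h : (Fin p → S × Bool) → ℂ, (∀ a : Fin p → (Fin d → ℤ) → ℝ, (∀ l n, 0 ≤ a l n) →
    ∑ w, ‖h w‖ * ∏ l, a l (w l).1 ≤ ε * ∏ l, sobNorm s S (a l)) ∧ F = poly h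

/-- The frequency modulation of a word. -/
def modulation (G : Matrix (Fin d) (Fin d) ℝ) {p : ℕ} (w : Fin p → S × Bool) : ℝ :=
  ∑ i, (sgn (w i).2 : ℝ) * freq G (w i).1

/-- `F` is as in `IsRep` and contains only monomials with frequency modulation less than one. -/
def IsResonant (G : Matrix (Fin d) (Fin d) ℝ) (S : Finset (Fin d → ℤ)) (p : ℕ) (B : ℝ)
    (F : MvPolynomial (S × Bool) ℂ) : Prop :=
  ∃ h : (Fin p → S × Bool) → ℂ, (∀ w, ‖h w‖ ≤ B) ∧
    (∀ w, h w ≠ 0 → mom w = 0 ∧ |modulation G w| < 1) ∧ F = poly h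

/-- The quadratic Hamiltonian of the linear flow. -/
def linHam (G : Matrix (Fin d) (Fin d) ℝ) (S : Finset (Fin d → ℤ)) : MvPolynomial (S × Bool) ℂ :=
  diagHam fun n : S => freq G n

lemma IsResonant.isRep {G : Matrix (Fin d) (Fin d) ℝ} {p : ℕ} {B : ℝ} {F : 𝓟}
    (hF : IsResonant G S p B F) : IsRep S p B F := by
  obtain ⟨h, h1, h2, h3⟩ := hF
  exact ⟨h, h1, fun w hw => (h2 w hw).1, h3⟩

lemma IsRep.mono {p : ℕ} {B B' : ℝ} {F : 𝓟} (hF : IsRep S p B F) (hB : B ≤ B') :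
    IsRep S p B' F := by
  obtain ⟨h, h1, h2, h3⟩ := hF
  exact ⟨h, fun w => (h1 w).trans hB, h2, h3⟩

lemma IsResonant.mono {G : Matrix (Fin d) (Fin d) ℝ} {p : ℕ} {B B' : ℝ} {F : 𝓟}
    (hF : IsResonant G S p B F) (hB : B ≤ B') : IsResonant G S p B' F := by
  obtain ⟨h, h1, h2, h3⟩ := hF
  exact ⟨h, fun w => (h1 w).trans hB, h2, h3⟩

lemma IsRep.zero {p : ℕ} : IsRep S p 0 0 :=
  ⟨fun _ => 0, by simp, by simp, poly_zero.symm⟩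

lemma IsRep.add {p : ℕ} {B B' : ℝ} {F F' : 𝓟} (hF : IsRep S p B F) (hF' : IsRep S p B' F') :
    IsRep S p (B + B') (F + F') := by
  obtain ⟨h, h1, h2, rfl⟩ := hF
  obtain ⟨h', h1', h2', rfl⟩ := hF'
  refine ⟨fun w => h w + h' w, fun w => (norm_add_le _ _).trans (add_le_add (h1 w) (h1' w)),
    fun w hw => ?_, (poly_add _ _).symm⟩
  by_cases h0 : h w = 0
  · exact h2' w (by simpa [h0] using hw)
  · exact h2 w h0

lemma IsRep.smul {p : ℕ} {B : ℝ} {F : 𝓟} (hF : IsRep S p B F) (c : ℂ) :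
    IsRep S p (‖c‖ * B) (c • F) := by
  obtain ⟨h, h1, h2, rfl⟩ := hF
  refine ⟨fun w => c * h w, fun w => ?_, fun w hw => h2 w (right_ne_zero_of_mul hw),
    (poly_smul _ _).symm⟩
  rw [norm_mul]
  exact mul_le_mul_of_nonneg_left (h1 w) (norm_nonneg c)

lemma IsRep.sum {p : ℕ} {β : Type*} (t : Finset β) {B : β → ℝ} {F : β → 𝓟}
    (hF : ∀ b ∈ t, IsRep S p (B b) (F b)) : IsRep S p (∑ b ∈ t, B b) (∑ b ∈ t, F b) := by
  classical
  induction t using Finset.induction_on with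
  | empty => simpa using IsRep.zero
  | insert b t hb ih =>
    rw [Finset.sum_insert hb, Finset.sum_insert hb]
    exact (hF b (by simp)).add (ih fun b' hb' => hF b' (by simp [hb']))

lemma IsForm.mono {s : ℝ} {p : ℕ} {ε ε' : ℝ} {F : 𝓟} (hF : IsForm s S p ε F) (hε : ε ≤ ε') :
    IsForm s S p ε' F := by
  obtain ⟨h, h1, h3⟩ := hF
  exact ⟨h, fun a ha => (h1 a ha).trans (mul_le_mul_of_nonneg_right hε
    (Finset.prod_nonneg fun l _ => sobNorm_nonneg _ _ _)), h3⟩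

lemma IsForm.zero {s : ℝ} {p : ℕ} : IsForm s S p 0 0 :=
  ⟨fun _ => 0, by simp, poly_zero.symm⟩

lemma IsForm.add {s : ℝ} {p : ℕ} {ε ε' : ℝ} {F F' : 𝓟} (hF : IsForm s S p ε F)
    (hF' : IsForm s S p ε' F') : IsForm s S p (ε + ε') (F + F') := by
  obtain ⟨h, h1, rfl⟩ := hF
  obtain ⟨h', h1', rfl⟩ := hF'
  refine ⟨fun w => h w + h' w, fun a ha => ?_, (poly_add _ _).symm⟩
  rw [add_mul]
  refine le_trans ?_ (add_le_add (h1 a ha) (h1' a ha))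
  rw [← Finset.sum_add_distrib]
  refine Finset.sum_le_sum fun w _ => ?_
  rw [← add_mul]
  exact mul_le_mul_of_nonneg_right (norm_add_le _ _) (Finset.prod_nonneg fun l _ => ha _ _)

lemma mom_append {p q : ℕ} (y : Fin (p + q) → S × Bool) :
    mom y = mom (fun i => y (Fin.castAdd q i)) + mom (fun i => y (Fin.natAdd p i)) := by
  unfold mom
  rw [Fin.sum_univ_add]

lemma sgn_not (b : Bool) : sgn (!b) = -sgn b := by cases b <;> simp

/-- The contracted letter is fixed up to its sign by the momentum of the second word, so no sum over
the lattice remains: each pair of slots contributes at most 2 B B'. The contracted letter enters the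
two words with opposite signs, whence the momentum is preserved. -/
lemma IsRep.poisson {p q : ℕ} {B B' : ℝ} {F F' : 𝓟} (hF : IsRep S (p + 1) B F)
    (hF' : IsRep S (q + 1) B' F') (hB : 0 ≤ B) (hB' : 0 ≤ B') :
    IsRep S (p + q) (2 * (p + 1) * (q + 1) * (B * B')) (poisson F F') := by
  obtain ⟨h, h1, h2, rfl⟩ := hF
  obtain ⟨h', h1', h2', rfl⟩ := hF'
  have hterm : ∀ i j y, ‖contract h h' i j y‖ ≤ 2 * (B * B') := by
    intro i j y
    refine (norm_contract_le h h' i j y).trans ((Finset.sum_le_sum fun c _ => ?_).trans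
      (sum_ite_letter_le (S := S) (z := mom fun l => y (Fin.natAdd p l)) (mul_nonneg hB hB')))
    split_ifs with hc
    · exact mul_le_mul (h1 _) (h1' _) (norm_nonneg _) hB
    · rw [← mom_ins j] at hc
      rw [not_imp_comm.mp (h2' _) hc]
      simp
  have hzero : ∀ i j y, contract h h' i j y ≠ 0 → mom y = 0 := by
    intro i j y hy
    have := (norm_pos_iff.mpr hy).trans_le (norm_contract_le h h' i j y)
    obtain ⟨c, -, hc⟩ := Finset.exists_ne_zero_of_sum_ne_zero this.ne'
    have m1 := h2 _ (norm_ne_zero_iff.mp (left_ne_zero_of_mul hc))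
    have m2 := h2' _ (norm_ne_zero_iff.mp (right_ne_zero_of_mul hc))
    rw [mom_ins] at m1 m2
    simp only [sgn_not, neg_smul] at m1
    rw [mom_append]
    have := congrArg₂ (· + ·) m1 m2
    simp only [add_zero] at this
    rw [← this]
    abel
  rw [poisson_poly]
  have key := IsRep.sum (S := S) Finset.univ (B := fun _ : Fin (p + 1) => ∑ _j : Fin (q + 1), 2 * (B * B'))
    (F := fun i => ∑ j, poly (contract h h' i j)) fun i _ =>
      IsRep.sum Finset.univ fun j _ => ⟨_, hterm i j, hzero i j, rfl⟩
  refine key.mono (le_of_eq ?_)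
  simp
  ring

lemma sum_form_ins {s : ℝ} {q : ℕ} {ε : ℝ} {h' : (Fin (q + 1) → S × Bool) → ℂ}
    (h1 : ∀ a : Fin (q + 1) → (Fin d → ℤ) → ℝ, (∀ l n, 0 ≤ a l n) →
      ∑ w, ‖h' w‖ * ∏ l, a l (w l).1 ≤ ε * ∏ l, sobNorm s S (a l))
    (j : Fin (q + 1)) (y : (Fin d → ℤ) → ℝ) (hy : ∀ n, 0 ≤ y n) (a : Fin q → (Fin d → ℤ) → ℝ)
    (ha : ∀ l n, 0 ≤ a l n) :
    ∑ c : S × Bool, ∑ v : Fin q → S × Bool, ‖h' (ins j c v)‖ * (y c.1 * ∏ l, a l (v l).1) ≤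
      ε * (sobNorm s S y * ∏ l, sobNorm s S (a l)) := by
  have := h1 (ins j y a) (fun l n => by
    refine Fin.succAboveCases j ?_ (fun l => ?_) l
    · simpa using hy n
    · simpa using ha l n)
  rw [sum_ins j, Fin.prod_univ_succAbove _ j] at this
  simp only [Fin.insertNth_apply_same, Fin.insertNth_apply_succAbove] at this
  refine le_trans (Finset.sum_le_sum fun c _ => Finset.sum_le_sum fun v _ => ?_) this
  rw [Fin.prod_univ_succAbove _ j]
  simp

/-- Contracting with a slot of F inserts the vector field of F into a slot of F'. Bounded
coefficients and zero momentum make that vector field bounded in h^s by `sobNorm_vectorField_le`, so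
that a form on h^s remains one, even if its own coefficients are unbounded. -/
lemma IsForm.poisson {s : ℝ} (hs : (d : ℝ) ≤ s) {p q : ℕ} (hp : 1 ≤ p) {B ε : ℝ} {F F' : 𝓟}
    (hF : IsRep S (p + 1) B F) (hF' : IsForm s S (q + 1) ε F') (hB : 0 ≤ B) (hε : 0 ≤ ε) :
    IsForm s S (p + q) ((p + 1) * (q + 1) * formConst d s (p + 1) * B * ε) (poisson F F') := by
  obtain ⟨h, h1, h2, rfl⟩ := hF
  obtain ⟨h', h1', rfl⟩ := hF'
  rw [poisson_poly]
  simp only [← poly_sum]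
  refine ⟨_, fun a ha => ?_, rfl⟩
  have hA : ∀ y : Fin (p + q) → S × Bool, 0 ≤ ∏ l, a l (y l).1 :=
    fun y => Finset.prod_nonneg fun l _ => ha _ _
  have hpair : ∀ i j, ∑ y, ‖contract h h' i j y‖ * ∏ l, a l (y l).1 ≤
      formConst d s (p + 1) * B * ε * ∏ l, sobNorm s S (a l) := by
    intro i j
    let a1 : Fin p → (Fin d → ℤ) → ℝ := fun l => a (Fin.castAdd q l)
    let a2 : Fin q → (Fin d → ℤ) → ℝ := fun l => a (Fin.natAdd p l)
    have ha1 : ∀ l n, 0 ≤ a1 l n := fun l n => ha _ _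
    have ha2 : ∀ l n, 0 ≤ a2 l n := fun l n => ha _ _
    let Y : (Fin d → ℤ) → ℝ := fun n => ∑ v : Fin p → S × Bool,
      if mom v = n ∨ mom v = -n then ∏ l, a1 l (v l).1 else 0
    have hY : ∀ n, 0 ≤ Y n := fun n => Finset.sum_nonneg fun v _ => by
      split_ifs <;> [exact Finset.prod_nonneg fun l _ => ha1 _ _; exact le_rfl]
    have hform := sum_form_ins h1' j Y hY a2 ha2
    have hvf := sobNorm_vectorField_le (S := S) hp hs a1 ha1
    calc ∑ y, ‖contract h h' i j y‖ * ∏ l, a l (y l).1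
        ≤ ∑ y : Fin (p + q) → S × Bool, (∑ c : S × Bool,
          ‖h (ins i (c.1, !c.2) fun l => y (Fin.castAdd q l))‖ *
            ‖h' (ins j c fun l => y (Fin.natAdd p l))‖) *
          ((∏ l, a1 l (y (Fin.castAdd q l)).1) * ∏ l, a2 l (y (Fin.natAdd p l)).1) := by
          refine Finset.sum_le_sum fun y _ => ?_
          rw [← Fin.prod_univ_add (fun l => a l (y l).1)]
          exact mul_le_mul_of_nonneg_right (norm_contract_le h h' i j y) (hA y)
      _ = ∑ v : Fin p → S × Bool, ∑ v' : Fin q → S × Bool, (∑ c : S × Bool,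
          ‖h (ins i (c.1, !c.2) v)‖ * ‖h' (ins j c v')‖) *
          ((∏ l, a1 l (v l).1) * ∏ l, a2 l (v' l).1) := by
          rw [sum_append (fun v v' => (∑ c : S × Bool,
            ‖h (ins i (c.1, !c.2) v)‖ * ‖h' (ins j c v')‖) *
            ((∏ l, a1 l (v l).1) * ∏ l, a2 l (v' l).1))]
      _ = ∑ c : S × Bool, ∑ v' : Fin q → S × Bool, ‖h' (ins j c v')‖ *
          ((∑ v : Fin p → S × Bool, ‖h (ins i (c.1, !c.2) v)‖ * ∏ l, a1 l (v l).1) *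
            ∏ l, a2 l (v' l).1) := by
          simp only [Finset.sum_mul, Finset.mul_sum]
          rw [Finset.sum_comm]
          refine (Finset.sum_congr rfl fun v' _ => Finset.sum_comm).trans ?_
          rw [Finset.sum_comm]
          refine Finset.sum_congr rfl fun c _ => Finset.sum_congr rfl fun v' _ =>
            Finset.sum_congr rfl fun v _ => ?_
          ring
      _ ≤ ∑ c : S × Bool, ∑ v' : Fin q → S × Bool, ‖h' (ins j c v')‖ *
          ((B * Y c.1) * ∏ l, a2 l (v' l).1) := by
          refine Finset.sum_le_sum fun c _ => Finset.sum_le_sum fun v' _ => ?_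
          refine mul_le_mul_of_nonneg_left (mul_le_mul_of_nonneg_right ?_
            (Finset.prod_nonneg fun l _ => ha2 _ _)) (norm_nonneg _)
          simp only [Y]
          rw [Finset.mul_sum]
          refine Finset.sum_le_sum fun v _ => ?_
          have hv : 0 ≤ ∏ l, a1 l (v l).1 := Finset.prod_nonneg fun l _ => ha1 _ _
          by_cases hm : mom (ins i (c.1, !c.2) v) = 0
          · have : mom v = c.1 ∨ mom v = -c.1 := by
              rw [mom_ins] at hm
              rcases c with ⟨n, b⟩
              cases b
              · right; simpa [add_comm, eq_neg_iff_add_eq_zero] using hm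
              · left
                simp only [Bool.not_true, sgn_false, neg_smul, one_smul, neg_add_eq_zero] at hm
                exact hm.symm
            rw [if_pos this]
            exact mul_le_mul_of_nonneg_right (h1 _) hv
          · rw [not_imp_comm.mp (h2 _) hm, norm_zero, zero_mul]
            split_ifs <;> [exact mul_nonneg hB hv; simp]
      _ = B * ∑ c : S × Bool, ∑ v' : Fin q → S × Bool, ‖h' (ins j c v')‖ *
          (Y c.1 * ∏ l, a2 l (v' l).1) := by
          simp only [Finset.mul_sum]
          refine Finset.sum_congr rfl fun c _ => Finset.sum_congr rfl fun v' _ => ?_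
          ring
      _ ≤ B * (ε * (sobNorm s S Y * ∏ l, sobNorm s S (a2 l))) :=
          mul_le_mul_of_nonneg_left hform hB
      _ ≤ B * (ε * ((formConst d s (p + 1) * ∏ l, sobNorm s S (a1 l)) * ∏ l, sobNorm s S (a2 l))) := by
          refine mul_le_mul_of_nonneg_left (mul_le_mul_of_nonneg_left
            (mul_le_mul_of_nonneg_right hvf ?_) hε) hB
          exact Finset.prod_nonneg fun l _ => sobNorm_nonneg _ _ _
      _ = _ := by
          rw [Fin.prod_univ_add]
          ring
  calc ∑ y, ‖∑ i, ∑ j, contract h h' i j y‖ * ∏ l, a l (y l).1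
      ≤ ∑ y, ∑ i, ∑ j, ‖contract h h' i j y‖ * ∏ l, a l (y l).1 := by
        refine Finset.sum_le_sum fun y _ => ?_
        simp only [← Finset.sum_mul]
        refine mul_le_mul_of_nonneg_right ?_ (hA y)
        exact (norm_sum_le _ _).trans (Finset.sum_le_sum fun i _ => norm_sum_le _ _)
    _ = ∑ i, ∑ j, ∑ y, ‖contract h h' i j y‖ * ∏ l, a l (y l).1 := by
        rw [Finset.sum_comm]
        exact Finset.sum_congr rfl fun i _ => Finset.sum_comm
    _ ≤ ∑ _i : Fin (p + 1), ∑ _j : Fin (q + 1),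
        formConst d s (p + 1) * B * ε * ∏ l, sobNorm s S (a l) :=
        Finset.sum_le_sum fun i _ => Finset.sum_le_sum fun j _ => hpair i j
    _ = _ := by simp; ring

lemma IsForm.eval_le {s : ℝ} {p : ℕ} {ε : ℝ} {F : 𝓟} (hF : IsForm s S p ε F)
    {x : S × Bool → ℂ} {ξ : (Fin d → ℤ) → ℝ} (hξ : ∀ n, 0 ≤ ξ n) (hx : ∀ c, ‖x c‖ ≤ ξ c.1) :
    ‖MvPolynomial.eval x F‖ ≤ ε * sobNorm s S ξ ^ p := by
  obtain ⟨h, h1, rfl⟩ := hF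
  have := h1 (fun _ => ξ) fun _ => hξ
  rw [Finset.prod_const, Finset.card_univ, Fintype.card_fin] at this
  refine le_trans ?_ this
  rw [eval_poly]
  refine (norm_sum_le _ _).trans (Finset.sum_le_sum fun w _ => ?_)
  rw [norm_mul, norm_prod]
  exact mul_le_mul_of_nonneg_left (Finset.prod_le_prod (fun l _ => norm_nonneg _)
    fun l _ => hx _) (norm_nonneg _)

lemma IsForm.eval_pderiv_le {s : ℝ} {p : ℕ} {ε : ℝ} {F : 𝓟} (hF : IsForm s S (p + 1) ε F)
    {x y : S × Bool → ℂ} {ξ η : (Fin d → ℤ) → ℝ} (hξ : ∀ n, 0 ≤ ξ n) (hx : ∀ c, ‖x c‖ ≤ ξ c.1)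
    (hη : ∀ n, 0 ≤ η n) (hy : ∀ c, ‖y c‖ ≤ η c.1) :
    ‖∑ c, MvPolynomial.eval x (MvPolynomial.pderiv c F) * y c‖ ≤
      (p + 1) * ε * (sobNorm s S η * sobNorm s S ξ ^ p) := by
  obtain ⟨h, h1, rfl⟩ := hF
  simp only [pderiv_poly, map_sum, eval_poly, Finset.sum_mul]
  rw [Finset.sum_comm]
  calc _ ≤ ∑ i : Fin (p + 1), ∑ c : S × Bool, ∑ v : Fin p → S × Bool,
        ‖h (ins i c v)‖ * (η c.1 * ∏ l, ξ (v l).1) := by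
        refine (norm_sum_le _ _).trans (Finset.sum_le_sum fun i _ => ?_)
        refine (norm_sum_le _ _).trans (Finset.sum_le_sum fun c _ => ?_)
        refine (norm_sum_le _ _).trans (Finset.sum_le_sum fun v _ => ?_)
        rw [norm_mul, norm_mul, norm_prod, mul_assoc, mul_comm (∏ l, ‖x (v l)‖)]
        refine mul_le_mul_of_nonneg_left ?_ (norm_nonneg _)
        exact mul_le_mul (hy c) (Finset.prod_le_prod (fun l _ => norm_nonneg _) fun l _ => hx _)
          (Finset.prod_nonneg fun l _ => norm_nonneg _) (hη _)
    _ ≤ ∑ _i : Fin (p + 1), ε * (sobNorm s S η * sobNorm s S ξ ^ p) := by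
        refine Finset.sum_le_sum fun i _ => ?_
        have := sum_form_ins h1 i η hη (fun _ => ξ) (fun _ => hξ)
        simpa using this
    _ = _ := by simp; ring

/-- Weighted sums of actions enter the scheme here: their coefficients may grow like ⟨n⟩^{2s}, and
each of the two slots absorbs ⟨n⟩^s. -/
lemma isForm_diagHam {s : ℝ} {μ : S → ℝ} {ε : ℝ}
    (hμ : ∀ n : S, |μ n| ≤ ε * bracket (n : Fin d → ℤ) ^ (2 * s)) (hε : 0 ≤ ε) :
    IsForm s S 2 ε (diagHam μ) := by
  refine ⟨diagCoeff μ, fun a ha => ?_, diagHam_eq_poly μ⟩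
  rw [Fin.prod_univ_two]
  have h1 : ∑ w : Fin 2 → S × Bool, ‖diagCoeff μ w‖ * ∏ l, a l (w l).1 =
      ∑ n : S, |μ n| * (a 0 n * a 1 n) := by
    rw [sum_ins 0, Fintype.sum_prod_type]
    refine Finset.sum_congr rfl fun n _ => ?_
    rw [Fintype.sum_bool, sum_ins 0, Fintype.sum_prod_type]
    simp only [diagCoeff, Fin.prod_univ_two]
    rw [Finset.sum_eq_single n (fun m _ hm => by simp [hm.symm]) (by simp)]
    simp
  rw [h1]
  have h2 : (∑ n : S, (bracket (n : Fin d → ℤ) ^ s * a 0 n) * (bracket (n : Fin d → ℤ) ^ s * a 1 n)) ≤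
      sobNorm s S (a 0) * sobNorm s S (a 1) := by
    have := Real.sum_mul_le_sqrt_mul_sqrt (Finset.univ : Finset S)
      (fun n => bracket (n : Fin d → ℤ) ^ s * a 0 n) (fun n => bracket (n : Fin d → ℤ) ^ s * a 1 n)
    have e : ∀ b : (Fin d → ℤ) → ℝ, ∑ n : S, (bracket (n : Fin d → ℤ) ^ s * b n) ^ 2 =
        ∑ n ∈ S, bracket n ^ (2 * s) * b n ^ 2 := by
      intro b
      rw [← Finset.sum_coe_sort S]
      exact Finset.sum_congr rfl fun n _ => by rw [mul_pow, bracket_rpow_two_mul]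
    rw [e, e] at this
    exact this
  refine le_trans ?_ (mul_le_mul_of_nonneg_left h2 hε)
  rw [Finset.mul_sum]
  refine Finset.sum_le_sum fun n _ => ?_
  have := mul_le_mul_of_nonneg_right (hμ n) (mul_nonneg (ha 0 n) (ha 1 n))
  rw [bracket_rpow_two_mul] at this
  refine this.trans (le_of_eq ?_)
  ring

/-- The homological equation. -/
lemma IsRep.homological (G : Matrix (Fin d) (Fin d) ℝ) {p : ℕ} {B : ℝ} {F : 𝓟}
    (hF : IsRep S p B F) : ∃ χ K : 𝓟, IsRep S p B χ ∧ IsResonant G S p B K ∧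
      IsRep S p B (NLSTorus.poisson χ (linHam G S)) ∧
      K + NLSTorus.poisson χ (linHam G S) = F := by
  classical
  obtain ⟨h, h1, h2, rfl⟩ := hF
  have hB : ∀ w, 0 ≤ ‖h w‖ := fun w => norm_nonneg _
  -- The bracket with `linHam` multiplies a monomial by its modulation. As only modulations of
  -- modulus at least 1 are divided out, `χ` obeys the same bound `B`.
  let k : (Fin p → S × Bool) → ℂ := fun w => if |modulation G w| < 1 then h w else 0
  let c : (Fin p → S × Bool) → ℂ := fun w =>
    if |modulation G w| < 1 then 0 else ((modulation G w : ℝ) : ℂ)⁻¹ * h w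
  have hc : NLSTorus.poisson (poly c) (linHam G S) =
      poly (fun w => if |modulation G w| < 1 then 0 else h w) := by
    unfold linHam
    rw [poisson_poly_diagHam]
    congr 1
    ext w
    change ((modulation G w : ℝ) : ℂ) * c w = _
    simp only [c]
    split_ifs with hw
    · simp
    · have : ((modulation G w : ℝ) : ℂ) ≠ 0 := by
        intro h0
        rw [Complex.ofReal_eq_zero] at h0
        simp [h0] at hw
      rw [mul_inv_cancel_left₀ this]
  refine ⟨poly c, poly k, ⟨c, fun w => ?_, fun w hw => ?_, rfl⟩, ⟨k, fun w => ?_, fun w hw => ?_, rfl⟩,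
    ⟨_, fun w => ?_, fun w hw => ?_, hc⟩, ?_⟩
  · simp only [c]
    split_ifs with hw
    · simpa using (hB w).trans (h1 w)
    · rw [norm_mul, norm_inv, Complex.norm_real, Real.norm_eq_abs]
      refine le_trans ?_ (h1 w)
      exact mul_le_of_le_one_left (hB w) (inv_le_one_of_one_le₀ (not_lt.mp hw))
  · apply h2
    intro h0
    apply hw
    simp [c, h0]
  · simp only [k]
    split_ifs
    · exact h1 w
    · simpa using (hB w).trans (h1 w)
  · simp only [k] at hw
    split_ifs at hw with h0
    · exact ⟨h2 w hw, h0⟩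
    · exact absurd rfl hw
  · split_ifs
    · simpa using (hB w).trans (h1 w)
    · exact h1 w
  · split_ifs at hw
    · exact absurd rfl hw
    · exact h2 w hw
  · rw [hc, ← poly_add]
    congr 1
    ext w
    simp only [k]
    split_ifs <;> simp

end Classes

end

noncomputable section

/-! ### Brackets of cluster weights with resonant monomials -/

section Resonant

variable {d : ℕ} {S : Finset (Fin d → ℤ)}

/-- Weights that are constant on the clusters of `P` and vanish on low modes. -/
structure IsClusterWeight (P : Setoid (Fin d → ℤ)) (M s : ℝ) (ϖ : (Fin d → ℤ) → ℝ) : Prop where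
  le : ∀ n, |ϖ n| ≤ bracket n ^ (2 * s)
  high : ∀ n, ϖ n ≠ 0 → M ≤ nrm n
  const : ∀ m n, Quotient.mk P m = Quotient.mk P n → ϖ m = ϖ n

lemma sum_eq_add_add {p : ℕ} {α : Type*} [AddCommMonoid α] {i j : Fin p} (hij : j ≠ i)
    (f : Fin p → α) : ∑ k, f k = f i + (f j + ∑ k ∈ (Finset.univ.erase i).erase j, f k) := by
  rw [Finset.add_sum_erase _ f (by simp [hij] : j ∈ Finset.univ.erase i),
    Finset.add_sum_erase _ f (Finset.mem_univ i)]

lemma sum_erase_le {p : ℕ} {i j : Fin p} (f : Fin p → ℝ) {B : ℝ} (hB : 0 ≤ B)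
    (hf : ∀ k, k ≠ i → k ≠ j → f k ≤ B) :
    ∑ k ∈ (Finset.univ.erase i).erase j, f k ≤ p * B := by
  calc ∑ k ∈ (Finset.univ.erase i).erase j, f k
      ≤ ∑ k ∈ (Finset.univ.erase i).erase j, B := Finset.sum_le_sum fun k hk => by
        simp only [Finset.mem_erase] at hk
        exact hf k hk.2.1 hk.1
    _ ≤ ∑ _k : Fin p, B := Finset.sum_le_sum_of_subset_of_nonneg
        ((Finset.erase_subset _ _).trans (Finset.erase_subset _ _)) fun _ _ _ => hB
    _ = _ := by simp

/-- In a resonant word, either the weights cancel or the third largest mode is large. -/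
lemma weight_eq_zero_or {G : Matrix (Fin d) (Fin d) ℝ} {g A : ℝ} (hA : 1 ≤ A)
    (hfreq : ∀ n : Fin d → ℤ, g * nrm n ^ 2 ≤ freq G n ∧ |freq G n| ≤ A * nrm n ^ 2)
    {δ : ℝ} (hδ0 : 0 < δ) (hδ1 : δ < 1) {s : ℝ} (hs : 0 ≤ s) {p : ℕ} (hp : 3 ≤ p) {c : ℝ}
    (hc : 0 < c) (hc1 : c ≤ 1) (hcg : c * (1 + p * A) ≤ g) (hcA : c * (p + 1 + p * A) ≤ 1)
    {P : Setoid (Fin d → ℤ)}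
    (hP : ∀ n₁ n₂, Quotient.mk P n₁ ≠ Quotient.mk P n₂ →
      (nrm n₁ + nrm n₂) ^ δ < nrm (n₁ - n₂) + |freq G n₁ - freq G n₂|)
    {M : ℝ} (hM : 1 ≤ M) {ϖ : (Fin d → ℤ) → ℝ} (hϖ : IsClusterWeight P M s ϖ)
    {w : Fin p → S × Bool} (hw : mom w = 0) (hres : |modulation G w| < 1) :
    ∑ k, (sgn (w k).2 : ℝ) * ϖ (w k).1 = 0 ∨ ∃ i j l, i ≠ j ∧ l ≠ i ∧ l ≠ j ∧
      c * M ^ (δ / 2) ≤ bracket ((w l).1 : Fin d → ℤ) ∧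
      |∑ k, (sgn (w k).2 : ℝ) * ϖ (w k).1| ≤ p * (p : ℝ) ^ s *
        (bracket ((w i).1 : Fin d → ℤ) ^ s * bracket ((w j).1 : Fin d → ℤ) ^ s) := by
  -- `i` carries the largest mode, `j` the largest among the others, and `l` the largest among the
  -- remaining ones.
  have hne : (Finset.univ : Finset (Fin p)).Nonempty := ⟨⟨0, by omega⟩, Finset.mem_univ _⟩
  obtain ⟨i, -, hi⟩ := Finset.exists_max_image Finset.univ
    (fun l => nrm ((w l).1 : Fin d → ℤ)) hne
  replace hi : ∀ k, nrm ((w k).1 : Fin d → ℤ) ≤ nrm ((w i).1 : Fin d → ℤ) :=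
    fun k => hi k (Finset.mem_univ k)
  obtain ⟨j, hji, -, -, hij⟩ := exists_ne_bracket_le (by omega : 2 ≤ p) hw i
  have hjm : j ∈ Finset.univ.erase i := by simp [hji]
  have hne' : ((Finset.univ.erase i).erase j).Nonempty := by
    rw [← Finset.card_pos, Finset.card_erase_of_mem hjm,
      Finset.card_erase_of_mem (Finset.mem_univ i)]
    simp; omega
  obtain ⟨l, hl, hlmax⟩ := Finset.exists_max_image _ (fun l => nrm ((w l).1 : Fin d → ℤ)) hne'
  simp only [Finset.mem_erase, Finset.mem_univ, and_true] at hl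
  replace hlmax : ∀ k, k ≠ i → k ≠ j → nrm ((w k).1 : Fin d → ℤ) ≤ nrm ((w l).1 : Fin d → ℤ) :=
    fun k h1 h2 => hlmax k (by simp [h1, h2])
  have hsgn : ∀ b : Bool, |(sgn b : ℝ)| = 1 := fun b => by cases b <;> simp
  rcases le_or_gt (c * M ^ (δ / 2)) (bracket ((w l).1 : Fin d → ℤ)) with hQ | hQ
  · right
    refine ⟨i, j, l, hji.symm, hl.2, hl.1, hQ, ?_⟩
    have hk : ∀ k, |(sgn (w k).2 : ℝ) * ϖ (w k).1| ≤ (p : ℝ) ^ s *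
        (bracket ((w i).1 : Fin d → ℤ) ^ s * bracket ((w j).1 : Fin d → ℤ) ^ s) := by
      intro k
      rw [abs_mul, hsgn, one_mul]
      refine (hϖ.le _).trans ((Real.rpow_le_rpow (bracket_nonneg _) (bracket_mono (hi k))
        (by linarith)).trans ?_)
      rw [bracket_rpow_two_mul, sq]
      have := Real.rpow_le_rpow (bracket_nonneg _) hij hs
      rw [Real.mul_rpow (Nat.cast_nonneg p) (bracket_nonneg _)] at this
      calc bracket ((w i).1 : Fin d → ℤ) ^ s * bracket ((w i).1 : Fin d → ℤ) ^ s
          ≤ bracket ((w i).1 : Fin d → ℤ) ^ s * ((p : ℝ) ^ s * bracket ((w j).1 : Fin d → ℤ) ^ s) :=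
            mul_le_mul_of_nonneg_left this (bracket_rpow_pos _ _).le
        _ = _ := by ring
    refine (Finset.abs_sum_le_sum_abs _ _).trans ((Finset.sum_le_sum fun k _ => hk k).trans ?_)
    simp [mul_assoc]
  · left
    rcases lt_or_ge (nrm ((w i).1 : Fin d → ℤ)) M with hM1 | hM1
    · refine Finset.sum_eq_zero fun k _ => ?_
      by_contra h
      have := hϖ.high _ (right_ne_zero_of_mul h)
      linarith [hi k]
    set N := nrm ((w i).1 : Fin d → ℤ) with hN
    set β := bracket ((w l).1 : Fin d → ℤ) with hβ
    have hβ1 : 1 ≤ β := one_le_bracket _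
    have hN1 : 1 ≤ N := hM.trans hM1
    have hMd : M ^ (δ / 2) ≤ M := by
      simpa using Real.rpow_le_rpow_of_exponent_le hM (by linarith : δ / 2 ≤ 1)
    -- All modes except `i` and `j` have size at most `β`. Their frequencies are quadratic in `β`,
    -- which is why the threshold on the third mode is M^{δ/2} and not M^δ.
    have hβ2 : β ^ 2 ≤ c ^ 2 * N ^ δ := by
      have h1 : β ^ 2 ≤ (c * M ^ (δ / 2)) ^ 2 := pow_le_pow_left₀ (by linarith) hQ.le 2
      have h2 : (c * M ^ (δ / 2)) ^ 2 = c ^ 2 * M ^ δ := by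
        rw [mul_pow, ← Real.rpow_natCast (M ^ (δ / 2)) 2, ← Real.rpow_mul (by linarith)]
        norm_num
      rw [h2] at h1
      refine h1.trans ?_
      gcongr
    have hNd : N ^ δ ≤ N := by
      simpa using Real.rpow_le_rpow_of_exponent_le hN1 hδ1.le
    have hsmall : ∀ k, k ≠ i → k ≠ j → nrm ((w k).1 : Fin d → ℤ) ≤ β :=
      fun k h1 h2 => (hlmax k h1 h2).trans (nrm_le_bracket _)
    have hp0 : (0 : ℝ) ≤ p := Nat.cast_nonneg p
    set R := ∑ k ∈ (Finset.univ.erase i).erase j, (sgn (w k).2 : ℝ) * freq G (w k).1 with hR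
    have hRle : |R| ≤ p * (A * β ^ 2) := by
      refine (Finset.abs_sum_le_sum_abs _ _).trans (sum_erase_le _ (by positivity) ?_)
      intro k h1 h2
      rw [abs_mul, hsgn, one_mul]
      refine (hfreq _).2.trans ?_
      gcongr
      · exact nrm_nonneg _
      · exact hsmall k h1 h2
    have hmod : modulation G w = (sgn (w i).2 : ℝ) * freq G (w i).1 +
        ((sgn (w j).2 : ℝ) * freq G (w j).1 + R) := sum_eq_add_add hji _
    rw [hmod] at hres
    have hfi := (hfreq (w i).1).1
    rw [← hN] at hfi
    have hg0 : 0 ≤ g := le_trans (by positivity) hcg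
    have hfj : 0 ≤ freq G (w j).1 := le_trans (by positivity) (hfreq (w j).1).1
    have hcN : 1 ≤ c ^ 2 * N ^ δ := (one_le_pow₀ hβ1).trans hβ2
    have hcc1 : c ^ 2 ≤ c := by
      rw [sq]; exact mul_le_of_le_one_left hc.le hc1
    have hcN2 : 1 ≤ c * N := hcN.trans (mul_le_mul hcc1 hNd (by positivity) hc.le)
    have hpA : 0 ≤ p * A := by positivity
    by_cases hsame : (w i).2 = (w j).2
    -- Equal signs: the two large frequencies add up to at least g N², which the small modes cannot
    -- compensate.
    · exfalso
      have h1 : freq G (w i).1 + freq G (w j).1 < 1 + p * (A * β ^ 2) := by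
        rw [hsame] at hres
        rw [abs_lt] at hres
        have := abs_le.mp hRle
        cases hb : (w j).2
        · rw [hb] at hres; simp only [sgn_false] at hres; push_cast at hres; linarith [hres.1]
        · rw [hb] at hres; simp only [sgn_true] at hres; push_cast at hres; linarith [hres.2]
      have h2 : g * N ^ 2 < 1 + p * A * (c ^ 2 * N) := by
        have : p * (A * β ^ 2) ≤ p * A * (c ^ 2 * N) := by
          rw [← mul_assoc]
          refine mul_le_mul_of_nonneg_left (hβ2.trans ?_) hpA
          gcongr
        linarith
      have h3 : c ^ 2 ≤ 1 := hcc1.trans hc1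
      have h4 : c * (1 + p * A) * N ^ 2 ≤ g * N ^ 2 := by gcongr
      have h5 : (1 + p * A) * N ≤ c * (1 + p * A) * N ^ 2 := by
        have h7 : 0 ≤ (1 + p * A) * N := by positivity
        calc (1 + p * A) * N = 1 * ((1 + p * A) * N) := (one_mul _).symm
          _ ≤ c * N * ((1 + p * A) * N) := mul_le_mul_of_nonneg_right hcN2 h7
          _ = _ := by ring
      have h6 : p * A * (c ^ 2 * N) ≤ p * A * N := by
        refine mul_le_mul_of_nonneg_left ?_ hpA
        exact mul_le_of_le_one_left (by linarith) h3
      have h8 : (1 + p * A) * N = N + p * A * N := by ring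
      linarith
    -- Opposite signs: n_i - n_j is bounded by p β and the frequency difference by 1 + p A β². The
    -- smallness of `c` contradicts `hP` unless both modes share a cluster, and then their weights
    -- cancel; the remaining modes lie below M, where the weight vanishes.
    · have hopp : (sgn (w j).2 : ℤ) = -sgn (w i).2 := by
        cases h1 : (w i).2 <;> cases h2 : (w j).2 <;> simp_all
      have hdist : nrm ((w i).1 - (w j).1 : Fin d → ℤ) ≤ p * β := by
        have h1 : mom w = sgn (w i).2 • ((w i).1 : Fin d → ℤ) + (sgn (w j).2 • ((w j).1 : Fin d → ℤ) +
          ∑ k ∈ (Finset.univ.erase i).erase j, sgn (w k).2 • ((w k).1 : Fin d → ℤ)) :=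
          sum_eq_add_add hji _
        rw [hw, hopp] at h1
        have h2 : nrm (∑ k ∈ (Finset.univ.erase i).erase j, sgn (w k).2 • ((w k).1 : Fin d → ℤ)) ≤
            p * β := by
          refine (nrm_sum_le _ _).trans (sum_erase_le _ (by linarith) fun k h1 h2 => ?_)
          have : nrm (sgn (w k).2 • ((w k).1 : Fin d → ℤ)) = nrm ((w k).1 : Fin d → ℤ) := by
            cases (w k).2 <;> simp
          rw [this]
          exact hsmall k h1 h2
        refine le_trans (le_of_eq ?_) h2
        set Y := ∑ k ∈ (Finset.univ.erase i).erase j, sgn (w k).2 • ((w k).1 : Fin d → ℤ)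
        have h3 : Y = -(sgn (w i).2 • ((w i).1 - (w j).1 : Fin d → ℤ)) := by
          rw [eq_neg_iff_add_eq_zero, h1, smul_sub, neg_smul]
          abel
        rw [h3, nrm_neg]
        cases (w i).2
        · rw [sgn_false, neg_smul, one_smul, nrm_neg]
        · rw [sgn_true, one_smul]
      have hfd : |freq G (w i).1 - freq G (w j).1| ≤ 1 + p * (A * β ^ 2) := by
        rw [hopp] at hres
        rw [abs_lt] at hres
        have := abs_le.mp hRle
        rw [abs_le]
        cases hb : (w i).2 <;> rw [hb] at hres <;> simp only [sgn_false, sgn_true] at hres <;>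
          push_cast at hres <;> constructor <;> linarith [hres.1, hres.2]
      have hclus : Quotient.mk P ((w i).1 : Fin d → ℤ) = Quotient.mk P ((w j).1 : Fin d → ℤ) := by
        by_contra hneq
        have h1 := hP _ _ hneq
        have h2 : N ^ δ ≤ (nrm ((w i).1 : Fin d → ℤ) + nrm ((w j).1 : Fin d → ℤ)) ^ δ :=
          Real.rpow_le_rpow (by linarith) (by linarith [nrm_nonneg ((w j).1 : Fin d → ℤ)]) hδ0.le
        have h3 : (p + 1 + p * A) * β ^ 2 ≤ N ^ δ := by
          have hX : 0 ≤ (p + 1 + p * A : ℝ) := by positivity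
          have hNd0 : 0 ≤ N ^ δ := by positivity
          have hcc : c ^ 2 * (p + 1 + p * A) ≤ 1 :=
            (mul_le_mul_of_nonneg_right hcc1 hX).trans hcA
          calc (p + 1 + p * A) * β ^ 2 ≤ (p + 1 + p * A) * (c ^ 2 * N ^ δ) := by gcongr
            _ = (c ^ 2 * (p + 1 + p * A)) * N ^ δ := by ring
            _ ≤ 1 * N ^ δ := by gcongr
            _ = N ^ δ := one_mul _
        have h4 : p * β ≤ p * β ^ 2 := by
          refine mul_le_mul_of_nonneg_left ?_ hp0
          exact le_self_pow₀ hβ1 two_ne_zero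
        have h5 : 1 ≤ β ^ 2 := one_le_pow₀ hβ1
        have h6 : (p + 1 + p * A) * β ^ 2 = p * β ^ 2 + β ^ 2 + p * (A * β ^ 2) := by ring
        linarith
      rw [sum_eq_add_add hji, hϖ.const _ _ hclus, hopp, Finset.sum_eq_zero]
      · push_cast; ring
      · intro k hk
        simp only [Finset.mem_erase] at hk
        have : ϖ (w k).1 = 0 := by
          by_contra h
          have h1 := hϖ.high _ h
          have h2 := hsmall k hk.2.1 hk.1
          have h3 : c * M ^ (δ / 2) ≤ M :=
            (mul_le_of_le_one_left (by positivity) hc1).trans hMd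
          linarith
        rw [this, mul_zero]

/-- The bracket of a cluster weight with a resonant Hamiltonian is small. -/
lemma exists_isForm_poisson_resonant {G : Matrix (Fin d) (Fin d) ℝ} (hG : G.PosDef)
    {δ : ℝ} (hδ0 : 0 < δ) (hδ1 : δ < 1) {s : ℝ} (hs : (d : ℝ) ≤ s) {p : ℕ} (hp : 3 ≤ p) :
    ∃ C : ℝ, 0 ≤ C ∧ ∀ (S : Finset (Fin d → ℤ)) (P : Setoid (Fin d → ℤ)) (M : ℝ)
      (ϖ : (Fin d → ℤ) → ℝ) (B : ℝ) (K : MvPolynomial (S × Bool) ℂ),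
      (∀ n₁ n₂, Quotient.mk P n₁ ≠ Quotient.mk P n₂ →
        (nrm n₁ + nrm n₂) ^ δ < nrm (n₁ - n₂) + |freq G n₁ - freq G n₂|) →
      1 ≤ M → IsClusterWeight P M s ϖ → 0 ≤ B → IsResonant G S p B K →
      IsForm s S p (C * M ^ (-(δ / 2) * (s - d)) * B) (poisson (diagHam fun n : S => ϖ n) K) := by
  obtain ⟨g, A, hg, hA, hfreq⟩ := exists_freq_bounds hG
  have hs0 : 0 ≤ s := (Nat.cast_nonneg d).trans hs
  -- The two quotients are what the cases of equal and of opposite signs require in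
  -- `weight_eq_zero_or`.
  set c : ℝ := min 1 (min (g / (1 + p * A)) (1 / (p + 1 + p * A))) with hcdef
  have hpA : 0 ≤ p * A := by positivity
  have hc : 0 < c := by
    refine lt_min one_pos (lt_min ?_ ?_) <;> positivity
  have hc1 : c ≤ 1 := min_le_left _ _
  have hcg : c * (1 + p * A) ≤ g := by
    rw [← le_div_iff₀ (by positivity)]
    exact (min_le_right _ _).trans (min_le_left _ _)
  have hcA : c * (p + 1 + p * A) ≤ 1 := by
    rw [← le_div_iff₀ (by positivity)]
    exact (min_le_right _ _).trans (min_le_right _ _)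
  have hemb := embConst_ge_one (d := d)
  refine ⟨p * (p : ℝ) ^ s * (p * (p * p) * ((2 * embConst d) ^ p * c ^ (-(s - d)))), by positivity, ?_⟩
  intro S P M ϖ B K hP hM hϖ hB ⟨h, h1, h2, hK⟩
  have hM0 : 0 < M := by linarith
  set Q := c * M ^ (δ / 2) with hQ
  have hQ0 : 0 < Q := mul_pos hc (Real.rpow_pos_of_pos hM0 _)
  refine ⟨fun w => (-1) * (((∑ i, (sgn (w i).2 : ℝ) * ϖ (w i).1 : ℝ) : ℂ) * h w), fun a ha => ?_, ?_⟩
  swap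
  · rw [hK, poisson_antisymm, poisson_poly_diagHam, poly_smul, neg_one_smul]
  have hA' : ∀ w : Fin p → S × Bool, 0 ≤ ∏ l, a l (w l).1 :=
    fun w => Finset.prod_nonneg fun l _ => ha _ _
  -- The triple (i, j, l) depends on the word, so all triples are summed. Slots i and j carry ⟨n⟩^s,
  -- and slot l is cut to ⟨n⟩ ≥ Q, which produces Q^{-(s-d)} through `sum_le_sobNorm`.
  let x : Fin p × Fin p × Fin p → Fin p → (Fin d → ℤ) → ℝ := fun t k n =>
    if k = t.1 ∨ k = t.2.1 then bracket n ^ s * a k n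
    else if k = t.2.2 ∧ bracket n < Q then 0 else a k n
  have hx : ∀ t k n, 0 ≤ x t k n := fun t k n => by
    simp only [x]
    split_ifs
    · exact mul_nonneg (bracket_rpow_pos _ _).le (ha _ _)
    · exact le_rfl
    · exact ha _ _
  let D : Finset (Fin p × Fin p × Fin p) :=
    Finset.univ.filter fun t => t.1 ≠ t.2.1 ∧ t.2.2 ≠ t.1 ∧ t.2.2 ≠ t.2.1
  have hterm : ∀ w : Fin p → S × Bool,
      ‖(-1) * (((∑ i, (sgn (w i).2 : ℝ) * ϖ (w i).1 : ℝ) : ℂ) * h w)‖ * ∏ l, a l (w l).1 ≤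
      p * (p : ℝ) ^ s * B * ∑ t ∈ D, if mom w = 0 then ∏ k, x t k (w k).1 else 0 := by
    intro w
    have hnn : ∀ t ∈ D, 0 ≤ (if mom w = 0 then ∏ k, x t k (w k).1 else 0 : ℝ) :=
      fun t _ => by split_ifs <;> [exact Finset.prod_nonneg fun l _ => hx _ _ _; exact le_rfl]
    have hR : 0 ≤ p * (p : ℝ) ^ s * B * ∑ t ∈ D, if mom w = 0 then ∏ k, x t k (w k).1 else 0 :=
      mul_nonneg (by positivity) (Finset.sum_nonneg hnn)
    by_cases hw0 : h w = 0
    · simpa [hw0] using hR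
    obtain ⟨hmom, hres⟩ := h2 w hw0
    rw [norm_mul, norm_mul, norm_neg, norm_one, one_mul, Complex.norm_real, Real.norm_eq_abs]
    rcases weight_eq_zero_or hA hfreq hδ0 hδ1 hs0 hp hc hc1 hcg hcA hP hM hϖ hmom hres with
      h0 | ⟨i, j, l, hij, hli, hlj, hbr, hle⟩
    · rw [h0]; simpa using hR
    have htD : (i, j, l) ∈ D := by simp [D, hij, hli, hlj]
    have hprod : ∏ k, x (i, j, l) k (w k).1 = bracket ((w i).1 : Fin d → ℤ) ^ s *
        bracket ((w j).1 : Fin d → ℤ) ^ s * ∏ k, a k (w k).1 := by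
      have hjm : j ∈ Finset.univ.erase i := by simp [hij.symm]
      rw [← Finset.mul_prod_erase _ _ (Finset.mem_univ i), ← Finset.mul_prod_erase _ _ hjm,
        ← Finset.mul_prod_erase _ (fun l => a l (w l).1) (Finset.mem_univ i),
        ← Finset.mul_prod_erase _ (fun l => a l (w l).1) hjm]
      have : ∏ k ∈ (Finset.univ.erase i).erase j, x (i, j, l) k (w k).1 =
          ∏ k ∈ (Finset.univ.erase i).erase j, a k (w k).1 := by
        refine Finset.prod_congr rfl fun k hk => ?_
        simp only [Finset.mem_erase] at hk
        simp only [x, hk.1, hk.2.1, or_self, if_false]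
        rw [if_neg]
        rintro ⟨rfl, hlt⟩
        exact absurd hbr (not_le.mpr hlt)
      rw [this]
      simp only [x, true_or, or_true, if_true]
      ring
    have hsingle := Finset.single_le_sum hnn htD
    simp only [hmom, if_true] at hsingle ⊢
    rw [hprod] at hsingle
    calc |∑ i, (sgn (w i).2 : ℝ) * ϖ (w i).1| * ‖h w‖ * ∏ l, a l (w l).1
        ≤ (p * (p : ℝ) ^ s * (bracket ((w i).1 : Fin d → ℤ) ^ s *
          bracket ((w j).1 : Fin d → ℤ) ^ s)) * B * ∏ l, a l (w l).1 := by
          refine mul_le_mul_of_nonneg_right ?_ (hA' w)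
          exact mul_le_mul hle (h1 w) (norm_nonneg _) ((abs_nonneg _).trans hle)
      _ = p * (p : ℝ) ^ s * B * (bracket ((w i).1 : Fin d → ℤ) ^ s *
          bracket ((w j).1 : Fin d → ℤ) ^ s * ∏ l, a l (w l).1) := by ring
      _ ≤ _ := mul_le_mul_of_nonneg_left hsingle (by positivity)
  have hsum : ∀ t ∈ D, (∑ w : Fin p → S × Bool, if mom w = 0 then ∏ k, x t k (w k).1 else 0) ≤
      (2 * embConst d) ^ p * Q ^ (-(s - d)) * ∏ l, sobNorm s S (a l) := by
    rintro ⟨i, j, l⟩ ht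
    simp only [D, Finset.mem_filter, Finset.mem_univ, true_and] at ht
    obtain ⟨hij, hli, hlj⟩ := ht
    have hQs : 0 ≤ Q ^ (-(s - d)) := Real.rpow_nonneg hQ0.le _
    have := sum_mom_pair_le (S := S) hij (s := s) a (x (i, j, l)) (hx _)
      (fun k => if k = l then Q ^ (-(s - d)) else 1)
      (fun k => by split_ifs <;> [exact hQs; exact zero_le_one])
      (fun n => by simp [x]) (fun n => by simp [x]) (fun k h1 h2 => by
        simp only [x, h1, h2, or_self, if_false]
        split_ifs with hkl
        · subst hkl
          simp only [true_and]
          have := sum_le_sobNorm hs hQ0 (S := S.filter fun n => Q ≤ bracket n)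
            (fun n hn => (Finset.mem_filter.mp hn).2) (a := a k) S (Finset.filter_subset _ _)
          refine le_trans (le_of_eq ?_) this
          rw [Finset.sum_filter]
          refine Finset.sum_congr rfl fun n _ => ?_
          by_cases hn : Q ≤ bracket n
          · rw [if_neg (not_lt.mpr hn), if_pos hn]
          · rw [if_pos (not_le.mp hn), if_neg hn]
        · simp only [hkl, false_and, if_false, mul_one]
          exact sum_le_sobNorm_of_subset hs)
    rw [Finset.prod_ite_eq' , if_pos (by simp [hli, hlj])] at this
    exact this
  have hN' : 0 ≤ ∏ l, sobNorm s S (a l) := Finset.prod_nonneg fun l _ => sobNorm_nonneg _ _ _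
  have hQs : 0 ≤ Q ^ (-(s - d)) := Real.rpow_nonneg hQ0.le _
  calc _ ≤ ∑ w : Fin p → S × Bool, p * (p : ℝ) ^ s * B *
        ∑ t ∈ D, if mom w = 0 then ∏ k, x t k (w k).1 else 0 := Finset.sum_le_sum fun w _ => hterm w
    _ = p * (p : ℝ) ^ s * B * ∑ t ∈ D, ∑ w : Fin p → S × Bool,
        if mom w = 0 then ∏ k, x t k (w k).1 else 0 := by
        rw [← Finset.mul_sum, Finset.sum_comm]
    _ ≤ p * (p : ℝ) ^ s * B * ∑ _t : Fin p × Fin p × Fin p,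
        (2 * embConst d) ^ p * Q ^ (-(s - d)) * ∏ l, sobNorm s S (a l) := by
        refine mul_le_mul_of_nonneg_left ((Finset.sum_le_sum hsum).trans ?_) (by positivity)
        exact Finset.sum_le_sum_of_subset_of_nonneg (Finset.subset_univ _) fun _ _ _ => by positivity
    _ = _ := by
        have hQe : Q ^ (-(s - d)) = c ^ (-(s - d)) * M ^ (-(δ / 2) * (s - d)) := by
          rw [hQ, Real.mul_rpow hc.le (Real.rpow_nonneg hM0.le _), ← Real.rpow_mul hM0.le]
          congr 2; ring
        rw [hQe]
        simp
        ring

end Resonant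

end

noncomputable section

/-! ### Birkhoff normal form and modified energy -/

section NormalForm

variable {d : ℕ} {S : Finset (Fin d → ℤ)}

local notation "𝓟" => MvPolynomial (S × Bool) ℂ

/-- The Lie transform for the Poisson bracket. -/
abbrev lieT (χ : ℕ → MvPolynomial (S × Bool) ℂ) (k : ℕ) :
    MvPolynomial (S × Bool) ℂ →ₗ[ℂ] MvPolynomial (S × Bool) ℂ := lieTransform poissonL χ k

/-- The bracket constants for `IsRep`. -/
def repRatio (B : ℝ) (m j : ℕ) : ℝ := 2 * (2 * j + 2) * (2 * m + 2) * B

/-- The bracket constants for `IsForm`. -/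
def formRatio (d : ℕ) (s B : ℝ) (m j : ℕ) : ℝ :=
  (2 * j + 2) * (2 * m + 2) * formConst d s (2 * j + 2) * B

/-- Grading: order m stands for degree 2m + 2. A bracket removes one letter from each factor, so
bracketing with χ_j, of degree 2j + 2, raises the order by exactly j. -/
lemma IsRep.lieT {χ : ℕ → 𝓟} {k m : ℕ} {B B' : ℝ} (hB : 0 ≤ B) (hB' : 0 ≤ B')
    (hχ : ∀ j, 1 ≤ j → j ≤ k → IsRep S (2 * j + 2) B (χ j)) {F : 𝓟}
    (hF : IsRep S (2 * m + 2) B' F) :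
    IsRep S (2 * (m + k) + 2) (lieBound (repRatio B) k m * B') (lieT χ k F) := by
  refine lieTransform_bound (b := poissonL) χ (fun m B F => IsRep S (2 * m + 2) B F) (fun m => IsRep.zero)
    (fun m B B' F F' h h' => h.add h') ?_ ?_ ?_ hB' hF
  · rintro m B F c hc ⟨h, h1, h2, rfl⟩
    refine ⟨fun w => c * h w, fun w => ?_, fun w hw => h2 w (right_ne_zero_of_mul hw),
      (poly_smul _ _).symm⟩
    rw [norm_mul]
    exact (mul_le_of_le_one_left (norm_nonneg _) hc).trans (h1 w)
  · intro m j B1 F1 h1 h2 hB1 hF1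
    have := IsRep.poisson (p := 2 * j + 1) (q := 2 * m + 1) (hχ j h1 h2) hF1 hB hB1
    rw [show 2 * j + 1 + (2 * m + 1) = 2 * (m + j) + 2 by ring] at this
    refine this.mono (le_of_eq ?_)
    unfold repRatio
    push_cast
    ring
  · intro m j
    unfold repRatio
    positivity

lemma IsForm.lieT {s : ℝ} (hs : (d : ℝ) ≤ s) {χ : ℕ → 𝓟} {k m : ℕ} {B ε : ℝ} (hB : 0 ≤ B)
    (hε : 0 ≤ ε) (hχ : ∀ j, 1 ≤ j → j ≤ k → IsRep S (2 * j + 2) B (χ j)) {F : 𝓟}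
    (hF : IsForm s S (2 * m + 2) ε F) :
    IsForm s S (2 * (m + k) + 2) (lieBound (formRatio d s B) k m * ε) (lieT χ k F) := by
  refine lieTransform_bound (b := poissonL) χ (fun m B F => IsForm s S (2 * m + 2) B F)
    (fun m => IsForm.zero) (fun m B B' F F' h h' => h.add h') ?_ ?_ ?_ hε hF
  · rintro m B F c hc ⟨h, h1, rfl⟩
    refine ⟨fun w => c * h w, fun a ha => le_trans (Finset.sum_le_sum fun w _ => ?_) (h1 a ha),
      (poly_smul _ _).symm⟩
    rw [norm_mul]
    exact mul_le_mul_of_nonneg_right (mul_le_of_le_one_left (norm_nonneg _) hc)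
      (Finset.prod_nonneg fun l _ => ha _ _)
  · intro m j B1 F1 h1 h2 hB1 hF1
    have := IsForm.poisson hs (p := 2 * j + 1) (q := 2 * m + 1) (by omega) (hχ j h1 h2) hF1 hB hB1
    rw [show 2 * j + 1 + (2 * m + 1) = 2 * (m + j) + 2 by ring] at this
    refine this.mono (le_of_eq ?_)
    unfold formRatio
    push_cast
    ring
  · intro m j
    have := formConst_nonneg d s (2 * j + 2)
    unfold formRatio
    positivity

lemma repRatio_nonneg {B : ℝ} (hB : 0 ≤ B) (m j : ℕ) : 0 ≤ repRatio B m j := by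
  unfold repRatio; positivity

lemma formRatio_nonneg (d : ℕ) (s : ℝ) {B : ℝ} (hB : 0 ≤ B) (m j : ℕ) : 0 ≤ formRatio d s B m j := by
  have := formConst_nonneg d s (2 * j + 2)
  unfold formRatio; positivity

/-- The Birkhoff normal form: the Hamiltonian with components `H` is the Lie transform of a
resonant one, up to order `D`. -/
lemma exists_normalForm (G : Matrix (Fin d) (Fin d) ℝ) (η : ℕ → ℝ) (hη : ∀ k, 0 ≤ η k) (D : ℕ) :
    ∃ B : ℝ, 0 ≤ B ∧ ∀ (S : Finset (Fin d → ℤ)) (H : ℕ → MvPolynomial (S × Bool) ℂ),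
      (∀ k, 1 ≤ k → IsRep S (2 * k + 2) (η k) (H k)) →
      ∃ χ K : ℕ → MvPolynomial (S × Bool) ℂ, K 0 = linHam G S ∧
        (∀ k, 1 ≤ k → k ≤ D → IsRep S (2 * k + 2) B (χ k) ∧ IsResonant G S (2 * k + 2) B (K k) ∧
          IsRep S (2 * k + 2) B (poisson (χ k) (linHam G S)) ∧
          H k = ∑ i ∈ Finset.range (k + 1), lieT χ i (K (k - i))) := by
  induction D with
  | zero =>
    refine ⟨0, le_rfl, fun S H _ => ⟨fun _ => 0, fun _ => linHam G S, rfl, fun k h1 h2 => ?_⟩⟩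
    omega
  | succ D ih =>
    obtain ⟨B, hB, ih⟩ := ih
    set X : ℝ := (∑ i ∈ Finset.range D, lieBound (repRatio B) (i + 1) (D - i) * B) +
      ∑ j ∈ Finset.range D, lieBound (repRatio B) (D - j) (j + 1) * B with hX
    have hlb : ∀ i j, 0 ≤ lieBound (repRatio B) i j * B := fun i j =>
      mul_nonneg (lieBound_nonneg (repRatio_nonneg hB) _ _) hB
    have hX0 : 0 ≤ X := add_nonneg (Finset.sum_nonneg fun i _ => hlb _ _)
      (Finset.sum_nonneg fun i _ => hlb _ _)
    have hD1 : (1 : ℝ) ≤ D + 1 := by linarith [(Nat.cast_nonneg D : (0 : ℝ) ≤ D)]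
    have hB1 : 0 ≤ η (D + 1) + X := add_nonneg (hη _) hX0
    refine ⟨B + (D + 1) * (η (D + 1) + X), by positivity, fun S H hH => ?_⟩
    obtain ⟨χ, K, hK0, hχK⟩ := ih S H hH
    set H2 := linHam G S with hH2
    -- At order D + 1 the equation is H_{D+1} = K' + Q1 + T_{D+1} H2, and Deprit's recursion gives
    -- (D + 1) T_{D+1} H2 = Q2 + {χ_{D+1}, H2}. The new generator enters linearly, and there remains
    -- one homological equation for K' and χ_{D+1} / (D + 1).
    set Q1 := ∑ i ∈ Finset.range D, lieT χ (i + 1) (K (D - i)) with hQ1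
    set Q2 := ∑ j ∈ Finset.range D, lieT χ (D - j) (poisson (χ (j + 1)) H2) with hQ2
    have hc : ‖((D + 1 : ℂ)⁻¹)‖ ≤ 1 := by
      rw [norm_inv]
      apply inv_le_one_of_one_le₀
      have : ‖((D + 1 : ℕ) : ℂ)‖ = (D + 1 : ℕ) := Complex.norm_natCast _
      push_cast at this
      rwa [this]
    have hQ : IsRep S (2 * (D + 1) + 2) (η (D + 1) + X)
        (H (D + 1) + (-1 : ℂ) • (Q1 + ((D + 1 : ℂ)⁻¹) • Q2)) := by
      have r1 : IsRep S (2 * (D + 1) + 2)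
          (∑ i ∈ Finset.range D, lieBound (repRatio B) (i + 1) (D - i) * B) Q1 := by
        refine IsRep.sum _ fun i hi => ?_
        have hi := Finset.mem_range.mp hi
        have := IsRep.lieT (k := i + 1) (m := D - i) hB hB
          (fun j h1 h2 => (hχK j h1 (by omega)).1) (hχK (D - i) (by omega) (by omega)).2.1.isRep
        rwa [show D - i + (i + 1) = D + 1 by omega] at this
      -- The coefficients of `linHam` grow with the modes, so `IsRep.poisson` gives no uniform bound
      -- for {χ_j, H2}; the induction carries this bound along from the homological equations.
      have r2 : IsRep S (2 * (D + 1) + 2)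
          (∑ j ∈ Finset.range D, lieBound (repRatio B) (D - j) (j + 1) * B) Q2 := by
        refine IsRep.sum _ fun j hj => ?_
        have hj := Finset.mem_range.mp hj
        have := IsRep.lieT (k := D - j) (m := j + 1) hB hB
          (fun j h1 h2 => (hχK j h1 (by omega)).1) (hχK (j + 1) (by omega) (by omega)).2.2.1
        rwa [show j + 1 + (D - j) = D + 1 by omega] at this
      have r3 := (hH (D + 1) (by omega)).add ((r1.add ((r2.smul ((D + 1 : ℂ)⁻¹)).mono
        (mul_le_of_le_one_left (Finset.sum_nonneg fun i _ => hlb _ _) hc))).smul (-1))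
      refine r3.mono (le_of_eq ?_)
      rw [norm_neg, norm_one, one_mul]
    obtain ⟨χ0, K', h1, h2, h3, h4⟩ := hQ.homological G
    rw [← hH2] at h3 h4
    let χ' := Function.update χ (D + 1) ((D + 1 : ℂ) • χ0)
    let Kn := Function.update K (D + 1) K'
    have hχ' : ∀ j, j ≤ D → χ' j = χ j := fun j hj => Function.update_of_ne (by omega) _ _
    have hKn : ∀ j, j ≤ D → Kn j = K j := fun j hj => Function.update_of_ne (by omega) _ _
    have hT : ∀ i, i ≤ D → lieT χ' i = lieT χ i := fun i hi =>
      lieTransform_congr poissonL fun j _ hj => hχ' j (by omega)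
    have hD0 : ((D : ℂ) + 1) ≠ 0 := by exact_mod_cast Nat.succ_ne_zero D
    have hnD : ‖((D : ℂ) + 1)‖ = D + 1 := by
      have : ‖((D + 1 : ℕ) : ℂ)‖ = (D + 1 : ℕ) := Complex.norm_natCast _
      push_cast at this
      exact this
    refine ⟨χ', Kn, by rw [hKn 0 (by omega), hK0], fun k hk1 hk2 => ?_⟩
    rcases Nat.lt_or_ge D k with hk | hk
    · have hk : k = D + 1 := by omega
      subst hk
      have e1 : χ' (D + 1) = (D + 1 : ℂ) • χ0 := Function.update_self _ _ _
      have e2 : Kn (D + 1) = K' := Function.update_self _ _ _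
      rw [e1, e2]
      have hle : η (D + 1) + X ≤ B + (D + 1) * (η (D + 1) + X) := by nlinarith
      refine ⟨?_, h2.mono hle, ?_, ?_⟩
      · refine (h1.smul _).mono ?_
        rw [hnD]; linarith
      · rw [poisson_smul_left]
        refine (h3.smul _).mono ?_
        rw [hnD]; linarith
      · rw [Finset.sum_range_succ, Finset.sum_range_succ', Nat.sub_self, Nat.sub_zero, e2,
          hKn 0 (by omega), hK0]
        have e3 : ∑ i ∈ Finset.range D, lieT χ' (i + 1) (Kn (D + 1 - (i + 1))) = Q1 := by
          refine Finset.sum_congr rfl fun i hi => ?_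
          have hi := Finset.mem_range.mp hi
          rw [hT _ (by omega), hKn _ (by omega), Nat.add_sub_add_right]
        have e4 : lieT χ' (D + 1) H2 =
            ((D + 1 : ℂ)⁻¹) • (Q2 + (D + 1 : ℂ) • poisson χ0 H2) := by
          rw [lieT, lieTransform_succ, LinearMap.smul_apply, LinearMap.sum_apply,
            Finset.sum_range_succ]
          congr 2
          · refine Finset.sum_congr rfl fun j hj => ?_
            have hj := Finset.mem_range.mp hj
            have := hT (D - j) (by omega)
            rw [lieT, lieT] at this
            rw [LinearMap.comp_apply, this, hχ' _ (by omega), poissonL_apply]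
          · rw [Nat.sub_self, lieTransform_zero, LinearMap.id_comp, e1, poissonL_apply,
              poisson_smul_left]
        rw [e3, e4, smul_add, smul_smul, inv_mul_cancel₀ hD0, one_smul, lieT, lieTransform_zero,
          LinearMap.id_apply]
        have h5 : H (D + 1) = K' + poisson χ0 H2 + (Q1 + ((D + 1 : ℂ)⁻¹) • Q2) := by
          rw [h4, neg_one_smul]; abel
        rw [h5]
        abel
    · obtain ⟨a1, a2, a3, a4⟩ := hχK k hk1 hk
      have hle : B ≤ B + (D + 1) * (η (D + 1) + X) := by
        have : 0 ≤ (D + 1 : ℝ) * (η (D + 1) + X) := by positivity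
        linarith
      rw [hχ' k hk, hKn k hk]
      refine ⟨a1.mono hle, a2.mono hle, a3.mono hle, a4.trans ?_⟩
      refine Finset.sum_congr rfl fun i hi => ?_
      have hi := Finset.mem_range.mp hi
      rw [hT i (by omega), hKn _ (by omega)]

lemma poissonL_leibniz (E F G : 𝓟) : poissonL E (poissonL F G) =
    poissonL (poissonL E F) G + poissonL F (poissonL E G) := poisson_jacobi E F G

/-- The components of the bracket of a Lie transform with a Lie transform. -/
lemma sum_poisson_lieT (χ K : ℕ → 𝓟) (J : 𝓟) (H : ℕ → 𝓟) (m : ℕ)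
    (hH : ∀ k, k ≤ m → H k = ∑ i ∈ Finset.range (k + 1), lieT χ i (K (k - i))) :
    ∑ k ∈ Finset.range (m + 1), poisson (lieT χ k J) (H (m - k)) =
      ∑ b ∈ Finset.range (m + 1), lieT χ (m - b) (poisson J (K b)) := by
  -- This is order m of {TJ, TK} = T{J, K}: the morphism property expands one side, the normal form
  -- of `H` the other.
  have h1 : ∀ b ∈ Finset.range (m + 1), lieT χ (m - b) (poisson J (K b)) =
      ∑ k ∈ Finset.range (m - b + 1), poisson (lieT χ k J) (lieT χ (m - b - k) (K b)) := by
    intro b _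
    rw [← poissonL_apply, lieT, lieTransform_bracket χ poissonL_leibniz,
      Finset.Nat.sum_antidiagonal_eq_sum_range_succ (fun i j =>
        poissonL (lieTransform poissonL χ i J) (lieTransform poissonL χ j (K b)))]
    rfl
  have h2 : ∀ k ∈ Finset.range (m + 1), poisson (lieT χ k J) (H (m - k)) =
      ∑ i ∈ Finset.range (m - k + 1), poisson (lieT χ k J) (lieT χ i (K (m - k - i))) := by
    intro k _
    rw [hH _ (by omega), poisson_sum_right]
  rw [Finset.sum_congr rfl h1, Finset.sum_congr rfl h2, Finset.sum_sigma', Finset.sum_sigma']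
  refine Finset.sum_bij' (fun x _ => ⟨m - x.1 - x.2, x.1⟩) (fun x _ => ⟨x.2, m - x.1 - x.2⟩)
    ?_ ?_ ?_ ?_ ?_
  · rintro ⟨k, i⟩ h
    simp only [Finset.mem_sigma, Finset.mem_range] at h ⊢
    omega
  · rintro ⟨k, i⟩ h
    simp only [Finset.mem_sigma, Finset.mem_range] at h ⊢
    omega
  · rintro ⟨k, i⟩ h
    simp only [Finset.mem_sigma, Finset.mem_range] at h
    simp only [Sigma.mk.injEq, heq_eq_eq, true_and]
    omega
  · rintro ⟨k, i⟩ h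
    simp only [Finset.mem_sigma, Finset.mem_range] at h
    simp only [Sigma.mk.injEq, heq_eq_eq, and_true]
    omega
  · rintro ⟨k, i⟩ h
    simp only [Finset.mem_sigma, Finset.mem_range] at h
    simp only
    rw [show m - (m - k - i) - k = i by omega]

lemma sobNorm_mono {s s' : ℝ} (h : s ≤ s') (a : (Fin d → ℤ) → ℝ) : sobNorm s S a ≤ sobNorm s' S a := by
  refine Real.sqrt_le_sqrt (Finset.sum_le_sum fun n _ => ?_)
  exact mul_le_mul_of_nonneg_right (Real.rpow_le_rpow_of_exponent_le (one_le_bracket n) (by linarith))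
    (sq_nonneg _)

set_option maxHeartbeats 1000000 in
/-- The modified energy attached to a cluster weight. -/
lemma exists_modifiedEnergy {G : Matrix (Fin d) (Fin d) ℝ} (hG : G.PosDef) {δ : ℝ} (hδ0 : 0 < δ)
    (hδ1 : δ < 1) {s : ℝ} (hs : (d : ℝ) ≤ s) (η : ℕ → ℝ) (hη : ∀ k, 0 ≤ η k) (D : ℕ) :
    ∃ C : ℝ, 0 ≤ C ∧ ∀ (S : Finset (Fin d → ℤ)) (P : Setoid (Fin d → ℤ)) (M : ℝ)
      (ϖ : (Fin d → ℤ) → ℝ) (H : ℕ → MvPolynomial (S × Bool) ℂ),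
      (∀ n₁ n₂, Quotient.mk P n₁ ≠ Quotient.mk P n₂ →
        (nrm n₁ + nrm n₂) ^ δ < nrm (n₁ - n₂) + |freq G n₁ - freq G n₂|) →
      1 ≤ M → IsClusterWeight P M s ϖ → H 0 = linHam G S →
      (∀ k, 1 ≤ k → IsRep S (2 * k + 2) (η k) (H k)) →
      ∃ E : MvPolynomial (S × Bool) ℂ, ∀ (x : S × Bool → ℂ) (ξ : (Fin d → ℤ) → ℝ) (R : ℝ),
        (∀ n, 0 ≤ ξ n) → (∀ c, ‖x c‖ ≤ ξ c.1) → sobNorm s S ξ ≤ R → R ≤ 1 →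
        ‖MvPolynomial.eval x E - MvPolynomial.eval x (diagHam fun n : S => ϖ n)‖ ≤ C * R ^ 4 ∧
        ‖MvPolynomial.eval x (poisson E (∑ l ∈ Finset.range (D + 1), H l))‖ ≤
          C * (M ^ (-(δ / 2) * (s - d)) * R ^ 4 + R ^ (2 * D + 4)) ∧
        (∀ (y : S × Bool → ℂ) (ζ : (Fin d → ℤ) → ℝ), (∀ n, 0 ≤ ζ n) → (∀ c, ‖y c‖ ≤ ζ c.1) →
          ‖∑ c, MvPolynomial.eval x (MvPolynomial.pderiv c E) * y c‖ ≤ C * (R * sobNorm s S ζ)) ∧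
        (∀ (W : ℝ), 0 ≤ W → (∀ n, |ϖ n| ≤ W) →
          ∀ (y : S × Bool → ℂ) (ζ : (Fin d → ℤ) → ℝ), (∀ n, 0 ≤ ζ n) → (∀ c, ‖y c‖ ≤ ζ c.1) →
          ‖∑ c, MvPolynomial.eval x (MvPolynomial.pderiv c E) * y c‖ ≤ C * (W * sobNorm d S ζ)) := by
  obtain ⟨B, hB, hNF⟩ := exists_normalForm G η hη D
  have hres : ∀ b : ℕ, ∃ C : ℝ, 0 ≤ C ∧ (1 ≤ b → ∀ (S : Finset (Fin d → ℤ)) (P : Setoid (Fin d → ℤ))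
      (M : ℝ) (ϖ : (Fin d → ℤ) → ℝ) (B : ℝ) (K : MvPolynomial (S × Bool) ℂ),
      (∀ n₁ n₂, Quotient.mk P n₁ ≠ Quotient.mk P n₂ →
        (nrm n₁ + nrm n₂) ^ δ < nrm (n₁ - n₂) + |freq G n₁ - freq G n₂|) →
      1 ≤ M → IsClusterWeight P M s ϖ → 0 ≤ B → IsResonant G S (2 * b + 2) B K →
      IsForm s S (2 * b + 2) (C * M ^ (-(δ / 2) * (s - d)) * B)
        (poisson (diagHam fun n : S => ϖ n) K)) := by
    intro b
    by_cases hb : 1 ≤ b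
    · obtain ⟨C, hC, h⟩ := exists_isForm_poisson_resonant hG hδ0 hδ1 hs
        (by omega : 3 ≤ 2 * b + 2)
      exact ⟨C, hC, fun _ => h⟩
    · exact ⟨0, le_rfl, fun h => absurd h hb⟩
  choose Cr hCr0 hCr using hres
  have hform0 : ∀ s p, 0 ≤ formConst d s p := formConst_nonneg d
  have hlb : ∀ s k m, 0 ≤ lieBound (formRatio d s B) k m := fun s k m =>
    lieBound_nonneg (formRatio_nonneg d s hB) k m
  set R1 := Finset.range (D + 1) with hR1
  -- `C1` controls E - J and the derivative of E in h^s, `C2` its derivative in h^d, `C3` the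
  -- resonant brackets, and `C4` the brackets beyond the order of the normal form.
  let C1 : ℝ := ∑ k ∈ R1, (2 * k + 2) * lieBound (formRatio d s B) k 0
  let C2 : ℝ := ∑ k ∈ R1, (2 * k + 2) * lieBound (formRatio d d B) k 0
  let C3 : ℝ := ∑ m ∈ R1, ∑ b ∈ Finset.range (m + 1),
    lieBound (formRatio d s B) (m - b) b * (Cr b * B)
  let C4 : ℝ := ∑ t ∈ R1 ×ˢ R1, (2 * t.1 + 2) * (2 * t.2 + 2) * formConst d s (2 * t.2 + 2) * η t.2 *
    lieBound (formRatio d s B) t.1 0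
  have hC1 : 0 ≤ C1 := Finset.sum_nonneg fun k _ => mul_nonneg (by positivity) (hlb _ _ _)
  have hC2 : 0 ≤ C2 := Finset.sum_nonneg fun k _ => mul_nonneg (by positivity) (hlb _ _ _)
  have hC3 : 0 ≤ C3 := Finset.sum_nonneg fun m _ => Finset.sum_nonneg fun b _ =>
    mul_nonneg (hlb _ _ _) (mul_nonneg (hCr0 b) hB)
  have hC4 : 0 ≤ C4 := Finset.sum_nonneg fun t _ => mul_nonneg (mul_nonneg (mul_nonneg
    (by positivity) (hform0 _ _)) (hη _)) (hlb _ _ _)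
  refine ⟨C1 + C2 + C3 + C4, by positivity, ?_⟩
  intro S P M ϖ H hP hM hϖ hH0 hH
  obtain ⟨χ, K, hK0, hχK⟩ := hNF S H hH
  have hM0 : 0 < M := by linarith
  set J := diagHam fun n : S => ϖ n with hJ
  have hJs : IsForm s S (2 * 0 + 2) 1 J :=
    isForm_diagHam (fun n => by rw [one_mul]; exact hϖ.le _) zero_le_one
  have hχ : ∀ k ≤ D, ∀ j, 1 ≤ j → j ≤ k → IsRep S (2 * j + 2) B (χ j) :=
    fun k hk j h1 h2 => (hχK j h1 (h2.trans hk)).1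
  have hTJ : ∀ k ≤ D, IsForm s S (2 * k + 2) (lieBound (formRatio d s B) k 0) (lieT χ k J) := by
    intro k hk
    have := IsForm.lieT hs hB zero_le_one (hχ k hk) hJs
    rwa [zero_add, mul_one] at this
  have hHsum : ∀ k ≤ D, H k = ∑ i ∈ Finset.range (k + 1), lieT χ i (K (k - i)) := by
    intro k hk
    rcases Nat.eq_zero_or_pos k with rfl | hk1
    · simp [lieT, lieTransform_zero, hH0, hK0]
    · exact (hχK k hk1 hk).2.2.2
  -- Orders with k + l ≤ D recombine into T{J, K}; the other pairs have degree 2(k + l) + 2 ≥ 2D +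
  -- 4.
  have hsplit : poisson (∑ k ∈ R1, lieT χ k J) (∑ l ∈ R1, H l) =
      (∑ m ∈ R1, ∑ b ∈ Finset.range (m + 1), lieT χ (m - b) (poisson J (K b))) +
        ∑ t ∈ (R1 ×ˢ R1).filter (fun t => ¬ t.1 + t.2 ≤ D), poisson (lieT χ t.1 J) (H t.2) := by
    rw [poisson_sum_left]
    simp only [poisson_sum_right]
    rw [← Finset.sum_product', ← Finset.sum_filter_add_sum_filter_not (R1 ×ˢ R1)
      (fun t => t.1 + t.2 ≤ D)]
    congr 1
    have h1 : ∀ m ∈ R1, ∑ b ∈ Finset.range (m + 1), lieT χ (m - b) (poisson J (K b)) =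
        ∑ k ∈ Finset.range (m + 1), poisson (lieT χ k J) (H (m - k)) := by
      intro m hm
      have hm := Finset.mem_range.mp hm
      rw [sum_poisson_lieT χ K J H m fun k hk => hHsum k (by omega)]
    rw [Finset.sum_congr rfl h1, Finset.sum_sigma']
    refine Finset.sum_bij' (fun t _ => ⟨t.1 + t.2, t.1⟩) (fun x _ => (x.2, x.1 - x.2)) ?_ ?_ ?_ ?_ ?_
    · rintro ⟨k, l⟩ h
      simp only [hR1, Finset.mem_sigma, Finset.mem_range, Finset.mem_filter, Finset.mem_product] at h ⊢
      omega
    · rintro ⟨k, l⟩ h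
      simp only [hR1, Finset.mem_sigma, Finset.mem_range, Finset.mem_filter, Finset.mem_product] at h ⊢
      omega
    · rintro ⟨k, l⟩ h
      simp
    · rintro ⟨k, l⟩ h
      simp only [hR1, Finset.mem_sigma, Finset.mem_range] at h
      simp only [Sigma.mk.injEq, heq_eq_eq, and_true]
      omega
    · rintro ⟨k, l⟩ h
      simp
  refine ⟨∑ k ∈ R1, lieT χ k J, fun x ξ R hξ hx hR hR1' => ?_⟩
  have hR0 : 0 ≤ R := (sobNorm_nonneg _ _ _).trans hR
  have hNp : ∀ p q : ℕ, q ≤ p → sobNorm s S ξ ^ p ≤ R ^ q := fun p q hpq =>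
    (pow_le_pow_left₀ (sobNorm_nonneg _ _ _) hR p).trans (pow_le_pow_of_le_one hR0 hR1' hpq)
  have hMs : 0 ≤ M ^ (-(δ / 2) * (s - d)) := Real.rpow_nonneg hM0.le _
  refine ⟨?_, ?_, ?_, ?_⟩
  · have h1 : MvPolynomial.eval x (∑ k ∈ R1, lieT χ k J) - MvPolynomial.eval x J =
        ∑ k ∈ Finset.range D, MvPolynomial.eval x (lieT χ (k + 1) J) := by
      rw [hR1, Finset.sum_range_succ', map_add, map_sum, lieT, lieTransform_zero,
        LinearMap.id_apply, add_sub_cancel_right]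
    rw [h1]
    calc _ ≤ ∑ k ∈ Finset.range D, lieBound (formRatio d s B) (k + 1) 0 * R ^ 4 := by
          refine (norm_sum_le _ _).trans (Finset.sum_le_sum fun k hk => ?_)
          have hk := Finset.mem_range.mp hk
          refine ((hTJ (k + 1) (by omega)).eval_le hξ hx).trans ?_
          exact mul_le_mul_of_nonneg_left (hNp _ _ (by omega)) (hlb _ _ _)
      _ ≤ C1 * R ^ 4 := by
          rw [← Finset.sum_mul]
          refine mul_le_mul_of_nonneg_right ?_ (by positivity)
          simp only [C1]
          rw [hR1, Finset.sum_range_succ']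
          refine (Finset.sum_le_sum fun k _ => ?_).trans (le_add_of_nonneg_right
            (mul_nonneg (by positivity) (hlb _ _ _)))
          refine le_mul_of_one_le_left (hlb _ _ _) ?_
          have : (0 : ℝ) ≤ (k + 1 : ℕ) := Nat.cast_nonneg _
          linarith
      _ ≤ _ := by
          refine mul_le_mul_of_nonneg_right ?_ (by positivity)
          linarith
  · rw [hsplit, map_add, mul_add]
    refine (norm_add_le _ _).trans (add_le_add ?_ ?_)
    · calc _ ≤ ∑ m ∈ R1, ∑ b ∈ Finset.range (m + 1),
            lieBound (formRatio d s B) (m - b) b * (Cr b * M ^ (-(δ / 2) * (s - d)) * B) * R ^ 4 := by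
            rw [map_sum]
            refine (norm_sum_le _ _).trans (Finset.sum_le_sum fun m hm => ?_)
            have hm := Finset.mem_range.mp hm
            rw [map_sum]
            refine (norm_sum_le _ _).trans (Finset.sum_le_sum fun b hb => ?_)
            have hb := Finset.mem_range.mp hb
            have hε : 0 ≤ Cr b * M ^ (-(δ / 2) * (s - d)) * B :=
              mul_nonneg (mul_nonneg (hCr0 b) hMs) hB
            -- The quadratic part contributes nothing, since both it and J are diagonal.
            rcases Nat.eq_zero_or_pos b with rfl | hb1
            · rw [hK0, hJ, linHam, poisson_diagHam_diagHam, map_zero, map_zero, norm_zero]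
              exact mul_nonneg (mul_nonneg (hlb _ _ _) hε) (by positivity)
            · have h1 := hCr b hb1 S P M ϖ B (K b) hP hM hϖ hB (hχK b hb1 (by omega)).2.1
              have h2 := IsForm.lieT hs hB hε (hχ (m - b) (by omega)) h1
              refine (h2.eval_le hξ hx).trans ?_
              exact mul_le_mul_of_nonneg_left (hNp _ _ (by omega)) (mul_nonneg (hlb _ _ _) hε)
        _ = C3 * (M ^ (-(δ / 2) * (s - d)) * R ^ 4) := by
            simp only [C3, Finset.sum_mul]
            exact Finset.sum_congr rfl fun m _ => Finset.sum_congr rfl fun b _ => by ring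
        _ ≤ _ := by
            refine mul_le_mul_of_nonneg_right ?_ (by positivity)
            linarith
    · calc _ ≤ ∑ t ∈ R1 ×ˢ R1, (2 * t.1 + 2) * (2 * t.2 + 2) * formConst d s (2 * t.2 + 2) * η t.2 *
            lieBound (formRatio d s B) t.1 0 * R ^ (2 * D + 4) := by
            rw [map_sum]
            refine (norm_sum_le _ _).trans ((Finset.sum_le_sum (g := fun t =>
              (2 * t.1 + 2) * (2 * t.2 + 2) * formConst d s (2 * t.2 + 2) * η t.2 *
              lieBound (formRatio d s B) t.1 0 * R ^ (2 * D + 4)) fun t ht => ?_).trans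
              (Finset.sum_le_sum_of_subset_of_nonneg (Finset.filter_subset _ _) fun t _ _ =>
                mul_nonneg (mul_nonneg (mul_nonneg (mul_nonneg
                (by positivity) (hform0 _ _)) (hη _)) (hlb _ _ _)) (by positivity)))
            simp only [hR1, Finset.mem_filter, Finset.mem_product, Finset.mem_range] at ht
            have h1 := IsForm.poisson hs (p := 2 * t.2 + 1) (q := 2 * t.1 + 1) (by omega)
              (hH t.2 (by omega)) (hTJ t.1 (by omega)) (hη _) (hlb _ _ _)
            have h2 := h1.eval_le hξ hx
            rw [poisson_antisymm, map_neg, norm_neg]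
            refine h2.trans ?_
            have h3 := hNp (2 * t.2 + 1 + (2 * t.1 + 1)) (2 * D + 4) (by omega)
            have h4 : 0 ≤ (((2 * t.2 + 1 : ℕ) : ℝ) + 1) * (((2 * t.1 + 1 : ℕ) : ℝ) + 1) *
                formConst d s (2 * t.2 + 1 + 1) * η t.2 * lieBound (formRatio d s B) t.1 0 :=
              mul_nonneg (mul_nonneg (mul_nonneg (by positivity) (hform0 _ _)) (hη _)) (hlb _ _ _)
            refine (mul_le_mul_of_nonneg_left h3 h4).trans (le_of_eq ?_)
            push_cast
            ring
        _ = C4 * R ^ (2 * D + 4) := by rw [← Finset.sum_mul]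
        _ ≤ _ := by
            refine mul_le_mul_of_nonneg_right ?_ (by positivity)
            linarith
  · intro y ζ hζ hy
    simp only [map_sum, Finset.sum_mul]
    rw [Finset.sum_comm]
    calc _ ≤ ∑ k ∈ R1, (2 * k + 2) * lieBound (formRatio d s B) k 0 * (R * sobNorm s S ζ) := by
          refine (norm_sum_le _ _).trans (Finset.sum_le_sum fun k hk => ?_)
          have hk := Finset.mem_range.mp hk
          refine ((hTJ k (by omega)).eval_pderiv_le (p := 2 * k + 1) hξ hx hζ hy).trans ?_
          have h1 := hNp (2 * k + 1) 1 (by omega)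
          rw [pow_one] at h1
          have h2 := sobNorm_nonneg s S ζ
          have h3 : (((2 * k + 1 : ℕ) : ℝ) + 1) = 2 * k + 2 := by push_cast; ring
          rw [h3, mul_comm (sobNorm s S ζ)]
          exact mul_le_mul_of_nonneg_left (mul_le_mul_of_nonneg_right h1 h2)
            (mul_nonneg (by positivity) (hlb _ _ _))
      _ = C1 * (R * sobNorm s S ζ) := by rw [← Finset.sum_mul]
      _ ≤ _ := by
          refine mul_le_mul_of_nonneg_right ?_ (mul_nonneg hR0 (sobNorm_nonneg _ _ _))
          linarith
  -- The same energy is now estimated in h^d, where J is a form of size W. This serves for the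
  -- truncation error of the equation, which is small only in h^d.
  · intro W hW hϖW y ζ hζ hy
    have hJd : IsForm d S (2 * 0 + 2) W J :=
      isForm_diagHam (fun n => (hϖW n).trans (le_mul_of_one_le_right hW
        (Real.one_le_rpow (one_le_bracket _) (by positivity)))) hW
    have hNd : ∀ p : ℕ, sobNorm d S ξ ^ p ≤ 1 := fun p =>
      pow_le_one₀ (sobNorm_nonneg _ _ _) (((sobNorm_mono hs _).trans hR).trans hR1')
    simp only [map_sum, Finset.sum_mul]
    rw [Finset.sum_comm]
    calc _ ≤ ∑ k ∈ R1, (2 * k + 2) * lieBound (formRatio d d B) k 0 * (W * sobNorm d S ζ) := by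
          refine (norm_sum_le _ _).trans (Finset.sum_le_sum fun k hk => ?_)
          have hk := Finset.mem_range.mp hk
          have h0 := IsForm.lieT le_rfl hB hW (hχ k (by omega)) hJd
          rw [zero_add] at h0
          refine (h0.eval_pderiv_le (p := 2 * k + 1) hξ hx hζ hy).trans ?_
          have h1 := hNd (2 * k + 1)
          have h2 := sobNorm_nonneg d S ζ
          have h3 : (((2 * k + 1 : ℕ) : ℝ) + 1) = 2 * k + 2 := by push_cast; ring
          rw [h3]
          have h4 : 0 ≤ (2 * (k : ℝ) + 2) * lieBound (formRatio d d B) k 0 * W :=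
            mul_nonneg (mul_nonneg (by positivity) (hlb _ _ _)) hW
          calc _ = (2 * (k : ℝ) + 2) * lieBound (formRatio d d B) k 0 * W *
                (sobNorm d S ζ * sobNorm d S ξ ^ (2 * k + 1)) := by ring
            _ ≤ (2 * (k : ℝ) + 2) * lieBound (formRatio d d B) k 0 * W * sobNorm d S ζ :=
                mul_le_mul_of_nonneg_left (mul_le_of_le_one_right h2 h1) h4
            _ = _ := by ring
      _ = C2 * (W * sobNorm d S ζ) := by rw [← Finset.sum_mul]
      _ ≤ _ := by
          refine mul_le_mul_of_nonneg_right ?_ (mul_nonneg hW (sobNorm_nonneg _ _ _))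
          linarith

end NormalForm

end

noncomputable section

/-! ### Fourier coefficients of continuous functions on the torus -/

section FourierCoefficients

open MeasureTheory

attribute [local instance] instMeasureSpaceUnitAddCircle

lemma isAddHaarMeasure_unitAddCircle :
    Measure.IsAddHaarMeasure (volume : Measure UnitAddCircle) :=
  inferInstanceAs (Measure.IsAddHaarMeasure AddCircle.haarAddCircle)

lemma isProbabilityMeasure_unitAddCircle : IsProbabilityMeasure (volume : Measure UnitAddCircle) :=
  inferInstanceAs (IsProbabilityMeasure AddCircle.haarAddCircle)

attribute [local instance] isAddHaarMeasure_unitAddCircle isProbabilityMeasure_unitAddCircle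

variable {d : ℕ}

/-- The Fourier coefficients of a continuous function, as a linear map. -/
def fc (n : Fin d → ℤ) : C(UnitAddTorus (Fin d), ℂ) →ₗ[ℂ] ℂ where
  toFun F := UnitAddTorus.mFourierCoeff F n
  map_add' F G := by
    rw [← UnitAddTorus.mFourierCoeff_toLp, ← UnitAddTorus.mFourierCoeff_toLp,
      ← UnitAddTorus.mFourierCoeff_toLp, ← UnitAddTorus.mFourierBasis_repr,
      ← UnitAddTorus.mFourierBasis_repr, ← UnitAddTorus.mFourierBasis_repr]
    simp
  map_smul' c F := by
    rw [← UnitAddTorus.mFourierCoeff_toLp, ← UnitAddTorus.mFourierCoeff_toLp,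
      ← UnitAddTorus.mFourierBasis_repr, ← UnitAddTorus.mFourierBasis_repr]
    simp

lemma fc_apply (n : Fin d → ℤ) (F : C(UnitAddTorus (Fin d), ℂ)) :
    fc n F = UnitAddTorus.mFourierCoeff F n := rfl

lemma fc_mFourier (m n : Fin d → ℤ) :
    fc n (UnitAddTorus.mFourier m) = if n = m then 1 else 0 := by
  rw [fc_apply, ← UnitAddTorus.mFourierCoeff_toLp, ← UnitAddTorus.mFourierBasis_repr,
    HilbertBasis.repr_apply_apply, UnitAddTorus.coe_mFourierBasis]
  exact orthonormal_iff_ite.1 UnitAddTorus.orthonormal_mFourier n m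

lemma norm_fc_le (n : Fin d → ℤ) (F : C(UnitAddTorus (Fin d), ℂ)) : ‖fc n F‖ ≤ ‖F‖ := by
  rw [fc_apply, UnitAddTorus.mFourierCoeff]
  refine (norm_integral_le_of_norm_le_const (C := ‖F‖) (Filter.Eventually.of_forall fun θ => ?_)).trans
    (by simp)
  rw [norm_smul]
  calc _ ≤ ‖(UnitAddTorus.mFourier (-n) : C(UnitAddTorus (Fin d), ℂ))‖ * ‖F‖ :=
        mul_le_mul (ContinuousMap.norm_coe_le_norm _ _) (ContinuousMap.norm_coe_le_norm _ _)
          (norm_nonneg _) (norm_nonneg _)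
    _ = ‖F‖ := by rw [UnitAddTorus.mFourier_norm, one_mul]

lemma hasSum_norm_fc_sq (F : C(UnitAddTorus (Fin d), ℂ)) :
    HasSum (fun n => ‖fc n F‖ ^ 2) (∫ θ, ‖F θ‖ ^ 2) := by
  have h := UnitAddTorus.hasSum_sq_mFourierCoeff (ContinuousMap.toLp (E := ℂ) 2 volume ℂ F)
  simp only [UnitAddTorus.mFourierCoeff_toLp] at h
  have e : ∫ θ, ‖F θ‖ ^ 2 = ∫ θ, ‖ContinuousMap.toLp (E := ℂ) 2 volume ℂ F θ‖ ^ 2 := by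
    refine integral_congr_ae ?_
    filter_upwards [ContinuousMap.coeFn_toLp volume (p := 2) (𝕜 := ℂ) F] with θ hθ
    rw [hθ]
  rw [e]
  exact h

lemma fc_conj (n : Fin d → ℤ) (F : C(UnitAddTorus (Fin d), ℂ)) :
    fc n (star F) = starRingEnd ℂ (fc (-n) F) := by
  simp only [fc_apply, UnitAddTorus.mFourierCoeff]
  rw [← integral_conj (𝕜 := ℂ)]
  refine integral_congr_ae (Filter.Eventually.of_forall fun θ => ?_)
  simp [UnitAddTorus.mFourier_neg]

/-- By Parseval, pointwise domination passes to the ℓ² norms of the coefficients. This and the two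
variants below carry pointwise bounds over to Sobolev norms. -/
lemma tsum_fc_sq_le {F : C(UnitAddTorus (Fin d), ℂ)} {G : C(UnitAddTorus (Fin d), ℂ)} {K : ℝ}
    (h : ∀ θ, ‖F θ‖ ≤ K * ‖G θ‖) :
    ∑' n, ‖fc n F‖ ^ 2 ≤ K ^ 2 * ∑' n, ‖fc n G‖ ^ 2 := by
  rw [(hasSum_norm_fc_sq F).tsum_eq, (hasSum_norm_fc_sq G).tsum_eq, ← integral_const_mul]
  have hint : ∀ F : C(UnitAddTorus (Fin d), ℂ), Integrable (fun θ => ‖F θ‖ ^ 2) := fun F =>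
    Continuous.integrable_of_hasCompactSupport (by fun_prop) (HasCompactSupport.of_compactSpace _)
  refine integral_mono (hint F) ((hint G).const_mul _) fun θ => ?_
  have := pow_le_pow_left₀ (norm_nonneg _) (h θ) 2
  rwa [mul_pow] at this

lemma tsum_fc_sq_le_const {F : C(UnitAddTorus (Fin d), ℂ)} {K : ℝ} (h : ∀ θ, ‖F θ‖ ≤ K) :
    ∑' n, ‖fc n F‖ ^ 2 ≤ K ^ 2 := by
  have h1 := tsum_fc_sq_le (F := F) (G := 1) (K := K) (by simpa using h)
  have h2 : ∑' n, ‖fc n (1 : C(UnitAddTorus (Fin d), ℂ))‖ ^ 2 = 1 := by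
    rw [(hasSum_norm_fc_sq _).tsum_eq]; simp
  rwa [h2, mul_one] at h1

lemma tsum_fc_sq_le_add {F G₁ G₂ : C(UnitAddTorus (Fin d), ℂ)} {K₁ K₂ : ℝ}
    (h : ∀ θ, ‖F θ‖ ≤ K₁ * ‖G₁ θ‖ + K₂ * ‖G₂ θ‖) :
    ∑' n, ‖fc n F‖ ^ 2 ≤
      2 * K₁ ^ 2 * ∑' n, ‖fc n G₁‖ ^ 2 + 2 * K₂ ^ 2 * ∑' n, ‖fc n G₂‖ ^ 2 := by
  rw [(hasSum_norm_fc_sq F).tsum_eq, (hasSum_norm_fc_sq G₁).tsum_eq, (hasSum_norm_fc_sq G₂).tsum_eq,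
    ← integral_const_mul, ← integral_const_mul]
  have hint : ∀ F : C(UnitAddTorus (Fin d), ℂ), Integrable (fun θ => ‖F θ‖ ^ 2) := fun F =>
    Continuous.integrable_of_hasCompactSupport (by fun_prop) (HasCompactSupport.of_compactSpace _)
  rw [← integral_add ((hint G₁).const_mul _) ((hint G₂).const_mul _)]
  refine integral_mono (hint F) (((hint G₁).const_mul _).add ((hint G₂).const_mul _)) fun θ => ?_
  have := pow_le_pow_left₀ (norm_nonneg _) (h θ) 2
  nlinarith [sq_nonneg (K₁ * ‖G₁ θ‖ - K₂ * ‖G₂ θ‖)]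

lemma summable_fc_sq (F : C(UnitAddTorus (Fin d), ℂ)) : Summable fun n => ‖fc n F‖ ^ 2 :=
  (hasSum_norm_fc_sq F).summable

lemma hasSum_fc (F : C(UnitAddTorus (Fin d), ℂ)) (h : Summable fun n => ‖fc n F‖) :
    HasSum (fun n => fc n F • (UnitAddTorus.mFourier n : C(UnitAddTorus (Fin d), ℂ))) F :=
  UnitAddTorus.hasSum_mFourier_series_of_summable h.of_norm

lemma tendsto_fc {α : Type*} {l : Filter α} {F : α → C(UnitAddTorus (Fin d), ℂ)}
    {F₀ : C(UnitAddTorus (Fin d), ℂ)} (h : Filter.Tendsto F l (𝓝 F₀)) (n : Fin d → ℤ) :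
    Filter.Tendsto (fun a => fc n (F a)) l (𝓝 (fc n F₀)) := by
  have hc : Continuous (fc n : C(UnitAddTorus (Fin d), ℂ) →ₗ[ℂ] ℂ) :=
    AddMonoidHomClass.continuous_of_bound (fc n) 1 fun F => by simpa using norm_fc_le n F
  exact (hc.tendsto F₀).comp h

end FourierCoefficients

/-! ### Sobolev bounds uniform over finite sets of modes -/

section HasHs

variable {d : ℕ}

/-- The `h^s` norm of the continuous function `F` is at most `b`. -/
def HasHs (s b : ℝ) (F : C(UnitAddTorus (Fin d), ℂ)) : Prop :=
  0 ≤ b ∧ ∀ S, sobNorm s S (fun n => ‖fc n F‖) ≤ b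

lemma sobNorm_le_of_le {s : ℝ} {S : Finset (Fin d → ℤ)} {a a' : (Fin d → ℤ) → ℝ}
    (h0 : ∀ n ∈ S, 0 ≤ a n) (h : ∀ n ∈ S, a n ≤ a' n) : sobNorm s S a ≤ sobNorm s S a' :=
  Real.sqrt_le_sqrt (Finset.sum_le_sum fun n hn => mul_le_mul_of_nonneg_left
    (pow_le_pow_left₀ (h0 n hn) (h n hn) 2) (bracket_rpow_pos n _).le)

lemma sobNorm_eq_norm (s : ℝ) (S : Finset (Fin d → ℤ)) (a : (Fin d → ℤ) → ℝ) :
    sobNorm s S a = ‖(WithLp.toLp 2 fun n : S => bracket (n : Fin d → ℤ) ^ s * a n :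
      EuclideanSpace ℝ S)‖ := by
  rw [EuclideanSpace.norm_eq, sobNorm, ← Finset.sum_coe_sort S]
  congr 1
  refine Finset.sum_congr rfl fun n _ => ?_
  rw [bracket_rpow_two_mul, Real.norm_eq_abs, sq_abs, mul_pow]

lemma sobNorm_add_le (s : ℝ) (S : Finset (Fin d → ℤ)) (a a' : (Fin d → ℤ) → ℝ) :
    sobNorm s S (fun n => a n + a' n) ≤ sobNorm s S a + sobNorm s S a' := by
  simp only [sobNorm_eq_norm]
  refine le_trans (le_of_eq ?_) (norm_add_le _ _)
  congr 1
  ext n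
  simp [mul_add]

lemma sobNorm_const_mul (s : ℝ) (S : Finset (Fin d → ℤ)) {c : ℝ} (hc : 0 ≤ c)
    (a : (Fin d → ℤ) → ℝ) : sobNorm s S (fun n => c * a n) = c * sobNorm s S a := by
  rw [← abs_of_nonneg hc, ← Real.norm_eq_abs, sobNorm_eq_norm, sobNorm_eq_norm, ← norm_smul]
  congr 1
  ext n
  simp [abs_of_nonneg hc]; ring

lemma sobNorm_sum_le {α : Type*} (s : ℝ) (S : Finset (Fin d → ℤ)) (t : Finset α)
    (a : α → (Fin d → ℤ) → ℝ) :
    sobNorm s S (fun n => ∑ i ∈ t, a i n) ≤ ∑ i ∈ t, sobNorm s S (a i) := by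
  classical
  induction t using Finset.induction_on with
  | empty => simp [sobNorm]
  | insert i t hi ih =>
    simp only [Finset.sum_insert hi]
    exact (sobNorm_add_le s S _ _).trans (by gcongr)

lemma HasHs.mono {s b b' : ℝ} {F : C(UnitAddTorus (Fin d), ℂ)} (h : HasHs s b F) (hb : b ≤ b') :
    HasHs s b' F := ⟨h.1.trans hb, fun S => (h.2 S).trans hb⟩

lemma HasHs.sum {α : Type*} {s : ℝ} (t : Finset α) {b : α → ℝ} {F : α → C(UnitAddTorus (Fin d), ℂ)}
    (h : ∀ i ∈ t, HasHs s (b i) (F i)) : HasHs s (∑ i ∈ t, b i) (∑ i ∈ t, F i) := by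
  refine ⟨Finset.sum_nonneg fun i hi => (h i hi).1, fun S => ?_⟩
  refine le_trans ?_ ((sobNorm_sum_le s S t fun i n => ‖fc n (F i)‖).trans
    (Finset.sum_le_sum fun i hi => (h i hi).2 S))
  refine sobNorm_le_of_le (fun n _ => norm_nonneg _) fun n _ => ?_
  rw [map_sum]; exact norm_sum_le _ _

lemma HasHs.add {s b b' : ℝ} {F F' : C(UnitAddTorus (Fin d), ℂ)} (h : HasHs s b F)
    (h' : HasHs s b' F') : HasHs s (b + b') (F + F') := by
  refine ⟨add_nonneg h.1 h'.1, fun S => le_trans ?_ ((sobNorm_add_le s S (fun n => ‖fc n F‖)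
    fun n => ‖fc n F'‖).trans (add_le_add (h.2 S) (h'.2 S)))⟩
  refine sobNorm_le_of_le (fun n _ => norm_nonneg _) fun n _ => ?_
  rw [map_add]; exact norm_add_le _ _

lemma HasHs.smul {s b : ℝ} {F : C(UnitAddTorus (Fin d), ℂ)} (h : HasHs s b F) (c : ℂ) :
    HasHs s (‖c‖ * b) (c • F) := by
  refine ⟨mul_nonneg (norm_nonneg _) h.1, fun S => ?_⟩
  simp only [map_smul, smul_eq_mul, norm_mul]
  rw [sobNorm_const_mul s S (norm_nonneg c)]
  exact mul_le_mul_of_nonneg_left (h.2 S) (norm_nonneg _)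

lemma HasHs.conj {s b : ℝ} {F : C(UnitAddTorus (Fin d), ℂ)} (h : HasHs s b F) :
    HasHs s b (star F) := by
  refine ⟨h.1, fun S => le_trans (le_of_eq ?_) (h.2 (S.map (Equiv.neg _).toEmbedding))⟩
  simp [sobNorm, fc_conj]

/-- For a fixed finite set of modes the norm depends continuously on finitely many Fourier
coefficients, so the bound survives uniform limits. -/
lemma HasHs.of_tendsto {α : Type*} {l : Filter α} [l.NeBot] {s b : ℝ}
    {F : α → C(UnitAddTorus (Fin d), ℂ)} {F₀ : C(UnitAddTorus (Fin d), ℂ)} (hb : 0 ≤ b)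
    (h : ∀ᶠ a in l, HasHs s b (F a)) (hF : Filter.Tendsto F l (𝓝 F₀)) : HasHs s b F₀ := by
  refine ⟨hb, fun S => ?_⟩
  have h1 : Filter.Tendsto (fun a => sobNorm s S fun n => ‖fc n (F a)‖) l
      (𝓝 (sobNorm s S fun n => ‖fc n F₀‖)) := by
    refine (Real.continuous_sqrt.tendsto _).comp (tendsto_finsetSum S fun n _ => ?_)
    exact ((tendsto_fc hF n).norm.pow 2).const_mul _
  exact le_of_tendsto h1 (h.mono fun a ha => ha.2 S)

lemma HasHs.summable {s b : ℝ} {F : C(UnitAddTorus (Fin d), ℂ)} (h : HasHs s b F)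
    (hs : (d : ℝ) ≤ s) : Summable fun n => ‖fc n F‖ :=
  summable_of_sum_le (fun _ => norm_nonneg _) fun S => sum_le_sobNorm_of_subset hs |>.trans
    (mul_le_mul_of_nonneg_left (h.2 S) (zero_le_one.trans embConst_ge_one))

lemma HasHs.tsum_le {s b : ℝ} {F : C(UnitAddTorus (Fin d), ℂ)} (h : HasHs s b F)
    (hs : (d : ℝ) ≤ s) : ∑' n, ‖fc n F‖ ≤ embConst d * b :=
  (h.summable hs).tsum_le_of_sum_le fun S => sum_le_sobNorm_of_subset hs |>.trans
    (mul_le_mul_of_nonneg_left (h.2 S) (zero_le_one.trans embConst_ge_one))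

end HasHs
end

noncomputable section

/-! ### Sobolev regularity from approximation by trigonometric polynomials -/

section TrigPoly

open MeasureTheory Polynomial

variable {d : ℕ}

lemma finite_nrm_le (L : ℝ) : {n : Fin d → ℤ | nrm n ≤ L}.Finite := by
  refine (Set.finite_Icc (fun _ : Fin d => -⌈L⌉) fun _ => ⌈L⌉).subset fun n hn => ?_
  have h : ∀ i, |n i| ≤ ⌈L⌉ := fun i => by
    have : (|n i| : ℝ) ≤ ⌈L⌉ := ((abs_apply_le_nrm n i).trans hn).trans (Int.le_ceil L)
    exact_mod_cast this
  exact ⟨fun i => (abs_le.1 (h i)).1, fun i => (abs_le.1 (h i)).2⟩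

/-- The finite set of modes with `|n| ≤ L`. -/
def modeBall (d : ℕ) (L : ℝ) : Finset (Fin d → ℤ) := (finite_nrm_le (d := d) L).toFinset

@[simp] lemma mem_modeBall {L : ℝ} {n : Fin d → ℤ} : n ∈ modeBall d L ↔ nrm n ≤ L := by
  simp [modeBall]

/-- Trigonometric polynomials with frequencies of size at most `N`. -/
def trigPoly (d : ℕ) (N : ℝ) : Submodule ℂ C(UnitAddTorus (Fin d), ℂ) :=
  Submodule.span ℂ (UnitAddTorus.mFourier '' {n : Fin d → ℤ | nrm n ≤ N})

lemma mFourier_mem_trigPoly {N : ℝ} {n : Fin d → ℤ} (h : nrm n ≤ N) :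
    (UnitAddTorus.mFourier n : C(UnitAddTorus (Fin d), ℂ)) ∈ trigPoly d N :=
  Submodule.subset_span ⟨n, h, rfl⟩

lemma trigPoly_mono {N M : ℝ} (h : N ≤ M) : trigPoly d N ≤ trigPoly d M :=
  Submodule.span_mono (Set.image_mono fun _ hn => le_trans hn h)

lemma fc_eq_zero_of_mem_trigPoly {N : ℝ} {F : C(UnitAddTorus (Fin d), ℂ)} (hF : F ∈ trigPoly d N)
    {n : Fin d → ℤ} (hn : N < nrm n) : fc n F = 0 := by
  induction hF using Submodule.span_induction with
  | mem F h =>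
    obtain ⟨m, hm, rfl⟩ := h
    rw [fc_mFourier, if_neg]
    rintro rfl
    exact absurd hm (not_le.2 hn)
  | zero => simp
  | add F G _ _ hF hG => rw [map_add, hF, hG, add_zero]
  | smul c F _ hF => rw [map_smul, hF, smul_zero]

lemma mul_mem_trigPoly {N M : ℝ} {F G : C(UnitAddTorus (Fin d), ℂ)} (hF : F ∈ trigPoly d N)
    (hG : G ∈ trigPoly d M) : F * G ∈ trigPoly d (N + M) := by
  have h := Submodule.mul_mem_mul hF hG
  rw [trigPoly, trigPoly, Submodule.span_mul_span] at h
  refine Submodule.span_mono ?_ h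
  rintro _ ⟨_, ⟨m, hm, rfl⟩, _, ⟨n, hn, rfl⟩, rfl⟩
  exact ⟨m + n, (nrm_add_le m n).trans (add_le_add hm hn), by
    ext θ; exact UnitAddTorus.mFourier_add⟩

lemma star_mem_trigPoly {N : ℝ} {F : C(UnitAddTorus (Fin d), ℂ)} (hF : F ∈ trigPoly d N) :
    star F ∈ trigPoly d N := by
  induction hF using Submodule.span_induction with
  | mem F h =>
    obtain ⟨m, hm, rfl⟩ := h
    have : star (UnitAddTorus.mFourier m : C(UnitAddTorus (Fin d), ℂ)) = UnitAddTorus.mFourier (-m) := by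
      ext θ; exact UnitAddTorus.mFourier_neg.symm
    rw [this]
    exact mFourier_mem_trigPoly (by simpa using hm)
  | zero => simp
  | add F G _ _ hF hG => rw [star_add]; exact Submodule.add_mem _ hF hG
  | smul c F _ hF => rw [star_smul]; exact Submodule.smul_mem _ _ hF

lemma pow_mem_trigPoly {N : ℝ} {F : C(UnitAddTorus (Fin d), ℂ)} (hF : F ∈ trigPoly d N) (k : ℕ) :
    F ^ k ∈ trigPoly d (k * N) := by
  induction k with
  | zero =>
    rw [pow_zero, ← UnitAddTorus.mFourier_zero]
    exact mFourier_mem_trigPoly (by simp)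
  | succ k ih =>
    rw [pow_succ, Nat.cast_succ, add_one_mul]
    exact mul_mem_trigPoly ih hF

lemma aeval_mem_trigPoly {N : ℝ} (hN : 0 ≤ N) {F : C(UnitAddTorus (Fin d), ℂ)}
    (hF : F ∈ trigPoly d N) (p : ℂ[X]) {k : ℕ} (hk : p.natDegree ≤ k) :
    aeval F p ∈ trigPoly d (k * N) := by
  rw [aeval_eq_sum_range]
  refine Submodule.sum_mem _ fun i hi => Submodule.smul_mem _ _
    (trigPoly_mono ?_ (pow_mem_trigPoly hF i))
  have : i ≤ k := by simp at hi; omega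
  gcongr

/-- The truncation of a function to the modes with `|n| ≤ N`. -/
def trunc (N : ℝ) (F : C(UnitAddTorus (Fin d), ℂ)) : C(UnitAddTorus (Fin d), ℂ) :=
  ∑ n ∈ modeBall d N, fc n F • UnitAddTorus.mFourier n

lemma trunc_mem_trigPoly (N : ℝ) (F : C(UnitAddTorus (Fin d), ℂ)) : trunc N F ∈ trigPoly d N :=
  Submodule.sum_mem _ fun _ hn => Submodule.smul_mem _ _ (mFourier_mem_trigPoly (mem_modeBall.1 hn))

lemma fc_sum_mFourier (S : Finset (Fin d → ℤ)) (v : (Fin d → ℤ) → ℂ) (n : Fin d → ℤ) :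
    fc n (∑ m ∈ S, v m • (UnitAddTorus.mFourier m : C(UnitAddTorus (Fin d), ℂ))) =
      if n ∈ S then v n else 0 := by
  simp [fc_mFourier]

lemma fc_sub_trunc (N : ℝ) (F : C(UnitAddTorus (Fin d), ℂ)) (n : Fin d → ℤ) :
    fc n (F - trunc N F) = if N < nrm n then fc n F else 0 := by
  rw [map_sub, trunc, fc_sum_mFourier]
  simp only [mem_modeBall]
  by_cases h : nrm n ≤ N
  · simp [h, not_lt.2 h]
  · simp [h, not_le.1 h]

lemma norm_sum_mFourier_le (S : Finset (Fin d → ℤ)) (v : (Fin d → ℤ) → ℂ)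
    (θ : UnitAddTorus (Fin d)) :
    ‖(∑ m ∈ S, v m • (UnitAddTorus.mFourier m : C(UnitAddTorus (Fin d), ℂ))) θ‖ ≤ ∑ m ∈ S, ‖v m‖ := by
  refine (ContinuousMap.norm_coe_le_norm _ θ).trans ((norm_sum_le _ _).trans (le_of_eq ?_))
  simp [norm_smul, UnitAddTorus.mFourier_norm]

lemma norm_trunc_apply_le {F : C(UnitAddTorus (Fin d), ℂ)} (h : Summable fun n => ‖fc n F‖) (N : ℝ)
    (θ : UnitAddTorus (Fin d)) : ‖trunc N F θ‖ ≤ ∑' n, ‖fc n F‖ :=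
  (norm_sum_mFourier_le _ _ θ).trans (h.sum_le_tsum _ fun _ _ => norm_nonneg _)

lemma norm_apply_le_tsum {F : C(UnitAddTorus (Fin d), ℂ)} (h : Summable fun n => ‖fc n F‖)
    (θ : UnitAddTorus (Fin d)) : ‖F θ‖ ≤ ∑' n, ‖fc n F‖ := by
  refine (ContinuousMap.norm_coe_le_norm F θ).trans
    ((hasSum_fc F h).norm_le_of_bounded h.hasSum fun n => le_of_eq ?_)
  rw [norm_smul, UnitAddTorus.mFourier_norm, mul_one]

lemma tsum_fc_sub_trunc (N : ℝ) (F : C(UnitAddTorus (Fin d), ℂ)) :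
    ∑' n, ‖fc n (F - trunc N F)‖ ^ 2 = ∑' n, if N < nrm n then ‖fc n F‖ ^ 2 else 0 := by
  refine tsum_congr fun n => ?_
  rw [fc_sub_trunc]; split_ifs <;> simp

open scoped ENNReal in
/-- A comparison of tails implies a comparison of weighted sums. -/
lemma tsum_weight_le_of_tail {κ p : ℝ} (hκ : 0 < κ) (hp : 0 < p) (α β : (Fin d → ℤ) → ℝ≥0∞)
    (h : ∀ t, 0 < t → ∑' n, {n | κ * t < nrm n}.indicator α n ≤ ∑' n, {n | t < nrm n}.indicator β n) :
    ∑' n, α n * ENNReal.ofReal (nrm n ^ p) ≤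
      ENNReal.ofReal (κ ^ p) * ∑' n, β n * ENNReal.ofReal (nrm n ^ p) := by
  -- Layer-cake formula for the measures of densities α and β on the lattice: each weighted sum is
  -- an integral over t of masses of tails, and `h` compares these masses.
  have hset : ∀ (α : (Fin d → ℤ) → ℝ≥0∞) (A : Set (Fin d → ℤ)),
      (Measure.count.withDensity α) A = ∑' n, A.indicator α n := by
    intro α A
    rw [withDensity_apply _ (Set.to_countable A).measurableSet,
      ← lintegral_indicator (Set.to_countable A).measurableSet, lintegral_count]
  have hint : ∀ α f : (Fin d → ℤ) → ℝ≥0∞,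
      ∫⁻ n, f n ∂(Measure.count.withDensity α) = ∑' n, α n * f n := by
    intro α f
    rw [lintegral_withDensity_eq_lintegral_mul _ (Measurable.of_discrete) (Measurable.of_discrete),
      lintegral_count]
    rfl
  have h1 := lintegral_rpow_eq_lintegral_meas_lt_mul (Measure.count.withDensity α)
    (f := fun n : Fin d → ℤ => nrm n / κ)
    (Filter.Eventually.of_forall fun n => div_nonneg (nrm_nonneg n) hκ.le)
    (Measurable.of_discrete).aemeasurable hp
  have h2 := lintegral_rpow_eq_lintegral_meas_lt_mul (Measure.count.withDensity β)
    (f := fun n : Fin d → ℤ => nrm n) (Filter.Eventually.of_forall fun n => nrm_nonneg n)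
    (Measurable.of_discrete).aemeasurable hp
  rw [hint] at h1 h2
  have h3 : ∑' n, α n * ENNReal.ofReal ((nrm n / κ) ^ p) ≤ ∑' n, β n * ENNReal.ofReal (nrm n ^ p) := by
    rw [h1, h2]
    gcongr ENNReal.ofReal p * ?_
    refine setLIntegral_mono' measurableSet_Ioi fun t ht => ?_
    gcongr ?_ * _
    rw [hset, hset]
    refine le_trans (le_of_eq ?_) (h t ht)
    simp only [lt_div_iff₀ hκ, mul_comm]
  calc ∑' n, α n * ENNReal.ofReal (nrm n ^ p)
      = ENNReal.ofReal (κ ^ p) * ∑' n, α n * ENNReal.ofReal ((nrm n / κ) ^ p) := by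
        rw [← ENNReal.tsum_mul_left]
        refine tsum_congr fun n => ?_
        rw [Real.div_rpow (nrm_nonneg n) hκ.le, mul_left_comm, ← ENNReal.ofReal_mul (by positivity),
          mul_div_cancel₀ _ (Real.rpow_pos_of_pos hκ p).ne']
    _ ≤ _ := by gcongr

lemma bracket_rpow_le {s : ℝ} (hs : 0 ≤ s) (n : Fin d → ℤ) :
    bracket n ^ (2 * s) ≤ 2 ^ s * (1 + nrm n ^ (2 * s)) := by
  have h0 := nrm_nonneg n
  rw [Real.rpow_mul (bracket_nonneg n), Real.rpow_mul h0, Real.rpow_two, Real.rpow_two, bracket_sq]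
  have h1 : 1 + nrm n ^ 2 ≤ 2 * max 1 (nrm n ^ 2) := by
    linarith [le_max_left 1 (nrm n ^ 2), le_max_right 1 (nrm n ^ 2)]
  refine (Real.rpow_le_rpow (by positivity) h1 hs).trans ?_
  rw [Real.mul_rpow (by norm_num) (by positivity)]
  gcongr
  rcases le_total 1 (nrm n ^ 2) with h | h
  · rw [max_eq_right h]; linarith
  · rw [max_eq_left h, Real.one_rpow]; linarith [Real.rpow_nonneg (sq_nonneg (nrm n)) s]

/-- Functions that are well approximated by trigonometric polynomials belong to `h^s`. -/
lemma sobNorm_sq_le_of_approx {s κ A B : ℝ} (hs : 0 < s) (hκ : 0 < κ)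
    {F : C(UnitAddTorus (Fin d), ℂ)} (hA : ∀ θ, ‖F θ‖ ≤ A) {β : (Fin d → ℤ) → ℝ} (hβ : ∀ n, 0 ≤ β n)
    (hβs : Summable β) (hB : ∀ S : Finset (Fin d → ℤ), ∑ n ∈ S, bracket n ^ (2 * s) * β n ≤ B)
    (h : ∀ t, 0 < t → ∃ G ∈ trigPoly d (κ * t),
      ∑' n, ‖fc n (F - G)‖ ^ 2 ≤ ∑' n, if t < nrm n then β n else 0) (S : Finset (Fin d → ℤ)) :
    sobNorm s S (fun n => ‖fc n F‖) ^ 2 ≤ 2 ^ s * (A ^ 2 + κ ^ (2 * s) * B) := by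
  have hB0 : 0 ≤ B := by simpa using hB ∅
  have h1 : ∑' n, ENNReal.ofReal (‖fc n F‖ ^ 2) * ENNReal.ofReal (nrm n ^ (2 * s)) ≤
      ENNReal.ofReal (κ ^ (2 * s)) *
        ∑' n, ENNReal.ofReal (β n) * ENNReal.ofReal (nrm n ^ (2 * s)) := by
    refine tsum_weight_le_of_tail hκ (by positivity) _ _ fun t ht => ?_
    obtain ⟨G, hG, hFG⟩ := h t ht
    calc ∑' n, {n | κ * t < nrm n}.indicator (fun n => ENNReal.ofReal (‖fc n F‖ ^ 2)) n
        ≤ ∑' n, ENNReal.ofReal (‖fc n (F - G)‖ ^ 2) := by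
          refine ENNReal.tsum_le_tsum fun n => ?_
          rw [Set.indicator_apply]
          split_ifs with hn
          -- Beyond frequency κ t the approximant has no coefficient, so F and F - G agree there.
          · rw [map_sub, fc_eq_zero_of_mem_trigPoly hG hn, sub_zero]
          · exact bot_le
      _ = ENNReal.ofReal (∑' n, ‖fc n (F - G)‖ ^ 2) :=
          (ENNReal.ofReal_tsum_of_nonneg (fun n => by positivity) (summable_fc_sq _)).symm
      _ ≤ ENNReal.ofReal (∑' n, if t < nrm n then β n else 0) := ENNReal.ofReal_le_ofReal hFG
      _ = ∑' n, {n | t < nrm n}.indicator (fun n => ENNReal.ofReal (β n)) n := by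
          rw [ENNReal.ofReal_tsum_of_nonneg]
          · refine tsum_congr fun n => ?_
            rw [Set.indicator_apply]
            simp only [Set.mem_ofPred_eq]
            split_ifs <;> simp
          · intro n; split_ifs <;> simp [hβ]
          · refine hβs.of_nonneg_of_le (fun n => ?_) fun n => ?_
            · split_ifs <;> simp [hβ]
            · split_ifs <;> simp [hβ]
  have h2 : ∑' n, ENNReal.ofReal (β n) * ENNReal.ofReal (nrm n ^ (2 * s)) ≤ ENNReal.ofReal B := by
    refine ENNReal.summable.tsum_le_of_sum_le fun T => ?_
    refine le_trans ?_ (ENNReal.ofReal_le_ofReal (hB T))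
    rw [ENNReal.ofReal_sum_of_nonneg fun n _ => mul_nonneg (bracket_rpow_pos n _).le (hβ n)]
    refine Finset.sum_le_sum fun n _ => ?_
    rw [← ENNReal.ofReal_mul (hβ n), mul_comm]
    refine ENNReal.ofReal_le_ofReal (mul_le_mul_of_nonneg_right ?_ (hβ n))
    exact Real.rpow_le_rpow (nrm_nonneg n) (nrm_le_bracket n) (by positivity)
  have h3 : ∑ n ∈ S, nrm n ^ (2 * s) * ‖fc n F‖ ^ 2 ≤ κ ^ (2 * s) * B := by
    have hk : (0 : ℝ) ≤ κ ^ (2 * s) := by positivity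
    rw [← ENNReal.ofReal_le_ofReal_iff (by positivity), ENNReal.ofReal_mul hk,
      ENNReal.ofReal_sum_of_nonneg fun n _ => mul_nonneg (Real.rpow_nonneg (nrm_nonneg n) _) (sq_nonneg _)]
    refine le_trans ?_ ((ENNReal.sum_le_tsum S).trans (h1.trans (by gcongr)))
    refine Finset.sum_le_sum fun n _ => le_of_eq ?_
    rw [← ENNReal.ofReal_mul (by positivity), mul_comm]
  have h4 : ∑ n ∈ S, ‖fc n F‖ ^ 2 ≤ A ^ 2 :=
    ((summable_fc_sq F).sum_le_tsum S fun _ _ => by positivity).trans (tsum_fc_sq_le_const hA)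
  rw [sobNorm_sq]
  calc ∑ n ∈ S, bracket n ^ (2 * s) * ‖fc n F‖ ^ 2
      ≤ ∑ n ∈ S, 2 ^ s * (‖fc n F‖ ^ 2 + nrm n ^ (2 * s) * ‖fc n F‖ ^ 2) :=
        Finset.sum_le_sum fun n _ => by
          have := mul_le_mul_of_nonneg_right (bracket_rpow_le hs.le n) (sq_nonneg ‖fc n F‖)
          linarith
    _ ≤ _ := by
        rw [← Finset.mul_sum, Finset.sum_add_distrib]
        gcongr

end TrigPoly

/-! ### Algebra property of h^s -/

section Product

open Polynomial

variable {d : ℕ}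

lemma HasHs.sum_sq_le {s b : ℝ} {F : C(UnitAddTorus (Fin d), ℂ)} (h : HasHs s b F)
    (S : Finset (Fin d → ℤ)) : ∑ n ∈ S, bracket n ^ (2 * s) * ‖fc n F‖ ^ 2 ≤ b ^ 2 := by
  have := pow_le_pow_left₀ (sobNorm_nonneg _ _ _) (h.2 S) 2
  rwa [sobNorm_sq] at this

/-- The constant of the algebra property of `h^s`. -/
def algConst (d : ℕ) (s : ℝ) : ℝ := 3 * embConst d ^ 2 * (2 ^ s * 2 ^ s)

lemma algConst_ge_one {s : ℝ} (hs : 0 ≤ s) : 1 ≤ algConst d s := by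
  have h1 := embConst_ge_one (d := d)
  have h2 : (1 : ℝ) ≤ 2 ^ s := Real.one_le_rpow (by norm_num) hs
  unfold algConst
  have h3 := one_le_mul_of_one_le_of_one_le h2 h2
  have h4 := one_le_mul_of_one_le_of_one_le (one_le_pow₀ h1 : 1 ≤ embConst d ^ 2) h3
  linarith

/-- Multiply the truncations to |n| ≤ t. The product has frequencies at most 2t, and the error (F -
F_t) G + F_t (G - G_t) is controlled by the tails of F and G and by their ℓ¹ norms;
`sobNorm_sq_le_of_approx` applies with κ = 2. -/
lemma HasHs.mul {s b b' : ℝ} (hs : (d : ℝ) ≤ s) (hs0 : 0 < s) {F G : C(UnitAddTorus (Fin d), ℂ)}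
    (hF : HasHs s b F) (hG : HasHs s b' G) : HasHs s (algConst d s * (b * b')) (F * G) := by
  have hE := embConst_ge_one (d := d)
  have hb := hF.1
  have hb' := hG.1
  have hK : 0 ≤ algConst d s := zero_le_one.trans (algConst_ge_one hs0.le)
  refine ⟨by positivity, fun S => ?_⟩
  set A := embConst d * b with hA
  set A' := embConst d * b' with hA'
  have hA0 : 0 ≤ A := by positivity
  have hA'0 : 0 ≤ A' := by positivity
  have hsF := hF.summable hs
  have hsG := hG.summable hs
  have hFA : ∑' n, ‖fc n F‖ ≤ A := hF.tsum_le hs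
  have hGA : ∑' n, ‖fc n G‖ ≤ A' := hG.tsum_le hs
  have hsum : ∀ (t : ℝ) (H : C(UnitAddTorus (Fin d), ℂ)),
      Summable fun n => if t < nrm n then ‖fc n H‖ ^ 2 else 0 := fun t H =>
    (summable_fc_sq H).of_nonneg_of_le (fun n => by split_ifs <;> positivity)
      fun n => by split_ifs <;> simp
  have key := sobNorm_sq_le_of_approx (A := A * A') (B := 2 * A' ^ 2 * b ^ 2 + 2 * A ^ 2 * b' ^ 2)
    (κ := 2) (F := F * G) hs0 two_pos
    (fun θ => by
      rw [ContinuousMap.mul_apply, norm_mul]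
      exact mul_le_mul ((norm_apply_le_tsum hsF θ).trans hFA) ((norm_apply_le_tsum hsG θ).trans hGA)
        (norm_nonneg _) hA0)
    (β := fun n => 2 * A' ^ 2 * ‖fc n F‖ ^ 2 + 2 * A ^ 2 * ‖fc n G‖ ^ 2) (fun n => by positivity)
    (((summable_fc_sq F).mul_left _).add ((summable_fc_sq G).mul_left _))
    (fun T => by
      have e : ∑ n ∈ T, bracket n ^ (2 * s) * (2 * A' ^ 2 * ‖fc n F‖ ^ 2 + 2 * A ^ 2 * ‖fc n G‖ ^ 2) =
          2 * A' ^ 2 * ∑ n ∈ T, bracket n ^ (2 * s) * ‖fc n F‖ ^ 2 +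
          2 * A ^ 2 * ∑ n ∈ T, bracket n ^ (2 * s) * ‖fc n G‖ ^ 2 := by
        rw [Finset.mul_sum, Finset.mul_sum, ← Finset.sum_add_distrib]
        exact Finset.sum_congr rfl fun n _ => by ring
      rw [e]
      gcongr
      · exact hF.sum_sq_le T
      · exact hG.sum_sq_le T)
    (fun t _ => by
      refine ⟨trunc t F * trunc t G, ?_, ?_⟩
      · rw [two_mul]
        exact mul_mem_trigPoly (trunc_mem_trigPoly t F) (trunc_mem_trigPoly t G)
      · refine (tsum_fc_sq_le_add (G₁ := F - trunc t F) (G₂ := G - trunc t G) (K₁ := A') (K₂ := A)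
          fun θ => ?_).trans (le_of_eq ?_)
        · simp only [ContinuousMap.sub_apply, ContinuousMap.mul_apply]
          have e : F θ * G θ - trunc t F θ * trunc t G θ =
              (F θ - trunc t F θ) * G θ + trunc t F θ * (G θ - trunc t G θ) := by ring
          rw [e]
          refine (norm_add_le _ _).trans ?_
          rw [norm_mul, norm_mul, mul_comm ‖F θ - _‖]
          gcongr
          · exact (norm_apply_le_tsum hsG θ).trans hGA
          · exact (norm_trunc_apply_le hsF t θ).trans hFA
        · rw [tsum_fc_sub_trunc, tsum_fc_sub_trunc, ← tsum_mul_left, ← tsum_mul_left,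
            ← ((hsum t F).mul_left _).tsum_add ((hsum t G).mul_left _)]
          refine tsum_congr fun n => ?_
          split_ifs <;> simp) S
  refine abs_le_of_sq_le_sq' (key.trans ?_) (by positivity) |>.2
  have h2 : (1 : ℝ) ≤ 2 ^ s := Real.one_le_rpow (by norm_num) hs0.le
  rw [mul_comm 2 s, Real.rpow_mul two_pos.le, Real.rpow_two, hA, hA', algConst]
  generalize (2 : ℝ) ^ s = σ at *
  generalize embConst d = E at *
  have h3 : E ^ 2 ≤ E ^ 4 := pow_le_pow_right₀ hE (by norm_num)
  have h4 : σ ≤ σ ^ 4 := le_self_pow₀ h2 (by norm_num)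
  have h5 : σ ^ 3 ≤ σ ^ 4 := pow_le_pow_right₀ h2 (by norm_num)
  have h6 : 0 ≤ (b * b') ^ 2 := sq_nonneg _
  calc σ * ((E * b * (E * b')) ^ 2 + σ ^ 2 * (2 * (E * b') ^ 2 * b ^ 2 + 2 * (E * b) ^ 2 * b' ^ 2))
      = (σ * E ^ 4 + 4 * (σ ^ 3 * E ^ 2)) * (b * b') ^ 2 := by ring
    _ ≤ (σ ^ 4 * E ^ 4 + 4 * (σ ^ 4 * E ^ 4)) * (b * b') ^ 2 := by gcongr
    _ ≤ 9 * (σ ^ 4 * E ^ 4) * (b * b') ^ 2 := by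
        gcongr
        linarith [mul_nonneg (pow_nonneg (zero_le_one.trans h2) 4) (pow_nonneg (zero_le_one.trans hE) 4)]
    _ = _ := by ring

end Product

/-! ### Chebyshev polynomials of a real function in h^s -/

section Chebyshev

open Polynomial

variable {d : ℕ}

lemma abs_sin_natCast_mul_le (k : ℕ) (x : ℝ) : |Real.sin (k * x)| ≤ k * |Real.sin x| := by
  induction k with
  | zero => simp
  | succ k ih =>
    rw [Nat.cast_succ, add_one_mul, Real.sin_add]
    refine (abs_add_le _ _).trans ?_
    rw [abs_mul, abs_mul, add_one_mul]
    have h1 := mul_le_mul ih (Real.abs_cos_le_one x) (abs_nonneg _) (by positivity)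
    have h2 := mul_le_mul_of_nonneg_right (Real.abs_cos_le_one (k * x)) (abs_nonneg (Real.sin x))
    linarith

lemma abs_sin_intCast_mul_le (k : ℤ) (x : ℝ) : |Real.sin (k * x)| ≤ k.natAbs * |Real.sin x| := by
  obtain ⟨n, rfl | rfl⟩ := k.eq_nat_or_neg
  · simpa using abs_sin_natCast_mul_le n x
  · simpa using abs_sin_natCast_mul_le n x

/-- With x = cos a and y = cos b the difference is cos(ka) - cos(kb), a product of two sines at
multiplied angles, each of which costs a factor |k|. -/
lemma abs_chebyshev_sub_le (k : ℤ) {x y : ℝ} (hx : |x| ≤ 1) (hy : |y| ≤ 1) :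
    |(Chebyshev.T ℝ k).eval x - (Chebyshev.T ℝ k).eval y| ≤ (k.natAbs : ℝ) ^ 2 * |x - y| := by
  obtain ⟨a, rfl⟩ : ∃ a, Real.cos a = x :=
    ⟨Real.arccos x, Real.cos_arccos (abs_le.1 hx).1 (abs_le.1 hx).2⟩
  obtain ⟨b, rfl⟩ : ∃ b, Real.cos b = y :=
    ⟨Real.arccos y, Real.cos_arccos (abs_le.1 hy).1 (abs_le.1 hy).2⟩
  rw [Chebyshev.T_real_cos, Chebyshev.T_real_cos, Real.cos_sub_cos, Real.cos_sub_cos,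
    show (k * a + k * b) / 2 = k * ((a + b) / 2) by ring,
    show (k * a - k * b) / 2 = k * ((a - b) / 2) by ring]
  simp only [abs_mul, abs_neg, abs_two]
  have h1 := abs_sin_intCast_mul_le k ((a + b) / 2)
  have h2 := abs_sin_intCast_mul_le k ((a - b) / 2)
  have h3 := mul_le_mul h1 h2 (abs_nonneg _) (by positivity)
  linarith

lemma eval_chebyshev_ofReal (k : ℤ) (x : ℝ) :
    (Chebyshev.T ℂ k).eval (x : ℂ) = ((Chebyshev.T ℝ k).eval x : ℝ) := by
  rw [← Chebyshev.map_T (algebraMap ℝ ℂ) k, Polynomial.eval_map_algebraMap,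
    ← Complex.coe_algebraMap, Polynomial.aeval_algebraMap_apply_eq_algebraMap_eval]

lemma natDegree_chebyshev_le (k : ℤ) : (Chebyshev.T ℂ k).natDegree ≤ k.natAbs :=
  (Chebyshev.natDegree_T ℂ k).le

/-- The Chebyshev polynomials of a real function in `h^s` that is small in the Wiener algebra. -/
lemma HasHs.chebyshev {s b : ℝ} (hs : (d : ℝ) ≤ s) (hs0 : 0 < s) {V : C(UnitAddTorus (Fin d), ℂ)}
    (hV : HasHs s b V) (hre : ∀ θ, ((V θ).re : ℂ) = V θ) (hA : ∑' n, ‖fc n V‖ ≤ 1) (k : ℤ) :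
    HasHs s (2 ^ s * (k.natAbs + 1 : ℝ) ^ (s + 2) * (1 + b)) (aeval V (Chebyshev.T ℂ k)) := by
  have hb := hV.1
  refine ⟨by positivity, fun S => ?_⟩
  have hsV := hV.summable hs
  -- The shift keeps `κ` positive at k = 0.
  set κ : ℝ := k.natAbs + 1 with hκ
  have hκ1 : 1 ≤ κ := by simp [hκ]
  have hκ0 : 0 < κ := zero_lt_one.trans_le hκ1
  have hV1 : ∀ θ, |(V θ).re| ≤ 1 := fun θ =>
    (Complex.abs_re_le_norm _).trans ((norm_apply_le_tsum hsV θ).trans hA)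
  have hT1 : ∀ t θ, |(trunc t V θ).re| ≤ 1 := fun t θ =>
    (Complex.abs_re_le_norm _).trans ((norm_trunc_apply_le hsV t θ).trans hA)
  -- A polynomial of degree |k| multiplies frequencies by at most |k| and, on [-1, 1], distances by
  -- at most k². The approximation criterion thus gives a norm that grows only polynomially in k.
  have key := sobNorm_sq_le_of_approx (A := 1) (B := κ ^ 4 * b ^ 2) (κ := κ)
    (F := aeval V (Chebyshev.T ℂ k)) hs0 hκ0
    (fun θ => by
      rw [Polynomial.aeval_continuousMap_apply, ← hre, eval_chebyshev_ofReal, Complex.norm_real]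
      exact Chebyshev.abs_eval_T_real_le_one k (hV1 θ))
    (β := fun n => κ ^ 4 * ‖fc n V‖ ^ 2) (fun n => by positivity)
    ((summable_fc_sq V).mul_left _)
    (fun T => by
      have e : ∑ n ∈ T, bracket n ^ (2 * s) * (κ ^ 4 * ‖fc n V‖ ^ 2) =
          κ ^ 4 * ∑ n ∈ T, bracket n ^ (2 * s) * ‖fc n V‖ ^ 2 := by
        rw [Finset.mul_sum]
        exact Finset.sum_congr rfl fun n _ => by ring
      rw [e]
      gcongr
      exact hV.sum_sq_le T)
    (fun t ht => by
      -- The Lipschitz bound needs real values in [-1, 1], so the real part of the truncation is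
      -- used; its frequencies are still at most t.
      set W : C(UnitAddTorus (Fin d), ℂ) := (1 / 2 : ℂ) • (trunc t V + star (trunc t V)) with hW
      have hWm : W ∈ trigPoly d t := Submodule.smul_mem _ _ (Submodule.add_mem _
        (trunc_mem_trigPoly t V) (star_mem_trigPoly (trunc_mem_trigPoly t V)))
      have hWre : ∀ θ, W θ = ((trunc t V θ).re : ℝ) := fun θ => by
        have : W θ = (1 / 2 : ℂ) * (trunc t V θ + starRingEnd ℂ (trunc t V θ)) := rfl
        rw [this, Complex.add_conj]; push_cast; ring
      refine ⟨aeval W (Chebyshev.T ℂ k), ?_, ?_⟩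
      · refine trigPoly_mono ?_ (aeval_mem_trigPoly ht.le hWm _ (natDegree_chebyshev_le k))
        gcongr; simp [hκ]
      · refine (tsum_fc_sq_le (G := V - trunc t V) (K := κ ^ 2) fun θ => ?_).trans (le_of_eq ?_)
        · rw [ContinuousMap.sub_apply, ContinuousMap.sub_apply, aeval_continuousMap_apply,
            aeval_continuousMap_apply, hWre, ← hre, eval_chebyshev_ofReal, eval_chebyshev_ofReal,
            ← Complex.ofReal_sub, Complex.norm_real]
          refine (abs_chebyshev_sub_le k (hV1 θ) (hT1 t θ)).trans ?_
          gcongr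
          · simp [hκ]
          · have := Complex.abs_re_le_norm (V θ - trunc t V θ)
            simpa [hre] using this
        · rw [tsum_fc_sub_trunc, ← tsum_mul_left]
          refine tsum_congr fun n => ?_
          split_ifs
          · ring
          · simp) S
  refine abs_le_of_sq_le_sq' (key.trans ?_) (by positivity) |>.2
  have h2 : (1 : ℝ) ≤ 2 ^ s := Real.one_le_rpow (by norm_num) hs0.le
  have h3 : (1 : ℝ) ≤ κ ^ s := Real.one_le_rpow hκ1 hs0.le
  rw [mul_comm 2 s, Real.rpow_mul hκ0.le, Real.rpow_two, Real.rpow_add hκ0, Real.rpow_two]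
  generalize (2 : ℝ) ^ s = σ at *
  generalize κ ^ s = τ at *
  have h4 : σ ≤ σ ^ 2 := le_self_pow₀ h2 (by norm_num)
  have h5 : 1 ≤ τ ^ 2 * κ ^ 4 := one_le_mul_of_one_le_of_one_le (one_le_pow₀ h3) (one_le_pow₀ hκ1)
  calc σ * (1 ^ 2 + τ ^ 2 * (κ ^ 4 * b ^ 2)) ≤ σ ^ 2 * (τ ^ 2 * κ ^ 4 + τ ^ 2 * (κ ^ 4 * b ^ 2)) := by
        gcongr; rw [one_pow]; exact h5
    _ = σ ^ 2 * (τ ^ 2 * κ ^ 4) * (1 + b ^ 2) := by ring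
    _ ≤ σ ^ 2 * (τ ^ 2 * κ ^ 4) * (1 + b) ^ 2 := by
        gcongr; nlinarith
    _ = _ := by ring

end Chebyshev
end

noncomputable section

/-! ### Cosine series of smooth functions on [-1, 1] -/

section CosineSeries

open Polynomial

lemma norm_fourierCoeffOn_le {g : ℝ → ℂ} {A : ℝ} (hA : ∀ x, ‖g x‖ ≤ A) (n : ℤ) :
    ‖fourierCoeffOn Real.two_pi_pos g n‖ ≤ A := by
  rw [fourierCoeffOn_eq_integral, norm_smul]
  have h : ‖∫ x in (0 : ℝ)..2 * Real.pi, (fourier (-n) : C(AddCircle (2 * Real.pi - 0), ℂ)) x • g x‖ ≤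
      A * |2 * Real.pi - 0| := by
    refine intervalIntegral.norm_integral_le_of_norm_le_const fun x _ => ?_
    rw [norm_smul, fourier_apply, Circle.norm_coe, one_mul]
    exact hA x
  have hpi := Real.two_pi_pos
  rw [sub_zero, abs_of_pos hpi] at h
  rw [sub_zero, Real.norm_eq_abs, abs_of_pos (by positivity), one_div, inv_mul_le_iff₀ hpi]
  linarith

/-- Integration by parts j times; periodicity removes the boundary terms. -/
lemma norm_fourierCoeffOn_mul_pow_le (j : ℕ) {n : ℤ} (hn : n ≠ 0) {A : ℝ} :
    ∀ {g : ℝ → ℂ}, ContDiff ℝ ∞ g → Function.Periodic g (2 * Real.pi) →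
      (∀ x, ‖iteratedDeriv j g x‖ ≤ A) →
      |(n : ℝ)| ^ j * ‖fourierCoeffOn Real.two_pi_pos g n‖ ≤ A := by
  induction j with
  | zero =>
    intro g _ _ h
    simpa using norm_fourierCoeffOn_le (by simpa using h) n
  | succ j ih =>
    intro g hg hper h
    have hg' : ContDiff ℝ ∞ (deriv g) := (contDiff_infty_iff_deriv.1 hg).2
    have hper' : Function.Periodic (deriv g) (2 * Real.pi) := fun x => by
      have := deriv_comp_add_const (f := g) (2 * Real.pi) x
      rw [← this]; congr 1; ext y; exact hper y
    have h1 := ih hg' hper' (by simpa [iteratedDeriv_succ'] using h)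
    have h2 := fourierCoeffOn_of_hasDerivAt Real.two_pi_pos hn (f := g) (f' := deriv g)
      (fun x _ => (hg.differentiable (by simp) x).hasDerivAt)
      (hg'.continuous.intervalIntegrable _ _)
    have h3 : g (2 * Real.pi) - g 0 = 0 := by rw [sub_eq_zero]; simpa using hper 0
    rw [h3, mul_zero, zero_sub] at h2
    have hn' : (n : ℂ) ≠ 0 := by exact_mod_cast hn
    have h4 : ‖fourierCoeffOn Real.two_pi_pos g n‖ =
        |(n : ℝ)|⁻¹ * ‖fourierCoeffOn Real.two_pi_pos (deriv g) n‖ := by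
      rw [h2, ← norm_neg]
      have : (n : ℂ)⁻¹ * Complex.I * fourierCoeffOn Real.two_pi_pos (deriv g) n =
        -(1 / (-2 * (Real.pi : ℂ) * Complex.I * n) *
          -((((2 * Real.pi : ℝ) : ℂ) - ((0 : ℝ) : ℂ)) * fourierCoeffOn Real.two_pi_pos (deriv g) n)) := by
        have hpi : (Real.pi : ℂ) ≠ 0 := by exact_mod_cast Real.pi_ne_zero
        push_cast
        field_simp
        rw [Complex.I_sq]; ring
      rw [← this, norm_mul, norm_mul, Complex.norm_I, mul_one, norm_inv, Complex.norm_intCast]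
    have hn0 : 0 < |(n : ℝ)| := abs_pos.2 (by exact_mod_cast hn)
    rw [h4, pow_succ, mul_assoc, mul_inv_cancel_left₀ hn0.ne']
    exact h1

/-- The coefficients of the cosine series of `θ ↦ φ (cos θ)`. -/
def cosCoeff (φ : ℝ → ℝ) (n : ℤ) : ℂ :=
  fourierCoeffOn Real.two_pi_pos (fun θ => (φ (Real.cos θ) : ℂ)) n

lemma norm_iteratedDeriv_comp_cos_le {φ : ℝ → ℝ} (hφ : ContDiff ℝ ∞ φ) {m : ℕ} {A : ℝ}
    (hA : ∀ j ≤ m, ∀ x, |x| ≤ 1 → |iteratedDeriv j φ x| ≤ A) (θ : ℝ) :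
    ‖iteratedDeriv m (fun θ => (φ (Real.cos θ) : ℂ)) θ‖ ≤ m.factorial * A := by
  rw [← norm_iteratedFDeriv_eq_norm_iteratedDeriv]
  have hc : ContDiff ℝ ∞ (φ ∘ Real.cos) := hφ.comp Real.contDiff_cos
  have h1 := LinearIsometry.norm_iteratedFDeriv_comp_left (n := ∞) Complex.ofRealLI (x := θ)
    (f := φ ∘ Real.cos) hc.contDiffAt (i := m) (by exact_mod_cast le_top)
  have h2 := norm_iteratedFDeriv_comp_le (N := ∞) (n := m) hφ Real.contDiff_cos
    (by exact_mod_cast le_top) θ (C := A) (D := 1)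
    (fun i hi => by
      rw [norm_iteratedFDeriv_eq_norm_iteratedDeriv]
      exact hA i hi _ (Real.abs_cos_le_one θ))
    (fun i _ _ => by
      rw [norm_iteratedFDeriv_eq_norm_iteratedDeriv, one_pow]
      exact Real.abs_iteratedDeriv_cos_le_one i θ)
  rw [one_pow, mul_one] at h2
  exact h1.le.trans h2

lemma norm_cosCoeff_le {φ : ℝ → ℝ} (hφ : ContDiff ℝ ∞ φ) {m : ℕ} {A : ℝ}
    (hA : ∀ j ≤ m, ∀ x, |x| ≤ 1 → |iteratedDeriv j φ x| ≤ A) (n : ℤ) :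
    (n.natAbs + 1 : ℝ) ^ m * ‖cosCoeff φ n‖ ≤ 2 ^ m * m.factorial * A := by
  have hA0 : 0 ≤ A := (abs_nonneg _).trans (hA 0 (Nat.zero_le _) 0 (by simp))
  have hg : ContDiff ℝ ∞ fun θ => (φ (Real.cos θ) : ℂ) :=
    Complex.ofRealCLM.contDiff.comp (hφ.comp Real.contDiff_cos)
  by_cases hn : n = 0
  · subst hn
    have h0 := norm_fourierCoeffOn_le (g := fun θ => (φ (Real.cos θ) : ℂ)) (A := A) (fun θ => by
      rw [Complex.norm_real]
      simpa using hA 0 (Nat.zero_le _) _ (Real.abs_cos_le_one θ)) 0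
    have h1 : (1 : ℝ) ≤ 2 ^ m * m.factorial := one_le_mul_of_one_le_of_one_le
      (one_le_pow₀ (by norm_num)) (by exact_mod_cast Nat.succ_le_of_lt m.factorial_pos)
    simp only [Int.natAbs_zero, Nat.cast_zero, zero_add, one_pow, one_mul]
    exact h0.trans (le_mul_of_one_le_left hA0 h1)
  · have h1 := norm_fourierCoeffOn_mul_pow_le m hn hg
      (fun θ => by simp) (norm_iteratedDeriv_comp_cos_le hφ hA)
    have h2 : (n.natAbs + 1 : ℝ) ≤ 2 * |(n : ℝ)| := by
      have : (1 : ℝ) ≤ n.natAbs := by exact_mod_cast Int.natAbs_pos.2 hn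
      rw [Nat.cast_natAbs, Int.cast_abs] at *
      linarith
    calc (n.natAbs + 1 : ℝ) ^ m * ‖cosCoeff φ n‖ ≤ (2 * |(n : ℝ)|) ^ m * ‖cosCoeff φ n‖ := by gcongr
      _ = 2 ^ m * (|(n : ℝ)| ^ m * ‖cosCoeff φ n‖) := by rw [mul_pow]; ring
      _ ≤ 2 ^ m * (m.factorial * A) := mul_le_mul_of_nonneg_left h1 (by positivity)
      _ = _ := by ring

lemma summable_natAbs_add_one : Summable fun n : ℤ => ((n.natAbs + 1 : ℝ) ^ 2)⁻¹ := by
  have h : Summable fun n : ℤ => ((n : ℝ) ^ 2)⁻¹ := by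
    simpa using (Real.summable_one_div_int_pow (p := 2)).2 one_lt_two
  refine (h.add (summable_of_hasFiniteSupport (f := fun n : ℤ => if n = 0 then (1 : ℝ) else 0)
    ((Set.finite_singleton 0).subset fun n => by simp))).of_nonneg_of_le
    (fun n => by positivity) fun n => ?_
  by_cases hn : n = 0
  · simp [hn]
  · simp only [hn, if_false, add_zero]
    have : (0 : ℝ) < |(n : ℝ)| := abs_pos.2 (by exact_mod_cast hn)
    rw [Nat.cast_natAbs, Int.cast_abs, ← sq_abs (n : ℝ)]
    gcongr; linarith

lemma summable_cosCoeff {φ : ℝ → ℝ} (hφ : ContDiff ℝ ∞ φ) : Summable fun n => ‖cosCoeff φ n‖ := by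
  have hK : ∀ j : ℕ, ∃ A, ∀ x, |x| ≤ 1 → |iteratedDeriv j φ x| ≤ A := fun j => by
    obtain ⟨A, hA⟩ := (isCompact_Icc (a := (-1 : ℝ)) (b := 1)).exists_bound_of_continuousOn
      (hφ.continuous_iteratedDeriv j (by exact_mod_cast le_top)).continuousOn
    exact ⟨A, fun x hx => hA x (abs_le.1 hx)⟩
  choose A hA using hK
  have h := norm_cosCoeff_le hφ (m := 2) (A := ∑ j ∈ Finset.range 3, |A j|) fun j hj x hx =>
    (hA j x hx).trans ((le_abs_self _).trans (Finset.single_le_sum (f := fun j => |A j|)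
      (fun _ _ => abs_nonneg _) (by simp; omega)))
  refine (summable_natAbs_add_one.mul_left
    (2 ^ 2 * (Nat.factorial 2 : ℝ) * ∑ j ∈ Finset.range 3, |A j|)).of_nonneg_of_le (fun n => norm_nonneg _) fun n => ?_
  have h0 : (0 : ℝ) < (n.natAbs + 1 : ℝ) ^ 2 := by positivity
  rw [← div_eq_mul_inv, le_div_iff₀ h0, mul_comm]
  exact h n

/-- Averaging the Fourier series of φ(cos θ) at θ and -θ replaces the exponentials by cos(nθ) =
T_n(cos θ), so the evenness of the coefficients is not needed. -/
lemma hasSum_cosCoeff {φ : ℝ → ℝ} (hφ : ContDiff ℝ ∞ φ) {x : ℝ} (hx : |x| ≤ 1) :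
    HasSum (fun n => cosCoeff φ n * ((Chebyshev.T ℝ n).eval x : ℝ)) (φ x : ℂ) := by
  have : Fact (0 < 2 * Real.pi) := ⟨Real.two_pi_pos⟩
  obtain ⟨θ, rfl⟩ : ∃ a, Real.cos a = x :=
    ⟨Real.arccos x, Real.cos_arccos (abs_le.1 hx).1 (abs_le.1 hx).2⟩
  have hper : Function.Periodic (fun θ => (φ (Real.cos θ) : ℂ)) (2 * Real.pi) := fun θ => by simp
  have hcont : Continuous fun θ => (φ (Real.cos θ) : ℂ) :=
    Complex.continuous_ofReal.comp (hφ.continuous.comp Real.continuous_cos)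
  let f : C(AddCircle (2 * Real.pi), ℂ) := ⟨hper.lift, hcont.quotient_lift _⟩
  have hf : ∀ θ : ℝ, f θ = (φ (Real.cos θ) : ℂ) := fun θ => rfl
  have hcoeff : fourierCoeff f = cosCoeff φ := by
    ext n
    rw [fourierCoeff_eq_intervalIntegral f n 0, cosCoeff, fourierCoeffOn_eq_integral]
    simp only [hf, zero_add, sub_zero, fourier_coe_apply]
  have hsum : Summable (fourierCoeff f) := by rw [hcoeff]; exact (summable_cosCoeff hφ).of_norm
  have h1 := has_pointwise_sum_fourier_series_of_summable hsum (θ : AddCircle (2 * Real.pi))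
  have h2 := has_pointwise_sum_fourier_series_of_summable hsum ((-θ : ℝ) : AddCircle (2 * Real.pi))
  have h3 := (h1.add h2).mul_left (1 / 2 : ℂ)
  rw [hf, hf, Real.cos_neg] at h3
  have hpi : (Real.pi : ℂ) ≠ 0 := by exact_mod_cast Real.pi_ne_zero
  have e : (fun n => cosCoeff φ n * ((Chebyshev.T ℝ n).eval (Real.cos θ) : ℝ)) = fun n =>
      (1 / 2 : ℂ) * (fourierCoeff f n • (fourier n (θ : AddCircle (2 * Real.pi)) : ℂ) +
        fourierCoeff f n • (fourier n ((-θ : ℝ) : AddCircle (2 * Real.pi)) : ℂ)) := by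
    ext n
    rw [hcoeff, Chebyshev.T_real_cos, fourier_coe_apply, fourier_coe_apply, Complex.ofReal_cos,
      Complex.cos]
    rw [show 2 * (Real.pi : ℂ) * Complex.I * n * (θ : ℝ) / ((2 * Real.pi : ℝ) : ℂ) =
      ((n * θ : ℝ) : ℂ) * Complex.I by push_cast; field_simp]
    rw [show 2 * (Real.pi : ℂ) * Complex.I * n * ((-θ : ℝ) : ℂ) / ((2 * Real.pi : ℝ) : ℂ) =
      -((n * θ : ℝ) : ℂ) * Complex.I by push_cast; field_simp]
    simp only [smul_eq_mul]
    ring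
  rw [e, show (φ (Real.cos θ) : ℂ) = 1 / 2 * (φ (Real.cos θ) + φ (Real.cos θ)) by ring]
  exact h3

end CosineSeries

/-! ### Composition of smooth functions with functions in h^s -/

section Composition

open Polynomial

variable {d : ℕ}

/-- Composition of a smooth function with a real function in `h^s`. -/
lemma exists_hasHs_comp {s : ℝ} (hs : (d : ℝ) ≤ s) (hs0 : 0 < s) : ∃ (m : ℕ) (C : ℝ), 0 ≤ C ∧
    ∀ (φ : ℝ → ℝ) (A b : ℝ) (V F : C(UnitAddTorus (Fin d), ℂ)), ContDiff ℝ ∞ φ →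
      (∀ j ≤ m, ∀ x, |x| ≤ 1 → |iteratedDeriv j φ x| ≤ A) →
      HasHs s b V → (∀ θ, ((V θ).re : ℂ) = V θ) → ∑' n, ‖fc n V‖ ≤ 1 →
      (∀ θ, F θ = φ (V θ).re) → HasHs s (C * A * (1 + b)) F := by
  -- The functions T_n(V) grow like (|n| + 1)^{s+2} in h^s, and two more powers make the series
  -- converge. Neither `m` nor the constant depends on `φ`, which is later rescaled with the size of
  -- the solution.
  set m := ⌈s⌉₊ + 4 with hm
  set Z := ∑' n : ℤ, ((n.natAbs + 1 : ℝ) ^ 2)⁻¹ with hZ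
  have hZ0 : 0 ≤ Z := tsum_nonneg fun n => by positivity
  refine ⟨m, 2 ^ m * m.factorial * 2 ^ s * Z, by positivity, ?_⟩
  intro φ A b V F hφ hA hV hre hVA hF
  have hA0 : 0 ≤ A := (abs_nonneg _).trans (hA 0 (Nat.zero_le _) 0 (by simp))
  have hb := hV.1
  have hV1 : ∀ θ, |(V θ).re| ≤ 1 := fun θ =>
    (Complex.abs_re_le_norm _).trans ((norm_apply_le_tsum (hV.summable hs) θ).trans hVA)
  have hTval : ∀ (n : ℤ) θ, aeval V (Chebyshev.T ℂ n) θ = ((Chebyshev.T ℝ n).eval (V θ).re : ℝ) := by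
    intro n θ
    rw [aeval_continuousMap_apply, ← hre, eval_chebyshev_ofReal, Complex.ofReal_re]
  have hTn : ∀ n : ℤ, ‖aeval V (Chebyshev.T ℂ n)‖ ≤ 1 := fun n => by
    rw [ContinuousMap.norm_le _ zero_le_one]
    intro θ
    rw [hTval, Complex.norm_real]
    exact Chebyshev.abs_eval_T_real_le_one n (hV1 θ)
  have hsum : Summable fun n => cosCoeff φ n • aeval V (Chebyshev.T ℂ n) := by
    refine Summable.of_norm_bounded (summable_cosCoeff hφ) fun n => ?_
    rw [norm_smul]
    exact mul_le_of_le_one_right (norm_nonneg _) (hTn n)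
  have hFsum : HasSum (fun n => cosCoeff φ n • aeval V (Chebyshev.T ℂ n)) F := by
    have e : F = ∑' n, cosCoeff φ n • aeval V (Chebyshev.T ℂ n) := by
      ext θ
      have h1 := (ContinuousMap.evalCLM ℂ θ).hasSum hsum.hasSum
      rw [hF]
      refine (hasSum_cosCoeff hφ (hV1 θ)).unique ?_
      have e1 : (fun n => cosCoeff φ n * ((Chebyshev.T ℝ n).eval (V θ).re : ℝ)) = fun n =>
          ContinuousMap.evalCLM ℂ θ (cosCoeff φ n • aeval V (Chebyshev.T ℂ n)) := by
        ext n
        rw [map_smul, ContinuousMap.evalCLM_apply, hTval, smul_eq_mul]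
      rw [e1]
      exact h1
    rw [e]
    exact hsum.hasSum
  have hterm : ∀ n, HasHs s (2 ^ m * m.factorial * 2 ^ s * A * (1 + b) * ((n.natAbs + 1 : ℝ) ^ 2)⁻¹)
      (cosCoeff φ n • aeval V (Chebyshev.T ℂ n)) := fun n => by
    refine ((hV.chebyshev hs hs0 hre hVA n).smul (cosCoeff φ n)).mono ?_
    have h1 := norm_cosCoeff_le hφ hA n
    set κ : ℝ := n.natAbs + 1 with hκ
    have hκ1 : 1 ≤ κ := by simp [hκ]
    have hκ0 : 0 < κ := by linarith
    have h2 : κ ^ (s + 2) ≤ κ ^ m * (κ ^ 2)⁻¹ := by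
      rw [← Real.rpow_natCast κ m, ← Real.rpow_natCast κ 2, ← Real.rpow_neg hκ0.le,
        ← Real.rpow_add hκ0]
      refine Real.rpow_le_rpow_of_exponent_le hκ1 ?_
      have := Nat.le_ceil s
      rw [hm]; push_cast; linarith
    calc ‖cosCoeff φ n‖ * (2 ^ s * κ ^ (s + 2) * (1 + b))
        ≤ ‖cosCoeff φ n‖ * (2 ^ s * (κ ^ m * (κ ^ 2)⁻¹) * (1 + b)) := by gcongr
      _ = κ ^ m * ‖cosCoeff φ n‖ * (2 ^ s * (κ ^ 2)⁻¹ * (1 + b)) := by ring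
      _ ≤ 2 ^ m * m.factorial * A * (2 ^ s * (κ ^ 2)⁻¹ * (1 + b)) := by gcongr
      _ = _ := by ring
  refine HasHs.of_tendsto (by positivity) (Filter.Eventually.of_forall fun T : Finset ℤ => ?_) hFsum
  refine (HasHs.sum T fun n _ => hterm n).mono ?_
  rw [← Finset.mul_sum]
  calc _ ≤ 2 ^ m * m.factorial * 2 ^ s * A * (1 + b) * Z := by
        gcongr
        exact summable_natAbs_add_one.sum_le_tsum T fun n _ => by positivity
    _ = _ := by ring

end Composition
end

noncomputable section

/-! ### Taylor expansion of the nonlinearity and its remainder in h^s -/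

section Taylor

/-- Each vanishing derivative at the origin gains one power of |z| by the mean value inequality. -/
lemma exists_abs_le_pow (j : ℕ) : ∀ {g : ℝ → ℝ}, ContDiff ℝ ∞ g →
    (∀ i < j, iteratedDeriv i g 0 = 0) → ∀ R : ℝ, ∃ C, 0 ≤ C ∧ ∀ z, |z| ≤ R → |g z| ≤ C * |z| ^ j := by
  induction j with
  | zero =>
    intro g hg _ R
    obtain ⟨C, hC⟩ := (isCompact_Icc (a := -R) (b := R)).exists_bound_of_continuousOn
      hg.continuous.continuousOn
    exact ⟨|C|, abs_nonneg _, fun z hz => by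
      simpa using (hC z (abs_le.1 hz)).trans (le_abs_self C)⟩
  | succ j ih =>
    intro g hg h R
    obtain ⟨C, hC0, hC⟩ := ih (g := deriv g) (contDiff_infty_iff_deriv.1 hg).2
      (fun i hi => by rw [← iteratedDeriv_succ']; exact h (i + 1) (by omega)) R
    refine ⟨C, hC0, fun z hz => ?_⟩
    have hg0 : g 0 = 0 := by simpa using h 0 (by omega)
    have h1 := (convex_Icc (-|z|) |z|).norm_image_sub_le_of_norm_deriv_le (f := g) (x := 0) (y := z)
      (C := C * |z| ^ j) (fun x _ => hg.differentiable (by simp) x)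
      (fun x hx => by
        have hx' : |x| ≤ |z| := abs_le.2 hx
        exact (hC x (hx'.trans hz)).trans (by gcongr))
      (by simp) ⟨neg_abs_le z, le_abs_self z⟩
    rw [hg0, sub_zero, sub_zero, Real.norm_eq_abs, Real.norm_eq_abs] at h1
    rwa [pow_succ, ← mul_assoc]

/-- The Taylor coefficients at the origin. -/
def taylorCoeff (f : ℝ → ℝ) (j : ℕ) : ℝ := iteratedDeriv j f 0 / j.factorial

/-- The remainder of the Taylor expansion at the origin. -/
def taylorRem (f : ℝ → ℝ) (q : ℕ) (x : ℝ) : ℝ :=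
  f x - ∑ j ∈ Finset.range (q + 1), taylorCoeff f j * x ^ j

lemma contDiff_taylorRem {f : ℝ → ℝ} (hf : ContDiff ℝ ∞ f) (q : ℕ) : ContDiff ℝ ∞ (taylorRem f q) := by
  unfold taylorRem
  fun_prop

lemma iteratedDeriv_taylorRem {f : ℝ → ℝ} (hf : ContDiff ℝ ∞ f) {q i : ℕ} (hi : i ≤ q) :
    iteratedDeriv i (taylorRem f q) 0 = 0 := by
  have hf' : ContDiff ℝ i f := hf.of_le (by exact_mod_cast le_top)
  have e : taylorRem f q = f - fun x => ∑ j ∈ Finset.range (q + 1), taylorCoeff f j * x ^ j := rfl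
  rw [e, iteratedDeriv_sub hf'.contDiffAt (by fun_prop), iteratedDeriv_fun_sum (by fun_prop)]
  simp only [iteratedDeriv_const_mul_field, iteratedDeriv_fun_pow_zero]
  rw [Finset.sum_eq_single i]
  · rw [if_pos rfl, taylorCoeff, div_mul_cancel₀ _ (by positivity), sub_self]
  · intro j _ hj; simp [hj.symm]
  · intro h; simp at h; omega

end Taylor

section Remainder

variable {d : ℕ}

/-- Rescaling: V = |U|²/R with R of order b² has ℓ¹ norm at most 1, and x ↦ ψ(Rx), where ψ vanishes
to order q + 1 at the origin, has its derivatives on [-1, 1] of order R^{q+1}. Composition gives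
b^{2q+2}, and the last factor U one more power. -/
lemma exists_hasHs_taylorRem {f : ℝ → ℝ} (hf : ContDiff ℝ ∞ f) (q : ℕ) {s : ℝ} (hs : (d : ℝ) ≤ s)
    (hs0 : 0 < s) : ∃ C : ℝ, 0 ≤ C ∧ ∀ (b : ℝ) (U F : C(UnitAddTorus (Fin d), ℂ)), 0 < b → b ≤ 1 →
      HasHs s b U → (∀ θ, F θ = (taylorRem f q (‖U θ‖ ^ 2) : ℂ) * U θ) →
      HasHs s (C * b ^ (2 * q + 3)) F := by
  obtain ⟨m, C₁, hC₁, hcomp⟩ := exists_hasHs_comp (d := d) hs hs0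
  have hE := embConst_ge_one (d := d)
  have hK := algConst_ge_one (d := d) hs0.le
  set Λ := embConst d * algConst d s with hΛ
  have hΛ1 : 1 ≤ Λ := one_le_mul_of_one_le_of_one_le hE hK
  have hψ := contDiff_taylorRem hf q
  have hex : ∀ j : ℕ, ∃ C, 0 ≤ C ∧ ∀ z, |z| ≤ Λ →
      |iteratedDeriv j (taylorRem f q) z| ≤ C * |z| ^ (q + 1 - j) := fun j => by
    refine exists_abs_le_pow (q + 1 - j) ?_ (fun i hi => ?_) Λ
    · rw [iteratedDeriv_eq_iterate]
      exact hψ.iterate_deriv j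
    · rw [iteratedDeriv_eq_iterate, iteratedDeriv_eq_iterate, ← Function.iterate_add_apply,
        ← iteratedDeriv_eq_iterate]
      exact iteratedDeriv_taylorRem hf (by omega)
  choose Cj hCj0 hCj using hex
  set B := ∑ j ∈ Finset.range (m + 1), Cj j with hB
  have hB0 : 0 ≤ B := Finset.sum_nonneg fun j _ => hCj0 j
  refine ⟨algConst d s * (C₁ * (B * Λ ^ m * Λ ^ (q + 1)) * 2), by positivity, ?_⟩
  intro b U F hb hb1 hU hF
  set R := Λ * b ^ 2 with hR
  have hR0 : 0 < R := by positivity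
  have hRΛ : R ≤ Λ := mul_le_of_le_one_right (by positivity) (pow_le_one₀ hb.le hb1)
  set V : C(UnitAddTorus (Fin d), ℂ) := ((R⁻¹ : ℝ) : ℂ) • (star U * U) with hV
  have hVval : ∀ θ, V θ = ((R⁻¹ * ‖U θ‖ ^ 2 : ℝ) : ℂ) := fun θ => by
    have : V θ = ((R⁻¹ : ℝ) : ℂ) * (starRingEnd ℂ (U θ) * U θ) := rfl
    rw [this, Complex.conj_mul']; push_cast; ring
  have hVs : HasHs s (embConst d)⁻¹ V := by
    refine ((hU.conj.mul hs hs0 hU).smul _).mono (le_of_eq ?_)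
    rw [Complex.norm_real, Real.norm_eq_abs, abs_of_pos (inv_pos.2 hR0), hR, hΛ]
    field_simp
  have hV1 : ∑' n, ‖fc n V‖ ≤ 1 := (hVs.tsum_le hs).trans (by
    rw [mul_inv_cancel₀ (by positivity)])
  let W : C(UnitAddTorus (Fin d), ℂ) := ⟨fun θ => (taylorRem f q (‖U θ‖ ^ 2) : ℂ),
    Complex.continuous_ofReal.comp (hψ.continuous.comp (by fun_prop))⟩
  have hW := hcomp (fun x => taylorRem f q (R * x)) (B * Λ ^ m * R ^ (q + 1)) _ V W
    (hψ.comp (by fun_prop)) (fun j hj x hx => by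
      rw [iteratedDeriv_comp_const_mul (hψ.of_le (by exact_mod_cast le_top))]
      simp only
      have hz : |R * x| ≤ R := by
        rw [abs_mul, abs_of_pos hR0]; exact mul_le_of_le_one_right hR0.le hx
      have h1 := hCj j _ (hz.trans hRΛ)
      have h2 : Cj j ≤ B := Finset.single_le_sum (fun j _ => hCj0 j) (by simp; omega)
      rw [abs_mul, abs_of_pos (pow_pos hR0 j)]
      have h3 : R ^ j * R ^ (q + 1 - j) ≤ Λ ^ m * R ^ (q + 1) := by
        rcases le_total j (q + 1) with h | h
        · rw [← pow_add, Nat.add_sub_cancel' h]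
          exact le_mul_of_one_le_left (by positivity) (one_le_pow₀ hΛ1)
        · rw [Nat.sub_eq_zero_of_le h, pow_zero, mul_one]
          calc R ^ j = R ^ (j - (q + 1)) * R ^ (q + 1) := by rw [← pow_add]; congr 1; omega
            _ ≤ Λ ^ (j - (q + 1)) * R ^ (q + 1) := by gcongr
            _ ≤ Λ ^ m * R ^ (q + 1) := by
                gcongr ?_ * _
                exact pow_le_pow_right₀ hΛ1 (by omega)
      calc _ ≤ R ^ j * (Cj j * |R * x| ^ (q + 1 - j)) := by gcongr
        _ ≤ R ^ j * (B * R ^ (q + 1 - j)) := by gcongr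
        _ = B * (R ^ j * R ^ (q + 1 - j)) := by ring
        _ ≤ B * (Λ ^ m * R ^ (q + 1)) := by gcongr
        _ = _ := by ring) hVs
    (fun θ => by rw [hVval, Complex.ofReal_re]) hV1
    (fun θ => by
      rw [hVval, Complex.ofReal_re, ← mul_assoc, mul_inv_cancel₀ hR0.ne', one_mul]; rfl)
  have hFW : F = W * U := by ext θ; exact hF θ
  rw [hFW]
  refine (hW.mul hs hs0 hU).mono ?_
  have h2 : 1 + (embConst d)⁻¹ ≤ 2 := by
    have := inv_le_one_of_one_le₀ hE
    linarith
  calc algConst d s * (C₁ * (B * Λ ^ m * R ^ (q + 1)) * (1 + (embConst d)⁻¹) * b)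
      ≤ algConst d s * (C₁ * (B * Λ ^ m * R ^ (q + 1)) * 2 * b) := by gcongr
    _ = _ := by rw [hR, mul_pow]; ring

end Remainder

/-! ### Frequency truncation and the monomials |U|^{2k} U -/

section Truncation

variable {d : ℕ}

lemma HasHs.of_le {s s' b : ℝ} {F : C(UnitAddTorus (Fin d), ℂ)} (h : HasHs s b F) (hs : s' ≤ s) :
    HasHs s' b F := ⟨h.1, fun S => (sobNorm_mono hs _).trans (h.2 S)⟩

lemma fc_trunc (N : ℝ) (F : C(UnitAddTorus (Fin d), ℂ)) (n : Fin d → ℤ) :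
    fc n (trunc N F) = if nrm n ≤ N then fc n F else 0 := by
  rw [trunc, fc_sum_mFourier]; simp

lemma HasHs.trunc {s b : ℝ} {F : C(UnitAddTorus (Fin d), ℂ)} (h : HasHs s b F) (L : ℝ) :
    HasHs s b (trunc L F) := by
  refine ⟨h.1, fun S => le_trans (sobNorm_le_of_le (fun n _ => norm_nonneg _) fun n _ => ?_) (h.2 S)⟩
  rw [fc_trunc]; split_ifs <;> simp

lemma HasHs.sub_trunc {s s' b L : ℝ} {F : C(UnitAddTorus (Fin d), ℂ)} (h : HasHs s b F) (hs : s' ≤ s)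
    (hL : 0 < L) : HasHs s' (L ^ (-(s - s')) * b) (F - NLSTorus.trunc L F) := by
  have hp : 0 ≤ L ^ (-(s - s')) := Real.rpow_nonneg hL.le _
  refine ⟨mul_nonneg hp h.1, fun S => ?_⟩
  refine le_trans ?_ (mul_le_mul_of_nonneg_left (h.2 S) hp)
  rw [← sobNorm_const_mul s S hp]
  refine Real.sqrt_le_sqrt (Finset.sum_le_sum fun n _ => ?_)
  beta_reduce
  rw [fc_sub_trunc, bracket_rpow_two_mul, bracket_rpow_two_mul, ← mul_pow, ← mul_pow]
  split_ifs with hn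
  · refine pow_le_pow_left₀ (mul_nonneg (bracket_rpow_pos n _).le (norm_nonneg _)) ?_ 2
    rw [← mul_assoc]
    refine mul_le_mul_of_nonneg_right ?_ (norm_nonneg _)
    have h1 : L ≤ bracket n := hn.le.trans (nrm_le_bracket n)
    rw [Real.rpow_neg hL.le, ← div_eq_mul_inv, le_div_iff₀ (Real.rpow_pos_of_pos hL _)]
    calc bracket n ^ s' * L ^ (s - s') ≤ bracket n ^ s' * bracket n ^ (s - s') :=
          mul_le_mul_of_nonneg_left (Real.rpow_le_rpow hL.le h1 (by linarith))
            (bracket_rpow_pos n _).le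
      _ = bracket n ^ s := by rw [← Real.rpow_add (bracket_pos n)]; congr 1; ring
  · rw [norm_zero, mul_zero, zero_pow two_ne_zero]; positivity

/-- The nonlinearity `|U|^(2 * k) U`. -/
def powNonlin (k : ℕ) (U : C(UnitAddTorus (Fin d), ℂ)) : C(UnitAddTorus (Fin d), ℂ) :=
  (star U * U) ^ k * U

lemma powNonlin_succ (k : ℕ) (U : C(UnitAddTorus (Fin d), ℂ)) :
    powNonlin (k + 1) U = star U * (U * powNonlin k U) := by
  unfold powNonlin; ring

/-- The factors of the product are replaced one at a time. The bound on the power itself is carried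
in the same induction, because the telescoping terms contain it. -/
lemma exists_hasHs_powNonlin_sub {s : ℝ} (hs : (d : ℝ) ≤ s) (hs0 : 0 < s) (k : ℕ) : ∃ C : ℝ, 0 ≤ C ∧
    ∀ (U W : C(UnitAddTorus (Fin d), ℂ)) (η : ℝ), HasHs s 1 U → HasHs s 1 W → HasHs s η (U - W) →
      HasHs s C (powNonlin k U) ∧ HasHs s (C * η) (powNonlin k U - powNonlin k W) := by
  induction k with
  | zero => exact ⟨1, zero_le_one, fun U W η hU hW h => by simpa [powNonlin] using ⟨hU, h⟩⟩
  | succ k ih =>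
    obtain ⟨C, hC, h⟩ := ih
    have hK : 0 ≤ algConst d s := zero_le_one.trans (algConst_ge_one hs0.le)
    refine ⟨3 * algConst d s ^ 2 * C, by positivity, fun U W η hU hW hη => ?_⟩
    obtain ⟨h1, h2⟩ := h U W η hU hW hη
    have hη0 := hη.1
    refine ⟨?_, ?_⟩
    · rw [powNonlin_succ]
      refine (hU.conj.mul hs hs0 (hU.mul hs hs0 h1)).mono ?_
      nlinarith [mul_nonneg (mul_nonneg hK hK) hC]
    · have e : powNonlin (k + 1) U - powNonlin (k + 1) W = star (U - W) * (U * powNonlin k U) +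
          (star W * ((U - W) * powNonlin k U) + star W * (W * (powNonlin k U - powNonlin k W))) := by
        rw [powNonlin_succ, powNonlin_succ, star_sub]; ring
      rw [e]
      refine ((hη.conj.mul hs hs0 (hU.mul hs hs0 h1)).add
        ((hW.conj.mul hs hs0 (hη.mul hs hs0 h1)).add
          (hW.conj.mul hs hs0 (hW.mul hs hs0 h2)))).mono (le_of_eq ?_)
      ring

end Truncation

/-! ### From sequences in h^s to continuous functions -/

section Lift

variable {d : ℕ}

lemma sobNorm_le_hsNorm {s : ℝ} {v : (Fin d → ℤ) → ℂ} (hv : MemHs s v) (S : Finset (Fin d → ℤ)) :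
    sobNorm s S (fun n => ‖v n‖) ≤ hsNorm s v :=
  Real.sqrt_le_sqrt (hv.sum_le_tsum S fun n _ => mul_nonneg (bracket_rpow_pos n _).le (sq_nonneg _))

lemma summable_of_memHs {s : ℝ} (hs : (d : ℝ) ≤ s) {v : (Fin d → ℤ) → ℂ} (hv : MemHs s v) :
    Summable fun n => ‖v n‖ :=
  summable_of_sum_le (fun _ => norm_nonneg _) fun S => sum_le_sobNorm_of_subset hs |>.trans
    (mul_le_mul_of_nonneg_left (sobNorm_le_hsNorm hv S) (zero_le_one.trans embConst_ge_one))

/-- A sequence in `h^s` is the sequence of Fourier coefficients of a continuous function. -/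
lemma exists_continuousMap {s : ℝ} (hs : (d : ℝ) ≤ s) {v : (Fin d → ℤ) → ℂ} (hv : MemHs s v) :
    ∃ U : C(UnitAddTorus (Fin d), ℂ), (∀ n, fc n U = v n) ∧ (∀ θ, toFun v θ = U θ) ∧
      HasHs s (hsNorm s v) U := by
  have h1 : Summable fun n => v n • (UnitAddTorus.mFourier n : C(UnitAddTorus (Fin d), ℂ)) := by
    refine Summable.of_norm ?_
    simpa [norm_smul, UnitAddTorus.mFourier_norm] using summable_of_memHs hs hv
  have hfc : ∀ n, fc n (∑' n, v n • (UnitAddTorus.mFourier n : C(UnitAddTorus (Fin d), ℂ))) = v n := by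
    intro n
    refine tendsto_nhds_unique (tendsto_fc h1.hasSum n) (tendsto_const_nhds.congr' ?_)
    filter_upwards [Filter.eventually_ge_atTop {n}] with S hS
    rw [fc_sum_mFourier, if_pos (hS (Finset.mem_singleton_self n))]
  refine ⟨_, hfc, fun θ => ?_, Real.sqrt_nonneg _, fun S => ?_⟩
  · exact ((ContinuousMap.evalCLM ℂ θ).hasSum h1.hasSum).tsum_eq
  · simp only [hfc]
    exact sobNorm_le_hsNorm hv S

end Lift
end

noncomputable section

open MvPolynomial

/-! ### Polynomial Hamiltonians of the monomials |u|^{2k} u -/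

section PatternHamiltonian

variable {d : ℕ} {S : Finset (Fin d → ℤ)}

/-- The sum of the monomials with conjugation pattern `σ` and momentum `z`. -/
def patternPoly (S : Finset (Fin d → ℤ)) {p : ℕ} (σ : Fin p → Bool) (z : Fin d → ℤ) :
    MvPolynomial (S × Bool) ℂ :=
  poly fun w => if (∀ i, (w i).2 = σ i) ∧ mom w = z then 1 else 0

/-- The trigonometric polynomial formed from the letters of a given sign. -/
def letterFun (x : S × Bool → ℂ) (b : Bool) : C(UnitAddTorus (Fin d), ℂ) :=
  ∑ n : S, x (n, b) • UnitAddTorus.mFourier (sgn b • (n : Fin d → ℤ))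

lemma prod_mFourier {p : ℕ} (k : Fin p → Fin d → ℤ) :
    ∏ i, (UnitAddTorus.mFourier (k i) : C(UnitAddTorus (Fin d), ℂ)) =
      UnitAddTorus.mFourier (∑ i, k i) := by
  induction p with
  | zero => simp [UnitAddTorus.mFourier_zero]
  | succ p ih =>
    rw [Fin.prod_univ_succ, Fin.sum_univ_succ, ih]
    ext θ
    exact UnitAddTorus.mFourier_add.symm

/-- When the product of the trigonometric polynomials is expanded, each word contributes its
monomial times the exponential of its momentum, and `fc z` selects the momentum `z`. -/
lemma eval_patternPoly {p : ℕ} (σ : Fin p → Bool) (z : Fin d → ℤ) (x : S × Bool → ℂ) :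
    eval x (patternPoly S σ z) = fc z (∏ i, letterFun x (σ i)) := by
  have h1 : ∀ b, letterFun x b = ∑ c : S × Bool, (if c.2 = b then x c else 0) •
      (UnitAddTorus.mFourier (sgn c.2 • (c.1 : Fin d → ℤ)) : C(UnitAddTorus (Fin d), ℂ)) := by
    intro b
    rw [Fintype.sum_prod_type]
    refine Finset.sum_congr rfl fun n _ => ?_
    rw [Fintype.sum_bool]
    cases b <;> (ext θ; simp)
  have h2 : ∏ i, letterFun x (σ i) = ∑ w : Fin p → S × Bool, (if ∀ i, (w i).2 = σ i then
      ∏ i, x (w i) else 0) • (UnitAddTorus.mFourier (mom w) : C(UnitAddTorus (Fin d), ℂ)) := by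
    simp only [h1]
    rw [Finset.prod_univ_sum, Fintype.piFinset_univ]
    refine Finset.sum_congr rfl fun w _ => ?_
    rw [mom, ← prod_mFourier, Finset.prod_smul]
    congr 1
    by_cases h : ∀ i, (w i).2 = σ i
    · rw [if_pos h]; exact Finset.prod_congr rfl fun i _ => if_pos (h i)
    · rw [if_neg h]
      obtain ⟨i, hi⟩ := not_forall.1 h
      exact Finset.prod_eq_zero (Finset.mem_univ i) (if_neg hi)
  rw [h2, patternPoly, eval_poly, map_sum]
  refine Finset.sum_congr rfl fun w _ => ?_
  rw [map_smul, fc_mFourier, smul_eq_mul]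
  by_cases h : ∀ i, (w i).2 = σ i <;> by_cases h' : mom w = z
  · simp [h, h']
  · simp [h, h', Ne.symm h']
  · simp [h]
  · simp [h]

lemma pderiv_patternPoly {p : ℕ} (σ : Fin (p + 1) → Bool) (z : Fin d → ℤ) (c : S × Bool) :
    pderiv c (patternPoly S σ z) = ∑ i, if σ i = c.2 then
      patternPoly S (fun j => σ (i.succAbove j)) (z - sgn c.2 • (c.1 : Fin d → ℤ)) else 0 := by
  rw [patternPoly, pderiv_poly]
  refine Finset.sum_congr rfl fun i _ => ?_
  have e : ∀ v : Fin p → S × Bool, ((∀ j, (ins i c v j).2 = σ j) ∧ mom (ins i c v) = z) ↔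
      σ i = c.2 ∧ (∀ j, (v j).2 = σ (i.succAbove j)) ∧ mom v = z - sgn c.2 • (c.1 : Fin d → ℤ) := by
    intro v
    rw [mom_ins, Fin.forall_iff_succAbove i, and_assoc, eq_sub_iff_add_eq']
    simp [eq_comm]
  simp only [e]
  split_ifs with h
  · simp [h, patternPoly]
  · simp [h, poly]

lemma prod_letterFun {p : ℕ} (σ : Fin p → Bool) (f : Bool → C(UnitAddTorus (Fin d), ℂ)) :
    ∏ i, f (σ i) = f true ^ (∑ i, if σ i = true then 1 else 0) *
      f false ^ (∑ i, if σ i = false then 1 else 0) := by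
  induction p with
  | zero => simp
  | succ p ih =>
    rw [Fin.prod_univ_succ, Fin.sum_univ_succ, Fin.sum_univ_succ, ih (fun i => σ i.succ), pow_add,
      pow_add]
    cases h : σ 0 <;> simp <;> ring

/-- The pattern of `|u|^(2 * k + 2)`. -/
def balancedPattern (k : ℕ) (i : Fin (2 * k + 1 + 1)) : Bool := decide ((i : ℕ) < k + 1)

lemma sum_balancedPattern (k : ℕ) (b : Bool) :
    ∑ i, (if balancedPattern k i = b then 1 else 0) = k + 1 := by
  have h : ∑ i, (if balancedPattern k i = true then 1 else 0) = k + 1 := by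
    simp only [balancedPattern, decide_eq_true_eq]
    rw [Fin.sum_univ_eq_sum_range (fun i => if i < k + 1 then 1 else 0), ← Finset.card_filter]
    have : Finset.filter (fun i => i < k + 1) (Finset.range (2 * k + 1 + 1)) = Finset.range (k + 1) := by
      ext i; simp; omega
    rw [this, Finset.card_range]
  cases b
  · have h2 : ∑ i, ((if balancedPattern k i = true then 1 else 0) +
        (if balancedPattern k i = false then 1 else 0)) = 2 * k + 1 + 1 := by
      rw [Finset.sum_congr rfl (g := fun _ => 1) fun i _ => by
        cases balancedPattern k i <;> simp]
      simp
    rw [Finset.sum_add_distrib, h] at h2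
    omega
  · exact h

/-- The Hamiltonian of the nonlinearity `a |u|^(2 * k) u`. -/
def powHam (S : Finset (Fin d → ℤ)) (a : ℝ) (k : ℕ) : MvPolynomial (S × Bool) ℂ :=
  ((a / (k + 1) : ℝ) : ℂ) • patternPoly S (balancedPattern k) 0

lemma isRep_powHam (a : ℝ) (k : ℕ) : IsRep S (2 * k + 2) |a| (powHam S a k) := by
  refine ⟨fun w => ((a / (k + 1) : ℝ) : ℂ) *
    if (∀ i, (w i).2 = balancedPattern k i) ∧ mom w = 0 then 1 else 0, fun w => ?_, fun w hw => ?_, ?_⟩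
  · have : |a / (k + 1)| ≤ |a| := by
      rw [abs_div]
      refine div_le_self (abs_nonneg _) ?_
      rw [abs_of_nonneg (by positivity)]
      linarith [(Nat.cast_nonneg k : (0 : ℝ) ≤ k)]
    rw [norm_mul, Complex.norm_real]
    split_ifs
    · rw [norm_one, mul_one]; exact this
    · simp
  · by_contra h
    exact hw (by simp [h])
  · rw [powHam, patternPoly, ← poly_smul]

/-- Differentiation removes one of the k + 1 slots of sign `b`. What is left depends only on the
number of letters of each sign, so these slots contribute equally and cancel the denominator in
`powHam`. -/
lemma eval_pderiv_powHam (a : ℝ) (k : ℕ) (x : S × Bool → ℂ) (n : S) (b : Bool) :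
    eval x (pderiv (n, b) (powHam S a k)) = a * fc (-(sgn b • (n : Fin d → ℤ)))
      ((letterFun x true * letterFun x false) ^ k * letterFun x (!b)) := by
  rw [powHam, Derivation.map_smul, smul_eval, pderiv_patternPoly, map_sum]
  have h1 : ∀ i, eval x (if balancedPattern k i = b then patternPoly S
      (fun j => balancedPattern k (i.succAbove j)) (0 - sgn b • (n : Fin d → ℤ)) else 0) =
      (if balancedPattern k i = b then 1 else 0 : ℕ) * fc (-(sgn b • (n : Fin d → ℤ)))
      ((letterFun x true * letterFun x false) ^ k * letterFun x (!b)) := by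
    intro i
    split_ifs with h
    · rw [eval_patternPoly, zero_sub, Nat.cast_one, one_mul]
      congr 1
      rw [prod_letterFun (fun j => balancedPattern k (i.succAbove j))]
      have ht := sum_balancedPattern k true
      have hf := sum_balancedPattern k false
      rw [Fin.sum_univ_succAbove _ i, h] at ht hf
      cases b
      · have e1 : ∑ j, (if balancedPattern k (i.succAbove j) = true then 1 else 0) = k + 1 := by
          simpa using ht
        have e2 : ∑ j, (if balancedPattern k (i.succAbove j) = false then 1 else 0) = k := by
          simp only [if_true] at hf; omega
        rw [e1, e2, mul_pow, pow_succ]; simp only [Bool.not_false]; ring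
      · have e1 : ∑ j, (if balancedPattern k (i.succAbove j) = true then 1 else 0) = k := by
          simp only [if_true] at ht; omega
        have e2 : ∑ j, (if balancedPattern k (i.succAbove j) = false then 1 else 0) = k + 1 := by
          simpa using hf
        rw [e1, e2, mul_pow, pow_succ]; simp only [Bool.not_true]; ring
    · simp
  rw [Finset.sum_congr rfl fun i _ => h1 i, ← Finset.sum_mul, ← Nat.cast_sum, sum_balancedPattern]
  have hk : (k + 1 : ℂ) ≠ 0 := by exact_mod_cast Nat.succ_ne_zero k
  push_cast
  field_simp

/-- The letters of the sequence `v`. -/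
def letters (S : Finset (Fin d → ℤ)) (v : (Fin d → ℤ) → ℂ) (c : S × Bool) : ℂ :=
  if c.2 then v c.1 else starRingEnd ℂ (v c.1)

lemma norm_letters (v : (Fin d → ℤ) → ℂ) (c : S × Bool) : ‖letters S v c‖ = ‖v c.1‖ := by
  unfold letters; split_ifs <;> simp

lemma letterFun_letters_true (v : (Fin d → ℤ) → ℂ) :
    letterFun (letters S v) true = ∑ n ∈ S, v n • UnitAddTorus.mFourier n := by
  rw [letterFun, ← Finset.sum_coe_sort S]
  simp [letters]

lemma letterFun_letters_false (v : (Fin d → ℤ) → ℂ) :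
    letterFun (letters S v) false = star (letterFun (letters S v) true) := by
  rw [letterFun, letterFun, star_sum]
  refine Finset.sum_congr rfl fun n _ => ?_
  ext θ
  simp [letters, UnitAddTorus.mFourier_neg]

lemma eval_pderiv_powHam_letters (a : ℝ) (k : ℕ) (v : (Fin d → ℤ) → ℂ) (n : S) (b : Bool) :
    eval (letters S v) (pderiv (n, b) (powHam S a k)) =
      letters S (fun n => a * fc n (powNonlin k (letterFun (letters S v) true))) (n, !b) := by
  rw [eval_pderiv_powHam, letterFun_letters_false]
  set U := letterFun (letters S v) true
  cases b
  · simp only [letters, Bool.not_false, if_true, sgn_false, neg_smul, one_smul, neg_neg, powNonlin]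
    rw [mul_comm U]
  · simp only [letters, Bool.not_true, sgn_true, one_smul, Bool.false_eq_true, if_false, map_mul,
      Complex.conj_ofReal]
    rw [letterFun_letters_false, ← neg_neg (n : Fin d → ℤ), ← fc_conj, neg_neg, powNonlin]
    congr 2
    simp only [star_mul', star_pow, star_star]
    rfl

end PatternHamiltonian

/-! ### Time derivative of a polynomial along a curve -/

section ChainRule

lemma hasDerivWithinAt_eval {ι : Type*} [Fintype ι] {x : ℝ → ι → ℂ} {x' : ι → ℂ} {A : Set ℝ} {t : ℝ}
    (hx : ∀ c, HasDerivWithinAt (fun τ => x τ c) (x' c) A t) (E : MvPolynomial ι ℂ) :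
    HasDerivWithinAt (fun τ => eval (x τ) E) (∑ c, eval (x t) (pderiv c E) * x' c) A t := by
  classical
  induction E using MvPolynomial.induction_on with
  | C a => simpa using hasDerivWithinAt_const t A a
  | add p q hp hq =>
    simp only [map_add, add_mul, Finset.sum_add_distrib]
    exact hp.add hq
  | mul_X p i hp =>
    have h := hp.mul (hx i)
    simp only [map_mul, eval_X]
    refine h.congr_deriv ?_
    simp only [Derivation.leibniz, pderiv_X, smul_eq_mul, map_add, map_mul, eval_X, add_mul,
      Finset.sum_add_distrib, Pi.single_apply]
    rw [add_comm]
    congr 1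
    · rw [Finset.sum_eq_single i]
      · simp
      · intro c _ hc; simp [hc.symm]
      · simp
    · rw [Finset.sum_mul]
      exact Finset.sum_congr rfl fun c _ => by ring

end ChainRule
end

noncomputable section

open MvPolynomial

/-! ### Splitting of the nonlinearity -/

section VectorField

variable {d : ℕ}

lemma powNonlin_apply (k : ℕ) (U : C(UnitAddTorus (Fin d), ℂ)) (θ : UnitAddTorus (Fin d)) :
    powNonlin k U θ = (((‖U θ‖ ^ 2) ^ k : ℝ) : ℂ) * U θ := by
  have : powNonlin k U θ = (starRingEnd ℂ (U θ) * U θ) ^ k * U θ := rfl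
  rw [this, Complex.conj_mul']; push_cast; ring

lemma trunc_eq_of_fc {U : C(UnitAddTorus (Fin d), ℂ)} {v : (Fin d → ℤ) → ℂ} (h : ∀ n, fc n U = v n)
    (L : ℝ) : trunc L U = ∑ n ∈ modeBall d L, v n • UnitAddTorus.mFourier n := by
  simp only [trunc, h]

/-- Splitting of the nonlinearity into the truncated Taylor polynomial, a Taylor remainder that is
small in `h^s` and a truncation error that is small in `h^d`. -/
lemma exists_nonlin_splitting (hd : 1 ≤ d) {f : ℝ → ℝ} (hf : ContDiff ℝ ∞ f) (hf0 : f 0 = 0) (D : ℕ)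
    {s : ℝ} (hs : (d : ℝ) ≤ s) : ∃ C : ℝ, 0 ≤ C ∧ ∀ (b L : ℝ) (v : (Fin d → ℤ) → ℂ), 0 < b → b ≤ 1 →
      0 < L → MemHs s v → hsNorm s v ≤ b → ∃ y₁ y₂ : (Fin d → ℤ) → ℂ,
        (∀ n, nonlin f v n = ∑ j ∈ Finset.range D, (taylorCoeff f (j + 1) : ℂ) *
          fc n (powNonlin (j + 1) (∑ n ∈ modeBall d L, v n • UnitAddTorus.mFourier n)) +
            (y₁ n + y₂ n)) ∧
        (∀ S, sobNorm s S (fun n => ‖y₁ n‖) ≤ C * b ^ (2 * D + 3)) ∧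
        ∀ S, sobNorm d S (fun n => ‖y₂ n‖) ≤ C * L ^ (-(s - d)) := by
  have hd0 : (0 : ℝ) < d := by exact_mod_cast hd
  obtain ⟨C₁, hC₁, h1⟩ := exists_hasHs_taylorRem (d := d) hf D hs (hd0.trans_le hs)
  -- The exponent here is d and not s: discarding the modes |n| > L is a small perturbation only in
  -- a weaker norm, by `HasHs.sub_trunc`.
  choose Ck hCk hk using exists_hasHs_powNonlin_sub (d := d) le_rfl hd0
  set B := ∑ j ∈ Finset.range D, |taylorCoeff f (j + 1)| * Ck (j + 1) with hB
  have hB0 : 0 ≤ B := Finset.sum_nonneg fun j _ => mul_nonneg (abs_nonneg _) (hCk _)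
  refine ⟨C₁ + B, by positivity, fun b L v hb hb1 hL hv hvb => ?_⟩
  obtain ⟨U, hU1, hU2, hU3⟩ := exists_continuousMap hs hv
  have hUb : HasHs s b U := hU3.mono hvb
  let F : C(UnitAddTorus (Fin d), ℂ) := ⟨fun θ => (taylorRem f D (‖U θ‖ ^ 2) : ℂ) * U θ,
    (Complex.continuous_ofReal.comp ((contDiff_taylorRem hf D).continuous.comp
      (by fun_prop))).mul U.continuous⟩
  let N : C(UnitAddTorus (Fin d), ℂ) := ⟨fun θ => (f (‖U θ‖ ^ 2) : ℂ) * U θ,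
    (Complex.continuous_ofReal.comp (hf.continuous.comp (by fun_prop))).mul U.continuous⟩
  have hN : N = (∑ j ∈ Finset.range D, (taylorCoeff f (j + 1) : ℂ) • powNonlin (j + 1) U) + F := by
    ext θ
    have e1 : N θ = (f (‖U θ‖ ^ 2) : ℂ) * U θ := rfl
    have e2 : F θ = (taylorRem f D (‖U θ‖ ^ 2) : ℂ) * U θ := rfl
    rw [ContinuousMap.add_apply, e1, e2, ContinuousMap.sum_apply]
    simp only [ContinuousMap.smul_apply, powNonlin_apply, smul_eq_mul]
    rw [taylorRem, Finset.sum_range_succ']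
    simp only [taylorCoeff, iteratedDeriv_zero, hf0]
    push_cast
    simp only [← mul_assoc]
    rw [← Finset.sum_mul]
    ring
  have hnl : ∀ n, nonlin f v n = fc n N := fun n => by
    rw [nonlin, fc_apply]
    congr 1
    ext θ
    rw [hU2]; rfl
  rw [← trunc_eq_of_fc hU1]
  have hUS := (hUb.of_le hs).mono hb1
  have hη := hUb.sub_trunc hs hL
  set η := L ^ (-(s - d)) * b with hηdef
  have hLp : 0 ≤ L ^ (-(s - d)) := Real.rpow_nonneg hL.le _
  refine ⟨fun n => fc n F, fun n => fc n (∑ j ∈ Finset.range D, (taylorCoeff f (j + 1) : ℂ) •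
    (powNonlin (j + 1) U - powNonlin (j + 1) (trunc L U))), fun n => ?_, fun S => ?_, fun S => ?_⟩
  · rw [hnl, hN]
    simp only [map_add, map_sum, map_smul, map_sub, smul_eq_mul, mul_sub, Finset.sum_sub_distrib]
    ring
  · refine ((h1 b U F hb hb1 hUb fun θ => rfl).2 S).trans ?_
    gcongr
    linarith
  · have h2 := HasHs.sum (Finset.range D) fun j _ =>
      ((hk (j + 1) U (trunc L U) η hUS (hUS.trunc L) hη).2).smul (taylorCoeff f (j + 1) : ℂ)
    refine (h2.2 S).trans ?_
    simp only [Complex.norm_real, Real.norm_eq_abs]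
    calc ∑ j ∈ Finset.range D, |taylorCoeff f (j + 1)| * (Ck (j + 1) * η) = B * η := by
          rw [hB, Finset.sum_mul]; exact Finset.sum_congr rfl fun j _ => by ring
      _ ≤ B * L ^ (-(s - d)) := by
          gcongr; exact mul_le_of_le_one_right hLp hb1
      _ ≤ _ := by gcongr; linarith

end VectorField

/-! ### Evolution of the modified energy along a solution -/

section Dynamics

variable {d : ℕ}

/-- The Hamiltonian of the truncated equation, split by degree. -/
def nlsHam (G : Matrix (Fin d) (Fin d) ℝ) (f : ℝ → ℝ) (S : Finset (Fin d → ℤ)) (k : ℕ) :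
    MvPolynomial (S × Bool) ℂ :=
  if k = 0 then linHam G S else powHam S (taylorCoeff f k) k

lemma eval_pderiv_nlsHam (G : Matrix (Fin d) (Fin d) ℝ) (f : ℝ → ℝ) (S : Finset (Fin d → ℤ)) (D : ℕ)
    (v : (Fin d → ℤ) → ℂ) (n : S) (b : Bool) :
    eval (letters S v) (pderiv (n, !b) (∑ l ∈ Finset.range (D + 1), nlsHam G f S l)) =
      letters S (fun n => freq G n * v n + ∑ j ∈ Finset.range D, (taylorCoeff f (j + 1) : ℂ) *
        fc n (powNonlin (j + 1) (∑ n ∈ S, v n • UnitAddTorus.mFourier n))) (n, b) := by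
  rw [Finset.sum_range_succ', map_add, map_add, map_sum, map_sum]
  simp only [nlsHam, Nat.add_eq_zero_iff, one_ne_zero, and_false, if_false, if_true,
    eval_pderiv_powHam_letters, letterFun_letters_true, linHam, pderiv_diagHam, map_mul, eval_C, eval_X,
    Bool.not_not]
  rw [add_comm]
  cases b <;> simp [letters]

/-- The sign in the Hamiltonian equations of motion. -/
def motionSign (b : Bool) : ℂ := if b then -Complex.I else Complex.I

lemma norm_motionSign (b : Bool) : ‖motionSign b‖ = 1 := by
  cases b <;> simp [motionSign]

lemma letters_add (S : Finset (Fin d → ℤ)) (v w : (Fin d → ℤ) → ℂ) (c : S × Bool) :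
    letters S (fun n => v n + w n) c = letters S v c + letters S w c := by
  unfold letters; split_ifs <;> simp

/-- Hamilton's equations are i ∂_t u_n = ∂H/∂ū_n and their conjugates, so the time derivative of E
is -i {E, H}. -/
lemma sum_mul_motionSign {S : Finset (Fin d → ℤ)} (x : S × Bool → ℂ)
    (E H : MvPolynomial (S × Bool) ℂ) :
    ∑ c : S × Bool, eval x (pderiv c E) * (motionSign c.2 * eval x (pderiv (c.1, !c.2) H)) =
      -Complex.I * eval x (poisson E H) := by
  rw [poisson, map_sum, Finset.mul_sum, Fintype.sum_prod_type]
  refine Finset.sum_congr rfl fun n _ => ?_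
  rw [Fintype.sum_bool]
  simp [motionSign]
  ring

lemma hasDerivWithinAt_letters {G : Matrix (Fin d) (Fin d) ℝ} {f : ℝ → ℝ} {s T : ℝ}
    {u : ℝ → (Fin d → ℤ) → ℂ} (hu : IsNLSSolution G f s T u) (S : Finset (Fin d → ℤ)) {t : ℝ}
    (ht : t ∈ Set.Icc 0 T) (c : S × Bool) :
    HasDerivWithinAt (fun τ => letters S (u τ) c)
      (motionSign c.2 * letters S (fun n => freq G n * u t n + nonlin f (u t) n) c)
      (Set.Icc 0 T) t := by
  obtain ⟨n, b⟩ := c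
  have h := hu.eqn n t ht
  cases b
  · refine h.star.congr_deriv ?_
    simp [letters, motionSign]
  · simpa [letters, motionSign] using h

lemma eval_diagHam_letters (S : Finset (Fin d → ℤ)) (ϖ : (Fin d → ℤ) → ℝ)
    (v : (Fin d → ℤ) → ℂ) : eval (letters S v) (diagHam fun n : S => ϖ (n : Fin d → ℤ)) =
      ((∑ n ∈ S, ϖ n * ‖v n‖ ^ 2 : ℝ) : ℂ) := by
  rw [diagHam, map_sum, ← Finset.sum_coe_sort S]
  push_cast
  refine Finset.sum_congr rfl fun n _ => ?_
  simp [letters, Complex.mul_conj']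

/-- Almost conservation of weighted sums of actions, for weights adapted to a cluster
decomposition. -/
lemma exists_weighted_action_bound (hd : 1 ≤ d) {G : Matrix (Fin d) (Fin d) ℝ} (hG : G.PosDef)
    {δ : ℝ} (hδ0 : 0 < δ) (hδ1 : δ < 1) {s : ℝ} (hs : (d : ℝ) < s) {f : ℝ → ℝ} (hf : ContDiff ℝ ∞ f)
    (hf0 : f 0 = 0) (D : ℕ) : ∃ K : ℝ, 0 ≤ K ∧ ∀ (P : Setoid (Fin d → ℤ)) (M : ℝ)
      (ϖ : (Fin d → ℤ) → ℝ) (A : Finset (Fin d → ℤ)) (T b : ℝ) (u : ℝ → (Fin d → ℤ) → ℂ),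
      (∀ n₁ n₂, Quotient.mk P n₁ ≠ Quotient.mk P n₂ →
        (nrm n₁ + nrm n₂) ^ δ < nrm (n₁ - n₂) + |freq G n₁ - freq G n₂|) →
      1 ≤ M → IsClusterWeight P M s ϖ → (∀ n, n ∉ A → ϖ n = 0) → 0 < b → b ≤ 1 →
      IsNLSSolution G f s T u → (∀ t ∈ Set.Icc 0 T, hsNorm s (u t) ≤ b) → ∀ t ∈ Set.Icc 0 T,
      |∑ n ∈ A, ϖ n * (‖u t n‖ ^ 2 - ‖u 0 n‖ ^ 2)| ≤
        K * (b ^ 4 + T * (M ^ (-(δ / 2) * (s - d)) * b ^ 4 + b ^ (2 * D + 4))) := by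
  obtain ⟨C, hC, hE⟩ := exists_modifiedEnergy hG hδ0 hδ1 hs.le (fun k => |taylorCoeff f k|)
    (fun k => abs_nonneg _) D
  obtain ⟨C', hC', hsplit⟩ := exists_nonlin_splitting hd hf hf0 D hs.le
  refine ⟨2 * C + C * (1 + C'), by positivity, ?_⟩
  intro P M ϖ A T b u hP hM hϖ hA hb hb1 hu hub t ht
  have hT : 0 ≤ T := ht.1.trans ht.2
  have hMp : 0 ≤ M ^ (-(δ / 2) * (s - d)) := Real.rpow_nonneg (by linarith) _
  -- Finite support makes the weight bounded. `W` may be enormous, but it only multiplies a term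
  -- that tends to zero with L.
  obtain ⟨W, hW0, hW⟩ : ∃ W : ℝ, 0 ≤ W ∧ ∀ n, |ϖ n| ≤ W := by
    refine ⟨∑ n ∈ A, |ϖ n|, Finset.sum_nonneg fun _ _ => abs_nonneg _, fun n => ?_⟩
    by_cases hn : n ∈ A
    · exact Finset.single_le_sum (f := fun n => |ϖ n|) (fun _ _ => abs_nonneg _) hn
    · rw [hA n hn, abs_zero]; exact Finset.sum_nonneg fun _ _ => abs_nonneg _
  have key : ∀ L : ℝ, 0 < L → A ⊆ modeBall d L →
      |∑ n ∈ A, ϖ n * (‖u t n‖ ^ 2 - ‖u 0 n‖ ^ 2)| ≤ 2 * C * b ^ 4 +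
        T * (C * (M ^ (-(δ / 2) * (s - d)) * b ^ 4 + b ^ (2 * D + 4)) +
          C * (b * (C' * b ^ (2 * D + 3))) + C * (W * (C' * L ^ (-(s - d))))) := by
    intro L hL hAL
    set S := modeBall d L with hS
    obtain ⟨E, hE⟩ := hE S P M ϖ (nlsHam G f S) hP hM hϖ rfl fun k hk => by
      have : nlsHam G f S k = powHam S (taylorCoeff f k) k := if_neg (by omega)
      rw [this]; exact isRep_powHam _ k
    have hEt : ∀ τ ∈ Set.Icc 0 T, _ := fun τ hτ => hE (letters S (u τ)) (fun n => ‖u τ n‖) b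
      (fun n => norm_nonneg _) (fun c => (norm_letters _ c).le)
      ((sobNorm_le_hsNorm (hu.mem τ hτ) S).trans (hub τ hτ)) hb1
    set Ht := ∑ l ∈ Finset.range (D + 1), nlsHam G f S l with hHt
    have hder : ∀ τ ∈ Set.Icc 0 T, ∃ E' : ℂ, HasDerivWithinAt (fun τ => eval (letters S (u τ)) E) E'
        (Set.Icc 0 T) τ ∧ ‖E'‖ ≤ C * (M ^ (-(δ / 2) * (s - d)) * b ^ 4 + b ^ (2 * D + 4)) +
          C * (b * (C' * b ^ (2 * D + 3))) + C * (W * (C' * L ^ (-(s - d)))) := by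
      intro τ hτ
      obtain ⟨y₁, y₂, hy, hy₁, hy₂⟩ := hsplit b L (u τ) hb hb1 hL (hu.mem τ hτ) (hub τ hτ)
      obtain ⟨-, h2, h3, h4⟩ := hEt τ hτ
      refine ⟨_, hasDerivWithinAt_eval (fun c => hasDerivWithinAt_letters hu S hτ c) E, ?_⟩
      -- On the retained modes the motion is Hamiltonian up to `y₁`, measured in h^s, and `y₂`,
      -- measured in h^d; the two derivative bounds of `exists_modifiedEnergy` treat them
      -- separately.
      have e : ∑ c, eval (letters S (u τ)) (pderiv c E) * (motionSign c.2 *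
          letters S (fun n => freq G n * u τ n + nonlin f (u τ) n) c) =
          -Complex.I * eval (letters S (u τ)) (poisson E Ht) +
          ∑ c, eval (letters S (u τ)) (pderiv c E) * (motionSign c.2 * letters S y₁ c) +
          ∑ c, eval (letters S (u τ)) (pderiv c E) * (motionSign c.2 * letters S y₂ c) := by
        rw [← sum_mul_motionSign, ← Finset.sum_add_distrib, ← Finset.sum_add_distrib]
        refine Finset.sum_congr rfl fun c _ => ?_
        rw [hHt, eval_pderiv_nlsHam, ← mul_add, ← mul_add, ← mul_add, ← mul_add, ← letters_add,
          ← letters_add]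
        congr 3
        ext n
        rw [hy]; ring
      rw [e]
      refine (norm_add_le _ _).trans (add_le_add ((norm_add_le _ _).trans (add_le_add ?_ ?_)) ?_)
      · rw [norm_mul, norm_neg, Complex.norm_I, one_mul]; exact h2
      · refine (h3 _ (fun n => ‖y₁ n‖) (fun n => norm_nonneg _) fun c => ?_).trans ?_
        · rw [norm_mul, norm_motionSign, one_mul, norm_letters]
        · gcongr; exact hy₁ S
      · refine (h4 W hW0 hW _ (fun n => ‖y₂ n‖) (fun n => norm_nonneg _) fun c => ?_).trans ?_
        · rw [norm_mul, norm_motionSign, one_mul, norm_letters]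
        · gcongr; exact hy₂ S
    choose! E' hE'1 hE'2 using hder
    have h0T : (0 : ℝ) ∈ Set.Icc 0 T := ⟨le_rfl, hT⟩
    have hmv := (convex_Icc (0 : ℝ) T).norm_image_sub_le_of_norm_hasDerivWithin_le hE'1 hE'2 h0T ht
    have ha := (hEt t ht).1
    have hb' := (hEt 0 h0T).1
    rw [eval_diagHam_letters] at ha hb'
    set J : ℝ → ℝ := fun τ => ∑ n ∈ S, ϖ n * ‖u τ n‖ ^ 2 with hJ
    have hJd : ∑ n ∈ A, ϖ n * (‖u t n‖ ^ 2 - ‖u 0 n‖ ^ 2) = J t - J 0 := by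
      rw [hJ, ← Finset.sum_sub_distrib]
      simp only [← mul_sub]
      exact Finset.sum_subset hAL fun n _ hn => by rw [hA n hn, zero_mul]
    rw [hJd, ← Real.norm_eq_abs, ← Complex.norm_real, Complex.ofReal_sub]
    have e : (J t : ℂ) - (J 0 : ℂ) = -(eval (letters S (u t)) E - J t) +
        (eval (letters S (u 0)) E - J 0) + (eval (letters S (u t)) E - eval (letters S (u 0)) E) := by
      ring
    rw [e]
    refine (norm_add_le _ _).trans (add_le_add ((norm_add_le _ _).trans ?_) (hmv.trans ?_))
    · rw [norm_neg]; linarith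
    · rw [mul_comm, sub_zero, Real.norm_eq_abs, abs_of_nonneg ht.1]
      have hLp : 0 ≤ L ^ (-(s - d)) := Real.rpow_nonneg hL.le _
      exact mul_le_mul_of_nonneg_right ht.2 (by positivity)
  -- `C` and `C'` do not depend on L, so the truncation error disappears in the limit.
  have hlim : Filter.Tendsto (fun L : ℝ => 2 * C * b ^ 4 +
      T * (C * (M ^ (-(δ / 2) * (s - d)) * b ^ 4 + b ^ (2 * D + 4)) +
        C * (b * (C' * b ^ (2 * D + 3))) + C * (W * (C' * L ^ (-(s - d)))))) Filter.atTop
      (𝓝 (2 * C * b ^ 4 + T * (C * (M ^ (-(δ / 2) * (s - d)) * b ^ 4 + b ^ (2 * D + 4)) +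
        C * (b * (C' * b ^ (2 * D + 3))) + C * (W * (C' * 0))))) := by
    have := tendsto_rpow_neg_atTop (sub_pos.2 hs)
    exact (((((this.const_mul C').const_mul W).const_mul C).const_add _).const_mul T).const_add _
  refine (ge_of_tendsto hlim (b := |∑ n ∈ A, ϖ n * (‖u t n‖ ^ 2 - ‖u 0 n‖ ^ 2)|) ?_).trans ?_
  · filter_upwards [Filter.eventually_gt_atTop 0, Filter.eventually_ge_atTop (∑ n ∈ A, nrm n)]
      with L hL hL2
    refine key L hL fun n hn => ?_
    rw [mem_modeBall]
    exact (Finset.single_le_sum (f := nrm) (fun n _ => nrm_nonneg n) hn).trans hL2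
  have e2 : b * (C' * b ^ (2 * D + 3)) = C' * b ^ (2 * D + 4) := by ring
  rw [e2]
  have hb4 : 0 ≤ b ^ 4 := by positivity
  have hb5 : 0 ≤ b ^ (2 * D + 4) := by positivity
  generalize b ^ (2 * D + 4) = β at *
  generalize b ^ 4 = α at *
  generalize M ^ (-(δ / 2) * (s - d)) = μ at *
  have h1 : 0 ≤ C * (1 + C') * α := by positivity
  have h2 : 0 ≤ T * ((2 * C + C * C') * (μ * α) + 2 * C * β) := by positivity
  nlinarith

end Dynamics
end

noncomputable section

/-! ### Length of chains of close lattice points -/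

section Chains

variable {d : ℕ}

/-- Coordinates in a basis of integer vectors are controlled by Cramer's rule. -/
lemma abs_coord_le {q : ℕ} {b : Fin q → Fin d → ℤ} (hb : LinearIndependent ℝ fun i => vec (b i))
    {B : ℝ} (hB : 1 ≤ B) (hbB : ∀ i, nrm (b i) ≤ B) (c : Fin q → ℝ) (i : Fin q) :
    |c i| ≤ q * (q.factorial * (B ^ 2) ^ q * B) * ‖∑ j, c j • vec (b j)‖ := by
  set v := ∑ j, c j • vec (b j) with hv
  let N : Matrix (Fin q) (Fin q) ℤ := Matrix.of fun i j => ∑ l, b i l * b j l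
  let M := Matrix.gram ℝ fun i => vec (b i)
  have hMN : (Int.castRingHom ℝ).mapMatrix N = M := by
    ext i j
    simp [N, M, Matrix.gram_apply, PiLp.inner_apply, mul_comm]
  have hdet : (N.det : ℝ) = M.det := by
    rw [← hMN, ← RingHom.map_det]; rfl
  have hpos : 0 < M.det := (Matrix.posDef_gram_of_linearIndependent hb).det_pos
  -- The Gram determinant of independent integer vectors is a positive integer, so dividing by it in
  -- Cramer's rule costs nothing.
  have hdet1 : 1 ≤ M.det := by
    rw [← hdet] at hpos ⊢
    exact_mod_cast Int.add_one_le_iff.2 (by exact_mod_cast hpos : (0 : ℤ) < N.det)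
  have hMc : M.mulVec c = fun i => inner ℝ (vec (b i)) v := by
    ext i
    simp [M, Matrix.mulVec, dotProduct, Matrix.gram_apply, hv, inner_sum, inner_smul_right, mul_comm]
  have hadj : M.det * c i = ∑ j, M.adjugate i j * inner ℝ (vec (b j)) v := by
    have : (M.adjugate * M).mulVec c = M.adjugate.mulVec (M.mulVec c) :=
      (Matrix.mulVec_mulVec c _ _).symm
    rw [Matrix.adjugate_mul, hMc, Matrix.smul_mulVec, Matrix.one_mulVec] at this
    simpa [Matrix.mulVec, dotProduct] using congrFun this i
  have hB2 : 1 ≤ B ^ 2 := one_le_pow₀ hB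
  have hMent : ∀ i j, |M i j| ≤ B ^ 2 := fun i j => by
    refine (abs_real_inner_le_norm (vec (b i)) (vec (b j))).trans ?_
    rw [← nrm_eq_norm, ← nrm_eq_norm, sq]
    exact mul_le_mul (hbB i) (hbB j) (nrm_nonneg _) (by linarith)
  have hAent : ∀ i j, |M.adjugate i j| ≤ q.factorial * (B ^ 2) ^ q := fun i j => by
    rw [Matrix.adjugate_apply]
    have := Matrix.det_le (A := M.updateRow j (Pi.single i 1)) (abv := AbsoluteValue.abs)
      (x := B ^ 2) fun k l => by
        rw [AbsoluteValue.abs_apply, Matrix.updateRow_apply]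
        split_ifs
        · rw [Pi.single_apply]; split_ifs
          · simpa using hB2
          · simpa using sq_nonneg B
        · exact hMent k l
    simpa using this
  calc |c i| ≤ M.det * |c i| := le_mul_of_one_le_left (abs_nonneg _) hdet1
    _ = |∑ j, M.adjugate i j * inner ℝ (vec (b j)) v| := by
        rw [← hadj, abs_mul, abs_of_pos hpos]
    _ ≤ ∑ j : Fin q, (q.factorial * (B ^ 2) ^ q) * (B * ‖v‖) := by
        refine (Finset.abs_sum_le_sum_abs _ _).trans (Finset.sum_le_sum fun j _ => ?_)
        rw [abs_mul]
        refine mul_le_mul (hAent i j) ((abs_real_inner_le_norm _ _).trans ?_) (abs_nonneg _)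
          (by positivity)
        rw [← nrm_eq_norm]
        gcongr
        exact hbB j
    _ = _ := by simp; ring

lemma abs_metric_le_of_mem_span (G : Matrix (Fin d) (Fin d) ℝ) {q : ℕ} {b : Fin q → Fin d → ℤ}
    (hb : LinearIndependent ℝ fun i => vec (b i)) {B Y : ℝ} (hB : 1 ≤ B) (hbB : ∀ i, nrm (b i) ≤ B)
    {p v : EuclideanSpace ℝ (Fin d)} (hp : ∀ i, |metric G p (vec (b i))| ≤ Y)
    (hv : v ∈ Submodule.span ℝ (Set.range fun i => vec (b i))) :
    |metric G p v| ≤ q ^ 2 * q.factorial * (B ^ (2 * q + 1) * Y) * ‖v‖ := by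
  obtain ⟨c, rfl⟩ := (Submodule.mem_span_range_iff_exists_fun ℝ).1 hv
  have hsum : metric G p (∑ j, c j • vec (b j)) = ∑ j, c j * metric G p (vec (b j)) := by
    have : ∀ t : Finset (Fin q), metric G p (∑ j ∈ t, c j • vec (b j)) =
        ∑ j ∈ t, c j * metric G p (vec (b j)) := fun t => by
      induction t using Finset.induction_on with
      | empty => simp [metric]
      | insert i t hi ih =>
        rw [Finset.sum_insert hi, Finset.sum_insert hi, metric_add_right, metric_smul_right, ih]
    exact this _
  rw [hsum]
  refine (Finset.abs_sum_le_sum_abs _ _).trans ((Finset.sum_le_sum fun j _ => ?_).trans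
    (b := ∑ j : Fin q, q * (q.factorial * (B ^ 2) ^ q * B) * ‖∑ j, c j • vec (b j)‖ * Y) ?_)
  · rw [abs_mul]
    exact mul_le_mul (abs_coord_le hb hB hbB c j) (hp j) (abs_nonneg _) (by positivity)
  · refine le_of_eq ?_
    simp only [Finset.sum_const, Finset.card_univ, Fintype.card_fin, nsmul_eq_mul]
    rw [← pow_mul]; ring

/-- Injective sequences of lattice points with bounded increments in position and frequency. -/
def IsLatticeChain (G : Matrix (Fin d) (Fin d) ℝ) (Γ : ℝ) (L : ℕ) (n : ℕ → Fin d → ℤ) : Prop :=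
  Set.InjOn n {i | i ≤ L} ∧
    ∀ i < L, nrm (n (i + 1) - n i) ≤ Γ ∧ |freq G (n (i + 1)) - freq G (n i)| ≤ Γ

lemma IsLatticeChain.shift {G : Matrix (Fin d) (Fin d) ℝ} {Γ : ℝ} {L ℓ j : ℕ} {n : ℕ → Fin d → ℤ}
    (h : IsLatticeChain G Γ L n) (hj : j + ℓ ≤ L) : IsLatticeChain G Γ ℓ fun i => n (j + i) := by
  refine ⟨fun a ha b hb hab => ?_, fun i hi => h.2 (j + i) (by omega)⟩
  have := h.1 (show j + a ≤ L by simp at ha; omega) (show j + b ≤ L by simp at hb; omega) hab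
  omega

lemma IsLatticeChain.dist_le {G : Matrix (Fin d) (Fin d) ℝ} {Γ : ℝ} {L : ℕ} {n : ℕ → Fin d → ℤ}
    (h : IsLatticeChain G Γ L n) (i k : ℕ) (hk : i + k ≤ L) :
    nrm (n (i + k) - n i) ≤ k * Γ ∧ |freq G (n (i + k)) - freq G (n i)| ≤ k * Γ := by
  induction k with
  | zero => simp
  | succ k ih =>
    obtain ⟨h1, h2⟩ := ih (by omega)
    obtain ⟨h3, h4⟩ := h.2 (i + k) (by omega)
    rw [← add_assoc]
    push_cast
    constructor
    · have e : n (i + k + 1) - n i = (n (i + k + 1) - n (i + k)) + (n (i + k) - n i) := by abel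
      rw [e]
      linarith [nrm_add_le (n (i + k + 1) - n (i + k)) (n (i + k) - n i)]
    · linarith [abs_sub_le (freq G (n (i + k + 1))) (freq G (n (i + k))) (freq G (n i))]

lemma IsLatticeChain.dist_le_of_window {G : Matrix (Fin d) (Fin d) ℝ} {Γ : ℝ} {L : ℕ}
    {n : ℕ → Fin d → ℤ} (h : IsLatticeChain G Γ L n) (hΓ : 0 ≤ Γ) {j ℓ a b : ℕ} (hj : j + ℓ ≤ L)
    (ha : j ≤ a ∧ a ≤ j + ℓ) (hb : j ≤ b ∧ b ≤ j + ℓ) :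
    nrm (n a - n b) ≤ ℓ * Γ ∧ |freq G (n a) - freq G (n b)| ≤ ℓ * Γ := by
  have aux : ∀ a b : ℕ, j ≤ b → b ≤ a → a ≤ j + ℓ →
      nrm (n a - n b) ≤ ℓ * Γ ∧ |freq G (n a) - freq G (n b)| ≤ ℓ * Γ := by
    intro a b h1 h2 h3
    obtain ⟨k, rfl⟩ := Nat.exists_eq_add_of_le h2
    have hk : (k : ℝ) * Γ ≤ ℓ * Γ := by
      have : k ≤ ℓ := by omega
      gcongr
    have := h.dist_le b k (by omega)
    exact ⟨this.1.trans hk, this.2.trans hk⟩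
  rcases le_total b a with hab | hab
  · exact aux a b hb.1 hab ha.2
  · rw [nrm_sub_comm, abs_sub_comm]
    exact aux b a ha.1 hab hb.2

/-- A lattice chain contained in a ball has few points. -/
lemma IsLatticeChain.length_le_of_ball {G : Matrix (Fin d) (Fin d) ℝ} {Γ : ℝ} {L : ℕ}
    {n : ℕ → Fin d → ℤ} (h : IsLatticeChain G Γ L n) {ρ : ℝ} (hρ : 0 ≤ ρ)
    (hn : ∀ i ≤ L, nrm (n i - n 0) ≤ ρ) : (L : ℝ) ≤ (2 * ρ + 1) ^ d := by
  set m : ℤ := ⌊ρ⌋ with hm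
  have hm0 : 0 ≤ m := Int.floor_nonneg.2 hρ
  set box := Finset.Icc (fun i => n 0 i - m) (fun i => n 0 i + m) with hbox
  have hcard : ((box.card : ℕ) : ℝ) ≤ (2 * ρ + 1) ^ d := by
    rw [hbox, Pi.card_Icc]
    simp only [Int.card_Icc]
    have e : ∀ i, (n 0 i + m + 1 - (n 0 i - m)).toNat = (2 * m + 1).toNat := fun i => by
      congr 1; ring
    simp only [e, Finset.prod_const, Finset.card_univ, Fintype.card_fin]
    push_cast
    have h1 : (((2 * m + 1).toNat : ℕ) : ℝ) = 2 * m + 1 := by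
      have : (((2 * m + 1).toNat : ℕ) : ℤ) = 2 * m + 1 := Int.toNat_of_nonneg (by omega)
      exact_mod_cast this
    rw [h1]
    have h2 := Int.floor_le ρ
    have h3 : (0 : ℝ) ≤ m := by exact_mod_cast hm0
    gcongr
  have hle : (Finset.range (L + 1)).card ≤ box.card := by
    refine Finset.card_le_card_of_injOn n (fun i hi => ?_) fun a ha b hb hab =>
      h.1 (by simp at ha ⊢; omega) (by simp at hb ⊢; omega) hab
    have hi' : i ≤ L := by simp at hi; omega
    have habs : ∀ k, |n i k - n 0 k| ≤ m := fun k => by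
      rw [hm, Int.le_floor]
      have := (abs_apply_le_nrm (n i - n 0) k).trans (hn i hi')
      simpa using this
    rw [hbox, Finset.coe_Icc]
    exact ⟨fun k => by have := abs_le.1 (habs k); linarith [this.1],
      fun k => by have := abs_le.1 (habs k); linarith [this.2]⟩
  rw [Finset.card_range] at hle
  have : (L : ℝ) + 1 ≤ box.card := by exact_mod_cast hle
  linarith

/-- A polynomial bound for the length of lattice chains. -/
lemma exists_chain_bound (d k : ℕ) : ∃ e : ℕ, ∀ G : Matrix (Fin d) (Fin d) ℝ, G.PosDef →
    ∃ A : ℝ, 1 ≤ A ∧ ∀ Γ : ℝ, 1 ≤ Γ → ∀ (L : ℕ) (n : ℕ → Fin d → ℤ), IsLatticeChain G Γ L n →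
      ∀ V : Submodule ℝ (EuclideanSpace ℝ (Fin d)), Module.finrank ℝ V ≤ k →
        (∀ i ≤ L, ∀ j ≤ L, vec (n i) - vec (n j) ∈ V) → (L : ℝ) ≤ A * Γ ^ e := by
  induction k with
  | zero =>
    refine ⟨0, fun G _ => ⟨1, le_rfl, fun Γ _ L n hn V hV hmem => ?_⟩⟩
    have hV0 : V = ⊥ := Submodule.finrank_eq_zero.1 (Nat.le_zero.1 hV)
    have h1 := hmem L le_rfl 0 (Nat.zero_le _)
    rw [hV0, Submodule.mem_bot, ← vec_sub] at h1
    have h2 : n L = n 0 := by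
      have : nrm (n L - n 0) = 0 := by rw [nrm_eq_norm, h1, norm_zero]
      ext i
      have h3 := abs_apply_le_nrm (n L - n 0) i
      rw [this] at h3
      have h4 : (((n L - n 0) i : ℤ) : ℝ) = 0 := abs_eq_zero.1 (le_antisymm h3 (abs_nonneg _))
      have h5 : (n L - n 0) i = 0 := by exact_mod_cast h4
      simpa [sub_eq_zero] using h5
    have h3 : L = 0 := hn.1 (by simp) (by simp) h2
    simp [h3]
  | succ k ih =>
    obtain ⟨e, ih⟩ := ih
    -- `abs_metric_le_of_mem_span` with q = k + 1 costs 2q + 1 powers of `B`, and the pairing with a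
    -- basis vector is of order B².
    set p := 2 * (k + 1) + 3 with hp
    -- The first term counts lattice points in a ball of radius of order Γ^{(e+1)p}; the second
    -- covers chains shorter than one window. The exponent is fixed before `G`, so that δ will
    -- depend on d only.
    refine ⟨(e + 1) * p * d + e, fun G hG => ?_⟩
    obtain ⟨A, hA, ih⟩ := ih G hG
    obtain ⟨g, a, hg, ha, hgl, hgu⟩ := exists_metric_bounds hG
    set Q : ℝ := ((k + 1 : ℕ) : ℝ) ^ 2 * (k + 1).factorial with hQ
    have hQ0 : 0 ≤ Q := by positivity
    set C : ℝ := ((4 * (Q * a) / g + 1) * (2 * A) ^ p) ^ d with hC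
    have hC0 : 0 ≤ C := by positivity
    refine ⟨2 * A + C, by linarith, fun Γ hΓ L n hn V hV hmem => ?_⟩
    have hΓ0 : 0 ≤ Γ := by linarith
    have hΓe : 1 ≤ Γ ^ e := one_le_pow₀ hΓ
    -- By the induction hypothesis a window of ℓ steps is too long for its differences to span at
    -- most k dimensions. In a longer chain every window therefore spans all of `V`.
    set ℓ := ⌊A * Γ ^ e⌋₊ + 1 with hℓ
    have hAΓ : 1 ≤ A * Γ ^ e := one_le_mul_of_one_le_of_one_le hA hΓe
    have hℓ1 : A * Γ ^ e < ℓ := by rw [hℓ]; push_cast; exact Nat.lt_floor_add_one _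
    have hℓ2 : (ℓ : ℝ) ≤ 2 * A * Γ ^ e := by
      have := Nat.floor_le (zero_le_one.trans hAΓ)
      rw [hℓ]; push_cast; linarith
    have hEe : Γ ^ e ≤ Γ ^ ((e + 1) * p * d + e) := pow_le_pow_right₀ hΓ (by omega)
    have hE' : Γ ^ ((e + 1) * p * d) ≤ Γ ^ ((e + 1) * p * d + e) := pow_le_pow_right₀ hΓ (by omega)
    rcases lt_or_ge L ℓ with hL | hL
    · calc (L : ℝ) ≤ ℓ := by exact_mod_cast hL.le
        _ ≤ 2 * A * Γ ^ e := hℓ2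
        _ ≤ 2 * A * Γ ^ ((e + 1) * p * d + e) := by gcongr
        _ ≤ _ := by gcongr; linarith
    set B := ℓ * Γ with hB
    have hB1 : 1 ≤ B := one_le_mul_of_one_le_of_one_le (hAΓ.trans hℓ1.le) hΓ
    have key : ∀ i ≤ L, ∀ v ∈ V, |metric G (vec (n i)) v| ≤ Q * a * B ^ p * ‖v‖ := by
      intro i hi v hv
      obtain ⟨j, hjL, hji, hij⟩ : ∃ j, j + ℓ ≤ L ∧ j ≤ i ∧ i ≤ j + ℓ :=
        ⟨min i (L - ℓ), by omega, by omega, by omega⟩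
      set s : Set (EuclideanSpace ℝ (Fin d)) :=
        {x | ∃ m, j ≤ m ∧ m ≤ j + ℓ ∧ x = vec (n m) - vec (n i)} with hs
      have hsub : Submodule.span ℝ s ≤ V := by
        refine Submodule.span_le.2 ?_
        rintro _ ⟨m, hm1, hm2, rfl⟩
        exact hmem m (by omega) i hi
      have hk : k + 1 ≤ Module.finrank ℝ (Submodule.span ℝ s) := by
        by_contra hlt
        refine absurd (ih Γ hΓ ℓ _ (hn.shift hjL) (Submodule.span ℝ s) (by omega)
          fun m hm m' hm' => ?_) (not_le.2 hℓ1)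
        have e1 : vec (n (j + m)) - vec (n (j + m')) =
            (vec (n (j + m)) - vec (n i)) - (vec (n (j + m')) - vec (n i)) := by abel
        rw [e1]
        exact Submodule.sub_mem _ (Submodule.subset_span ⟨j + m, by omega, by omega, rfl⟩)
          (Submodule.subset_span ⟨j + m', by omega, by omega, rfl⟩)
      have hspan : Submodule.span ℝ s = V :=
        Submodule.eq_of_le_of_finrank_le hsub (hV.trans hk)
      have hq : Module.finrank ℝ (Submodule.span ℝ s) = k + 1 :=
        le_antisymm (by rw [hspan]; exact hV) hk
      obtain ⟨F, hF1, hF2, hF3⟩ := Submodule.exists_fun_fin_finrank_span_eq ℝ s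
      choose m hm1 hm2 hm3 using hF1
      have hFb : F = fun l => vec (n (m l) - n i) := by ext1 l; rw [hm3, vec_sub]
      have hd1 : ∀ l, nrm (n (m l) - n i) ≤ B ∧ |freq G (n (m l)) - freq G (n i)| ≤ B := fun l =>
        hn.dist_le_of_window hΓ0 hjL ⟨hm1 l, hm2 l⟩ ⟨hji, hij⟩
      rw [hFb] at hF2 hF3
      have hY : ∀ l, |metric G (vec (n i)) (vec (n (m l) - n i))| ≤ a * B ^ 2 := fun l => by
        set b := n (m l) - n i with hb
        -- Polarisation: a bounded frequency increment bounds the pairing of n_i with the increment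
        -- b, and such increments contain a basis of `V`.
        have e1 : freq G (n (m l)) - freq G (n i) =
            metric G (vec b) (vec b) + 2 * metric G (vec (n i)) (vec b) := by
          have e2 : n (m l) = n i + b := by rw [hb]; abel
          rw [e2, freq_eq_metric, freq_eq_metric, vec_add, metric_add_left, metric_add_right,
            metric_add_right, metric_comm hG.1 (vec b) (vec (n i))]
          ring
        have h1 := (hd1 l).2
        rw [e1] at h1
        have h2 := hgu (vec b) (vec b)
        rw [← nrm_eq_norm] at h2
        have h3 : a * nrm b * nrm b ≤ a * B ^ 2 := by
          rw [mul_assoc, ← sq]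
          have := (hd1 l).1
          have := nrm_nonneg b
          gcongr
        have h4 : B ≤ a * B ^ 2 := by nlinarith
        rw [abs_le] at h1 h2 ⊢
        constructor <;> linarith [h1.1, h1.2, h2.1, h2.2]
      have h5 := abs_metric_le_of_mem_span G hF3 hB1 (fun l => (hd1 l).1) hY
        (v := v) (by rw [hF2, hspan]; exact hv)
      rw [hq] at h5
      refine h5.trans (le_of_eq ?_)
      rw [hp, hQ]; ring
    -- Since z = n_i - n_0 lies in `V`, both endpoints have a bounded pairing with z / |z|, and
    -- positivity of the metric bounds |z|. The chain stays in a ball and is injective, so its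
    -- length is at most a count of lattice points.
    have hball : ∀ i ≤ L, nrm (n i - n 0) ≤ 2 * (Q * a) / g * B ^ p := by
      intro i hi
      have hz := hmem i hi 0 (Nat.zero_le _)
      rw [← vec_sub] at hz
      set z := n i - n 0 with hzdef
      have h1 := key i hi _ hz
      have h2 := key 0 (Nat.zero_le _) _ hz
      have h3 := hgl (vec z)
      have h4 : metric G (vec z) (vec z) = metric G (vec (n i)) (vec z) - metric G (vec (n 0)) (vec z) := by
        rw [← metric_sub_left, ← vec_sub]
      rw [h4] at h3
      rw [nrm_eq_norm]
      rcases (norm_nonneg (vec z)).eq_or_lt with h0 | h0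
      · rw [← h0]; positivity
      · have h5 : g * ‖vec z‖ ^ 2 ≤ 2 * (Q * a * B ^ p) * ‖vec z‖ := by
          linarith [(abs_le.1 h1).2, (abs_le.1 h2).1]
        have h6 : g * ‖vec z‖ ≤ 2 * (Q * a * B ^ p) := by
          refine le_of_mul_le_mul_right ?_ h0
          linarith
        rw [div_mul_eq_mul_div, le_div_iff₀ hg]
        linarith
    have hfin := hn.length_le_of_ball (by positivity) hball
    have hBp : 1 ≤ B ^ p := one_le_pow₀ hB1
    have hBΓ : B ≤ 2 * A * Γ ^ (e + 1) := by
      rw [hB, pow_succ, ← mul_assoc]; gcongr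
    calc (L : ℝ) ≤ (2 * (2 * (Q * a) / g * B ^ p) + 1) ^ d := hfin
      _ ≤ ((4 * (Q * a) / g + 1) * B ^ p) ^ d := by
          gcongr
          rw [add_mul, one_mul]
          have : 2 * (2 * (Q * a) / g * B ^ p) = 4 * (Q * a) / g * B ^ p := by ring
          linarith
      _ ≤ ((4 * (Q * a) / g + 1) * (2 * A * Γ ^ (e + 1)) ^ p) ^ d := by gcongr
      _ = C * Γ ^ ((e + 1) * p * d) := by
          rw [hC, mul_pow (2 * A), ← mul_assoc, mul_pow, ← pow_mul, ← pow_mul,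
            mul_assoc (e + 1) p d]
      _ ≤ C * Γ ^ ((e + 1) * p * d + e) := by gcongr
      _ ≤ _ := by gcongr; linarith

end Chains
end

noncomputable section

/-! ### Existence of cluster decompositions -/

section Clusters

variable {d : ℕ}

/-- Paths of close lattice points stay in dyadic shells. -/
lemma nrm_le_of_chain {G : Matrix (Fin d) (Fin d) ℝ} {e : ℕ} {A δ R : ℝ} (hA : 1 ≤ A)
    (hδ : δ * (e + 1 : ℕ) = 1 / 2)
    (hchain : ∀ Γ : ℝ, 1 ≤ Γ → ∀ (L : ℕ) (n : ℕ → Fin d → ℤ), IsLatticeChain G Γ L n →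
      (L : ℝ) ≤ A * Γ ^ e) (hR : 8 * A ^ 2 ≤ R) {L : ℕ} {n : ℕ → Fin d → ℤ}
    (hinj : Set.InjOn n {i | i ≤ L})
    (hn : ∀ i < L, nrm (n (i + 1) - n i) + |freq G (n (i + 1)) - freq G (n i)| ≤
      (nrm (n (i + 1)) + nrm (n i)) ^ δ) (h0 : nrm (n 0) ≤ R) :
    ∀ j ≤ L, nrm (n j) ≤ 2 * R := by
  have hA2 : 1 ≤ A ^ 2 := one_le_pow₀ hA
  have hR8 : 8 ≤ R := by linarith
  have hδ0 : 0 < δ := by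
    by_contra h
    have : δ * (e + 1 : ℕ) ≤ 0 := mul_nonpos_of_nonpos_of_nonneg (not_lt.1 h) (Nat.cast_nonneg _)
    linarith
  have hδ2 : δ ≤ 1 / 2 := by
    rw [← hδ]
    refine le_mul_of_one_le_right hδ0.le ?_
    exact_mod_cast Nat.succ_le_succ (Nat.zero_le e)
  intro j
  induction j using Nat.strong_induction_on with
  | _ j ih =>
  intro hj
  rcases j with _ | j
  · linarith
  have hprev : ∀ i ≤ j, nrm (n i) ≤ 2 * R := fun i hi => ih i (by omega) (by omega)
  have hstep : ∀ i < L, nrm (n (i + 1) - n i) ≤ (nrm (n (i + 1)) + nrm (n i)) ^ δ ∧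
      |freq G (n (i + 1)) - freq G (n i)| ≤ (nrm (n (i + 1)) + nrm (n i)) ^ δ := fun i hi => by
    have h1 := hn i hi
    have h2 := nrm_nonneg (n (i + 1) - n i)
    have h3 := abs_nonneg (freq G (n (i + 1)) - freq G (n i))
    constructor <;> linarith
  -- The allowed length of the last step involves its own endpoint, not yet bounded. As δ ≤ 1/2, a
  -- step is at most y/2 for large y, and then y > 8R is incompatible with |n_j| ≤ 2R.
  have hy : nrm (n (j + 1)) + nrm (n j) ≤ 8 * R := by
    by_contra hlt
    rw [not_le] at hlt
    set y := nrm (n (j + 1)) + nrm (n j) with hy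
    have h1 : nrm (n (j + 1)) ≤ nrm (n (j + 1) - n j) + nrm (n j) := by
      simpa using nrm_add_le (n (j + 1) - n j) (n j)
    have h2 := (hstep j (by omega)).1
    have h3 : y ^ δ ≤ y ^ (1 / 2 : ℝ) := Real.rpow_le_rpow_of_exponent_le (by linarith) hδ2
    rw [← Real.sqrt_eq_rpow] at h3
    have h4 := hprev j le_rfl
    have h5 : Real.sqrt y ≤ y / 2 := by
      rw [Real.sqrt_le_left (by linarith)]
      nlinarith
    have h6 : nrm (n (j + 1) - n j) ≤ Real.sqrt y := h2.trans h3
    linarith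
  set Γ := (8 * R) ^ δ with hΓ
  have hΓ1 : 1 ≤ Γ := Real.one_le_rpow (by linarith) hδ0.le
  have hch : IsLatticeChain G Γ (j + 1) n := by
    refine ⟨hinj.mono fun i hi => le_trans hi hj, fun i hi => ?_⟩
    have hle : (nrm (n (i + 1)) + nrm (n i)) ^ δ ≤ Γ := by
      refine Real.rpow_le_rpow (add_nonneg (nrm_nonneg _) (nrm_nonneg _)) ?_ hδ0.le
      rcases Nat.lt_succ_iff_lt_or_eq.1 hi with h | rfl
      · linarith [hprev (i + 1) h, hprev i h.le]
      · exact hy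
    exact ⟨(hstep i (by omega)).1.trans hle, (hstep i (by omega)).2.trans hle⟩
  have hlen := hchain Γ hΓ1 (j + 1) n hch
  have hdist := (hch.dist_le 0 (j + 1) (by omega)).1
  rw [zero_add] at hdist
  -- The displacement is at most length times step, that is A Γ^{e+1}; the choice δ(e + 1) = 1/2
  -- turns this into A (8R)^{1/2}, which is at most R because R ≥ 8A².
  have hΓe : Γ ^ (e + 1) = Real.sqrt (8 * R) := by
    rw [hΓ, ← Real.rpow_natCast, ← Real.rpow_mul (by linarith), hδ, Real.sqrt_eq_rpow]
  have h1 : nrm (n (j + 1) - n 0) ≤ A * Real.sqrt (8 * R) := by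
    rw [← hΓe, pow_succ, ← mul_assoc]
    exact hdist.trans (mul_le_mul_of_nonneg_right hlen (by linarith))
  have h2 : A * Real.sqrt (8 * R) ≤ R := by
    rw [← Real.sqrt_sq (zero_le_one.trans hA), ← Real.sqrt_mul (sq_nonneg A),
      Real.sqrt_le_left (by linarith)]
    nlinarith
  have h3 : nrm (n (j + 1)) ≤ nrm (n (j + 1) - n 0) + nrm (n 0) := by
    simpa using nrm_add_le (n (j + 1) - n 0) (n 0)
  linarith

/-- The graph of pairs of close lattice points. -/
def closeGraph (G : Matrix (Fin d) (Fin d) ℝ) (δ : ℝ) : SimpleGraph (Fin d → ℤ) where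
  Adj m n := m ≠ n ∧ nrm (m - n) + |freq G m - freq G n| ≤ (nrm m + nrm n) ^ δ
  symm := ⟨fun m n h => ⟨h.1.symm, by rw [nrm_sub_comm, abs_sub_comm, add_comm (nrm n)]; exact h.2⟩⟩
  loopless := ⟨fun _ h => h.1 rfl⟩

/-- The components of the graph of close pairs, where the components that meet the ball of radius
`R` are merged. -/
def mergedComponents (G : Matrix (Fin d) (Fin d) ℝ) (δ R : ℝ) : Setoid (Fin d → ℤ) where
  r m n := (closeGraph G δ).Reachable m n ∨
    (∃ b, nrm b ≤ R ∧ (closeGraph G δ).Reachable b m) ∧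
      ∃ b, nrm b ≤ R ∧ (closeGraph G δ).Reachable b n
  iseqv :=
    { refl := fun m => Or.inl (SimpleGraph.Reachable.refl m)
      symm := fun h => h.elim (fun h => Or.inl h.symm) fun h => Or.inr ⟨h.2, h.1⟩
      trans := by
        rintro l m n (h | ⟨hl, b, hb, hm⟩) (h' | ⟨⟨b', hb', hm'⟩, hn⟩)
        · exact Or.inl (h.trans h')
        · exact Or.inr ⟨⟨b', hb', hm'.trans h.symm⟩, hn⟩
        · exact Or.inr ⟨hl, b, hb, hm.trans h'⟩
        · exact Or.inr ⟨hl, hn⟩ }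

/-- Bourgain's cluster decomposition. -/
lemma exists_isClusterDecomposition (d : ℕ) : ∃ δ : ℝ, 0 < δ ∧ δ < 1 ∧
    ∀ G : Matrix (Fin d) (Fin d) ℝ, G.PosDef → ∃ C₀ : ℝ, 2 ≤ C₀ ∧
      ∃ P : Setoid (Fin d → ℤ), IsClusterDecomposition G δ C₀ P := by
  obtain ⟨e, he⟩ := exists_chain_bound d d
  have hepos : (0 : ℝ) < (e + 1 : ℕ) := by exact_mod_cast Nat.succ_pos e
  have he1 : (1 : ℝ) ≤ (e + 1 : ℕ) := by exact_mod_cast Nat.succ_le_succ (Nat.zero_le e)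
  refine ⟨1 / (2 * (e + 1 : ℕ)), by positivity, ?_, fun G hG => ?_⟩
  · rw [div_lt_one (by positivity)]; linarith
  set δ : ℝ := 1 / (2 * (e + 1 : ℕ)) with hδ
  have hδe : δ * (e + 1 : ℕ) = 1 / 2 := by rw [hδ]; field_simp
  obtain ⟨A, hA, hchain⟩ := he G hG
  have hA2 : 1 ≤ A ^ 2 := one_le_pow₀ hA
  -- The least radius allowed in `nrm_le_of_chain`. Components meeting the ball of radius R stay in
  -- the ball of radius 2R and are merged into the exceptional cluster; the other components lie
  -- outside the ball of radius R, where chains at most double the norm.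
  set R := 8 * A ^ 2 with hR
  have hchain' : ∀ Γ : ℝ, 1 ≤ Γ → ∀ (L : ℕ) (n : ℕ → Fin d → ℤ), IsLatticeChain G Γ L n →
      (L : ℝ) ≤ A * Γ ^ e := fun Γ hΓ L n hn => hchain Γ hΓ L n hn ⊤
    (by rw [finrank_top, finrank_euclideanSpace_fin]) fun _ _ _ _ => Submodule.mem_top
  have hreach : ∀ a b r, (closeGraph G δ).Reachable a b → nrm a ≤ r → R ≤ r → nrm b ≤ 2 * r := by
    intro a b r hab ha hr
    obtain ⟨p, hp⟩ := hab.exists_isPath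
    have := nrm_le_of_chain hA hδe hchain' hr (n := p.getVert) (L := p.length) hp.getVert_injOn
      (fun i hi => (p.adj_getVert_succ hi).symm.2) (by simpa using ha) p.length le_rfl
    simpa using this
  refine ⟨2 * R, by linarith, mergedComponents G δ R, ?_⟩
  set P := mergedComponents G δ R with hP
  have hlow : ∀ n, Quotient.mk P n = Quotient.mk P 0 ↔
      ∃ b, nrm b ≤ R ∧ (closeGraph G δ).Reachable b n := by
    intro n
    have h0 : nrm (0 : Fin d → ℤ) ≤ R := by rw [nrm_zero]; linarith
    rw [Quotient.eq]
    constructor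
    · rintro (h | ⟨h, -⟩)
      · exact ⟨0, h0, h.symm⟩
      · exact h
    · exact fun h => Or.inr ⟨h, 0, h0, SimpleGraph.Reachable.refl _⟩
  have hhigh : ∀ m n, Quotient.mk P m ≠ Quotient.mk P 0 → Quotient.mk P n = Quotient.mk P m →
      nrm n ≤ 2 * nrm m := by
    intro m n hm hmn
    have hmR : R ≤ nrm m := by
      by_contra h
      exact hm ((hlow m).2 ⟨m, (not_le.1 h).le, SimpleGraph.Reachable.refl _⟩)
    rcases Quotient.exact hmn with h | ⟨-, h⟩
    · exact hreach m n _ h.symm le_rfl hmR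
    · exact absurd ((hlow m).2 h) hm
  have hlow' : ∀ n, Quotient.mk P n = Quotient.mk P 0 → nrm n ≤ 2 * R := fun n hn => by
    obtain ⟨b, hb, hbn⟩ := (hlow n).1 hn
    exact hreach b n R hbn hb le_rfl
  refine ⟨fun υ => ?_, ⟨Quotient.mk P 0, hlow', fun n hn => ?_, fun υ hυ n hn => ?_⟩,
    fun m n hmn => ?_⟩
  · obtain ⟨m, rfl⟩ := Quotient.exists_rep υ
    by_cases hm : Quotient.mk P m = Quotient.mk P 0
    · exact (finite_nrm_le (2 * R)).subset fun n hn => hlow' n (Eq.trans hn hm)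
    · exact (finite_nrm_le (2 * nrm m)).subset fun n hn => hhigh m n hm hn
  · exact (hlow n).2 ⟨n, by linarith, SimpleGraph.Reachable.refl _⟩
  · have : Nonempty (cluster P υ) := ⟨⟨n, hn⟩⟩
    have h : nrm n / 2 ≤ clusterMin P υ := le_ciInf fun m => by
      have h1 : Quotient.mk P (m : Fin d → ℤ) = υ := m.2
      have := hhigh m n (by rw [h1]; exact hυ) (by rw [h1]; exact hn)
      linarith
    linarith
  · by_contra h
    refine hmn (Quotient.sound (Or.inl (SimpleGraph.Adj.reachable ⟨fun e => hmn (by rw [e]), ?_⟩)))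
    exact not_lt.1 h

end Clusters
end

noncomputable section

/-! ### From weighted actions to super-actions and high modes -/

section SuperActions

variable {d : ℕ} {P : Setoid (Fin d → ℤ)}

lemma clusterMin_nonneg (υ : Quotient P) : 0 ≤ clusterMin P υ := Real.iInf_nonneg fun _ => nrm_nonneg _

lemma clusterMin_le (n : Fin d → ℤ) : clusterMin P (Quotient.mk P n) ≤ nrm n :=
  ciInf_le (f := fun n : cluster P (Quotient.mk P n) => nrm (n : Fin d → ℤ))
    ⟨0, by rintro _ ⟨m, rfl⟩; exact nrm_nonneg _⟩ ⟨n, rfl⟩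

lemma superAction_nonneg (υ : Quotient P) (v : (Fin d → ℤ) → ℂ) : 0 ≤ superAction P υ v :=
  tsum_nonneg fun _ => sq_nonneg _

open Classical in
/-- The union of finitely many finite clusters. -/
def clusterUnion (hfin : ∀ υ, (cluster P υ).Finite) (F : Finset (Quotient P)) : Finset (Fin d → ℤ) :=
  F.biUnion fun υ => (hfin υ).toFinset

lemma mem_clusterUnion {hfin : ∀ υ, (cluster P υ).Finite} {F : Finset (Quotient P)}
    {n : Fin d → ℤ} : n ∈ clusterUnion hfin F ↔ Quotient.mk P n ∈ F := by
  simp [clusterUnion, cluster]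

lemma sum_mul_superAction (hfin : ∀ υ, (cluster P υ).Finite) (F : Finset (Quotient P))
    (W : Quotient P → ℝ) (v : (Fin d → ℤ) → ℂ) :
    ∑ υ ∈ F, W υ * superAction P υ v =
      ∑ n ∈ clusterUnion hfin F, W (Quotient.mk P n) * ‖v n‖ ^ 2 := by
  classical
  rw [clusterUnion, Finset.sum_biUnion]
  · refine Finset.sum_congr rfl fun υ _ => ?_
    have h : superAction P υ v = ∑ n ∈ (hfin υ).toFinset, ‖v n‖ ^ 2 := by
      rw [superAction, tsum_subtype (cluster P υ) fun n => ‖v n‖ ^ 2,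
        tsum_eq_sum (s := (hfin υ).toFinset) fun n hn =>
          Set.indicator_of_notMem (by simpa using hn) _]
      exact Finset.sum_congr rfl fun n hn => Set.indicator_of_mem (by simpa using hn) _
    rw [h, Finset.mul_sum]
    refine Finset.sum_congr rfl fun n hn => ?_
    have : Quotient.mk P n = υ := by simpa [cluster] using hn
    rw [this]
  · intro υ _ υ' _ hne
    refine Finset.disjoint_left.2 fun n hn hn' => hne ?_
    have h1 : Quotient.mk P n = υ := by simpa [cluster] using hn
    have h2 : Quotient.mk P n = υ' := by simpa [cluster] using hn'
    rw [← h1, h2]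

/-- Weighted sums of super-actions are dominated by the square of the norm. -/
lemma sum_mul_superAction_le (hfin : ∀ υ, (cluster P υ).Finite) (F : Finset (Quotient P))
    {W : Quotient P → ℝ} {s : ℝ} (hW : ∀ n, W (Quotient.mk P n) ≤ bracket n ^ (2 * s))
    {v : (Fin d → ℤ) → ℂ} (hv : MemHs s v) :
    ∑ υ ∈ F, W υ * superAction P υ v ≤ hsNorm s v ^ 2 := by
  rw [sum_mul_superAction hfin, hsNorm, Real.sq_sqrt (tsum_nonneg fun n =>
    mul_nonneg (bracket_rpow_pos n _).le (sq_nonneg _))]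
  exact (Finset.sum_le_sum fun n _ => mul_le_mul_of_nonneg_right (hW n) (sq_nonneg _)).trans
    (hv.sum_le_tsum _ fun n _ => mul_nonneg (bracket_rpow_pos n _).le (sq_nonneg _))

lemma clusterMin_rpow_le {s : ℝ} (hs : 0 ≤ s) (n : Fin d → ℤ) :
    clusterMin P (Quotient.mk P n) ^ (2 * s) ≤ bracket n ^ (2 * s) :=
  Real.rpow_le_rpow (clusterMin_nonneg _) ((clusterMin_le n).trans (nrm_le_bracket n)) (by positivity)

/-- Variation of the high super-actions. -/
lemma exists_superAction_variation_bound (hd : 1 ≤ d) {G : Matrix (Fin d) (Fin d) ℝ} (hG : G.PosDef)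
    {δ : ℝ} (hδ0 : 0 < δ) (hδ1 : δ < 1) {s : ℝ} (hs : (d : ℝ) < s) {f : ℝ → ℝ} (hf : ContDiff ℝ ∞ f)
    (hf0 : f 0 = 0) {r c : ℝ} (hc : 1 < c) : ∃ K : ℝ, 0 < K ∧ ∀ (C₀ : ℝ)
      (P : Setoid (Fin d → ℤ)), IsClusterDecomposition G δ C₀ P →
      ∀ (T ρ : ℝ) (u : ℝ → (Fin d → ℤ) → ℂ), 0 < ρ → ρ ≤ 1 → IsNLSSolution G f s T u →
      hsNorm s (u 0) ≤ ρ → (∀ t ∈ Set.Icc 0 T, hsNorm s (u t) ≤ c * ρ) →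
      ∀ M : ℝ, 2 ≤ M → ∀ t ∈ Set.Icc 0 T, ∀ F : Finset (Quotient P), (∀ υ ∈ F, M ≤ clusterMin P υ) →
        ∑ υ ∈ F, clusterMin P υ ^ (2 * s) * |superAction P υ (u t) - superAction P υ (u 0)| ≤
          K * (ρ ^ 4 + T * M ^ (-(δ / 2) * (s - d)) * ρ ^ 4 + T * ρ ^ (2 * (r + 1))) := by
  -- This gives 2D + 4 ≥ 2(r + 1), which suffices because ρ ≤ 1.
  set D := ⌈r⌉₊ with hD
  obtain ⟨K, hK, hbound⟩ := exists_weighted_action_bound hd hG hδ0 hδ1 hs hf hf0 D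
  have hs0 : 0 ≤ s := (Nat.cast_nonneg d).trans hs.le
  refine ⟨K * c ^ (2 * D + 4) + 2 * c ^ 4, by positivity, ?_⟩
  intro C₀ P hP T ρ u hρ hρ1 hu hu0 hub M hM t ht F hF
  have hT : 0 ≤ T := ht.1.trans ht.2
  have h0T : (0 : ℝ) ∈ Set.Icc 0 T := ⟨le_rfl, hT⟩
  have hMp : 0 ≤ M ^ (-(δ / 2) * (s - d)) := Real.rpow_nonneg (by linarith) _
  have hρr : 0 ≤ ρ ^ (2 * (r + 1)) := Real.rpow_nonneg hρ.le _
  have hm : ∀ υ : Quotient P, 0 ≤ clusterMin P υ ^ (2 * s) := fun υ =>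
    Real.rpow_nonneg (clusterMin_nonneg υ) _
  -- If c ρ > 1 the estimate is trivial: the left side is at most 2(c ρ)² ≤ 2 c⁴ ρ⁴. This frees the
  -- threshold on ρ from `s` and `c`.
  rcases le_or_gt (c * ρ) 1 with hcρ | hcρ
  · set ΔS : Quotient P → ℝ := fun υ => superAction P υ (u t) - superAction P υ (u 0) with hΔS
    -- The signs turn the sum of absolute values into one weighted sum of actions, with weights
    -- constant on clusters.
    set W : Quotient P → ℝ := fun υ =>
      (if 0 ≤ ΔS υ then 1 else -1) * clusterMin P υ ^ (2 * s) with hW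
    have hWabs : ∀ υ, |W υ| = clusterMin P υ ^ (2 * s) := fun υ => by
      simp only [hW]
      rw [abs_mul, abs_of_nonneg (hm υ)]
      split_ifs <;> simp
    classical
    have hϖ : IsClusterWeight P M s fun n => if Quotient.mk P n ∈ F then W (Quotient.mk P n) else 0 := by
      refine ⟨fun n => ?_, fun n hn => ?_, fun m n hmn => by rw [hmn]⟩
      · split_ifs
        · rw [hWabs]; exact clusterMin_rpow_le hs0 n
        · rw [abs_zero]; exact (bracket_rpow_pos n _).le
      · have : Quotient.mk P n ∈ F := by by_contra h; exact hn (if_neg h)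
        exact (hF _ this).trans (clusterMin_le n)
    have hmain := hbound P M _ (clusterUnion hP.finite F) T (c * ρ) u hP.separated (by linarith) hϖ
      (fun n hn => if_neg fun h => hn (mem_clusterUnion.2 h)) (by positivity) hcρ hu hub t ht
    have e : ∑ υ ∈ F, clusterMin P υ ^ (2 * s) * |ΔS υ| =
        ∑ n ∈ clusterUnion hP.finite F, (if Quotient.mk P n ∈ F then W (Quotient.mk P n) else 0) *
          (‖u t n‖ ^ 2 - ‖u 0 n‖ ^ 2) := by
      have e1 : ∀ υ ∈ F, clusterMin P υ ^ (2 * s) * |ΔS υ| =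
          W υ * superAction P υ (u t) - W υ * superAction P υ (u 0) := fun υ _ => by
        rw [← mul_sub]
        simp only [hW]
        split_ifs with h
        · rw [abs_of_nonneg h]; simp only [hΔS]; ring
        · rw [abs_of_neg (not_le.1 h)]; simp only [hΔS]; ring
      rw [Finset.sum_congr rfl e1, Finset.sum_sub_distrib, sum_mul_superAction hP.finite,
        sum_mul_superAction hP.finite, ← Finset.sum_sub_distrib]
      refine Finset.sum_congr rfl fun n hn => ?_
      rw [if_pos (mem_clusterUnion.1 hn)]; ring
    rw [e]
    refine (le_abs_self _).trans (hmain.trans ?_)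
    have h1 : (c * ρ) ^ 4 ≤ c ^ (2 * D + 4) * ρ ^ 4 := by
      rw [mul_pow]
      gcongr
      · exact hc.le
      · omega
    have h2 : (c * ρ) ^ (2 * D + 4) ≤ c ^ (2 * D + 4) * ρ ^ (2 * (r + 1)) := by
      rw [mul_pow]
      gcongr
      rw [← Real.rpow_natCast]
      refine Real.rpow_le_rpow_of_exponent_ge hρ hρ1 ?_
      have := Nat.le_ceil r
      rw [hD]; push_cast; linarith
    calc K * ((c * ρ) ^ 4 + T * (M ^ (-(δ / 2) * (s - d)) * (c * ρ) ^ 4 + (c * ρ) ^ (2 * D + 4)))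
        ≤ K * (c ^ (2 * D + 4) * ρ ^ 4 + T * (M ^ (-(δ / 2) * (s - d)) * (c ^ (2 * D + 4) * ρ ^ 4) +
          c ^ (2 * D + 4) * ρ ^ (2 * (r + 1)))) := by gcongr
      _ = K * c ^ (2 * D + 4) *
          (ρ ^ 4 + T * M ^ (-(δ / 2) * (s - d)) * ρ ^ 4 + T * ρ ^ (2 * (r + 1))) := by ring
      _ ≤ _ := by
          gcongr
          have : 0 ≤ 2 * c ^ 4 := by positivity
          linarith
  · have h1 : ∀ υ ∈ F, clusterMin P υ ^ (2 * s) * |superAction P υ (u t) - superAction P υ (u 0)| ≤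
        clusterMin P υ ^ (2 * s) * superAction P υ (u t) +
          clusterMin P υ ^ (2 * s) * superAction P υ (u 0) := fun υ _ => by
      rw [← mul_add]
      refine mul_le_mul_of_nonneg_left ?_ (hm υ)
      have := superAction_nonneg υ (u t)
      have := superAction_nonneg υ (u 0)
      rw [abs_le]; constructor <;> linarith
    refine (Finset.sum_le_sum h1).trans ?_
    rw [Finset.sum_add_distrib]
    have h2 := sum_mul_superAction_le hP.finite (W := fun υ => clusterMin P υ ^ (2 * s)) F
      (clusterMin_rpow_le (P := P) hs0) (hu.mem t ht)
    have h3 := sum_mul_superAction_le hP.finite (W := fun υ => clusterMin P υ ^ (2 * s)) F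
      (clusterMin_rpow_le (P := P) hs0) (hu.mem 0 h0T)
    have h4 : ∀ τ ∈ Set.Icc 0 T, hsNorm s (u τ) ^ 2 ≤ (c * ρ) ^ 2 := fun τ hτ =>
      pow_le_pow_left₀ (Real.sqrt_nonneg _) (hub τ hτ) 2
    have h5 : (c * ρ) ^ 2 ≤ c ^ 4 * ρ ^ 4 := by
      rw [← mul_pow]; exact pow_le_pow_right₀ hcρ.le (by norm_num)
    calc _ ≤ 2 * c ^ 4 * ρ ^ 4 := by linarith [h4 t ht, h4 0 h0T]
      _ ≤ (K * c ^ (2 * D + 4) + 2 * c ^ 4) * ρ ^ 4 := by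
          gcongr
          have : 0 ≤ K * c ^ (2 * D + 4) := by positivity
          linarith
      _ ≤ _ := by
          gcongr
          have : 0 ≤ T * M ^ (-(δ / 2) * (s - d)) * ρ ^ 4 := by positivity
          have : 0 ≤ T * ρ ^ (2 * (r + 1)) := by positivity
          linarith

/-- High modes are controlled by the super-actions. -/
lemma hsNorm_projHigh_sq_le {G : Matrix (Fin d) (Fin d) ℝ} {δ C₀ : ℝ}
    (hP : IsClusterDecomposition G δ C₀ P) {s : ℝ} (hs : 0 ≤ s) {v w : (Fin d → ℤ) → ℂ}
    (hw : MemHs s w) {N B : ℝ} (hN : C₀ < N) (hN2 : 2 ≤ N)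
    (hB : ∀ F : Finset (Quotient P), (∀ υ ∈ F, N / 2 ≤ clusterMin P υ) →
      ∑ υ ∈ F, clusterMin P υ ^ (2 * s) * |superAction P υ v - superAction P υ w| ≤ B) :
    hsNorm s (projHigh N v) ^ 2 ≤ 2 ^ (2 * s) * hsNorm s w ^ 2 + 2 ^ (2 * s) * 2 ^ s * B := by
  classical
  obtain ⟨υ₀, hlow, -, hdy⟩ := hP.dyadic
  have hcl : ∀ n : Fin d → ℤ, N ≤ nrm n → nrm n ≤ 2 * clusterMin P (Quotient.mk P n) := fun n hn =>
    hdy _ (fun h => absurd (hlow n h) (not_le.2 (hN.trans_le hn))) n rfl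
  have hnn : ∀ n, 0 ≤ bracket n ^ (2 * s) * ‖projHigh N v n‖ ^ 2 := fun n =>
    mul_nonneg (bracket_rpow_pos n _).le (sq_nonneg _)
  -- On high modes ⟨n⟩^{2s} ≤ 2^{2s} W, because |n| ≤ 2m there. At the reference state W ≤ ⟨n⟩^{2s}
  -- costs no constant, which keeps the factor 2^{2s} exact. Finally W ≤ 2^s m^{2s}, since m ≥ 1,
  -- brings in the variation bound.
  set W : Quotient P → ℝ := fun υ => (1 + clusterMin P υ ^ 2) ^ s with hW
  have hW0 : ∀ υ, 0 ≤ W υ := fun υ => by simp only [hW]; positivity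
  have hbr : ∀ n : Fin d → ℤ, bracket n ^ (2 * s) = (1 + nrm n ^ 2) ^ s := fun n => by
    rw [Real.rpow_mul (bracket_nonneg n), Real.rpow_two, bracket_sq]
  have hfin : ∀ S : Finset (Fin d → ℤ), ∑ n ∈ S, bracket n ^ (2 * s) * ‖projHigh N v n‖ ^ 2 ≤
      2 ^ (2 * s) * hsNorm s w ^ 2 + 2 ^ (2 * s) * 2 ^ s * B := by
    intro S
    set S' := S.filter fun n => N ≤ nrm n with hS'
    set F := S'.image (Quotient.mk P) with hF
    have hFmin : ∀ υ ∈ F, N / 2 ≤ clusterMin P υ := by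
      intro υ hυ
      obtain ⟨n, hn, rfl⟩ := Finset.mem_image.1 hυ
      have hn' := (Finset.mem_filter.1 hn).2
      linarith [hcl n hn']
    have h1 : ∑ n ∈ S, bracket n ^ (2 * s) * ‖projHigh N v n‖ ^ 2 =
        ∑ n ∈ S', bracket n ^ (2 * s) * ‖v n‖ ^ 2 := by
      rw [hS', Finset.sum_filter]
      refine Finset.sum_congr rfl fun n _ => ?_
      rw [projHigh, Set.indicator_apply]
      simp only [Set.mem_ofPred_eq]
      split_ifs <;> simp
    have h2 : ∑ n ∈ S', bracket n ^ (2 * s) * ‖v n‖ ^ 2 ≤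
        2 ^ (2 * s) * ∑ υ ∈ F, W υ * superAction P υ v := by
      rw [sum_mul_superAction hP.finite, Finset.mul_sum]
      refine (Finset.sum_le_sum fun n hn => ?_).trans (Finset.sum_le_sum_of_subset_of_nonneg
        (fun n hn => mem_clusterUnion.2 (Finset.mem_image_of_mem _ hn)) fun n _ _ =>
          mul_nonneg (by positivity) (mul_nonneg (hW0 _) (sq_nonneg _)))
      rw [← mul_assoc]
      refine mul_le_mul_of_nonneg_right ?_ (sq_nonneg _)
      have hn' := hcl n (Finset.mem_filter.1 hn).2
      rw [hbr, Real.rpow_mul two_pos.le, Real.rpow_two, ← Real.mul_rpow (by norm_num) (by positivity)]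
      refine Real.rpow_le_rpow (by positivity) ?_ hs
      nlinarith [nrm_nonneg n]
    have h3 : ∑ υ ∈ F, W υ * superAction P υ w ≤ hsNorm s w ^ 2 := by
      refine sum_mul_superAction_le hP.finite F (fun n => ?_) hw
      rw [hbr]
      refine Real.rpow_le_rpow (by positivity) ?_ hs
      have := pow_le_pow_left₀ (clusterMin_nonneg _) (clusterMin_le (P := P) n) 2
      linarith
    have h4 : ∑ υ ∈ F, W υ * superAction P υ v ≤
        ∑ υ ∈ F, W υ * superAction P υ w + 2 ^ s * B := by
      have h5 : ∀ υ ∈ F, W υ * superAction P υ v ≤ W υ * superAction P υ w +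
          2 ^ s * (clusterMin P υ ^ (2 * s) * |superAction P υ v - superAction P υ w|) := by
        intro υ hυ
        have hm1 : 1 ≤ clusterMin P υ := by linarith [hFmin υ hυ]
        have h6 : W υ ≤ 2 ^ s * clusterMin P υ ^ (2 * s) := by
          simp only [hW]
          rw [Real.rpow_mul (by linarith), Real.rpow_two, ← Real.mul_rpow (by norm_num) (by positivity)]
          exact Real.rpow_le_rpow (by positivity) (by nlinarith) hs
        have h7 := mul_le_mul_of_nonneg_right h6 (abs_nonneg (superAction P υ v - superAction P υ w))
        have h8 := mul_le_mul_of_nonneg_left (le_abs_self (superAction P υ v - superAction P υ w))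
          (hW0 υ)
        linarith
      refine (Finset.sum_le_sum h5).trans ?_
      rw [Finset.sum_add_distrib, ← Finset.mul_sum]
      gcongr
      exact hB F hFmin
    rw [h1]
    calc _ ≤ 2 ^ (2 * s) * (hsNorm s w ^ 2 + 2 ^ s * B) := by
          refine h2.trans ?_
          gcongr
          linarith
      _ = _ := by ring
  have hsum : Summable fun n => bracket n ^ (2 * s) * ‖projHigh N v n‖ ^ 2 :=
    summable_of_sum_le hnn hfin
  rw [hsNorm, Real.sq_sqrt (tsum_nonneg hnn)]
  exact hsum.tsum_le_of_sum_le hfin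

end SuperActions

end
end NLSTorus

/-! ### Assembly of the theorem -/

theorem proposition2p7 (d : ℕ) (hd : 1 ≤ d) :
    ∃ δ : ℝ, 0 < δ ∧ δ < 1 ∧
    ∀ G : Matrix (Fin d) (Fin d) ℝ, G.PosDef →
    ∃ C₀ N₀ : ℝ, 2 ≤ C₀ ∧ 2 ≤ N₀ ∧
      (∃ P : Setoid (Fin d → ℤ), NLSTorus.IsClusterDecomposition G δ C₀ P) ∧
      ∀ f : ℝ → ℝ, ContDiff ℝ ∞ f → f 0 = 0 → deriv f 0 ≠ 0 →
      ∀ r : ℝ, 2 ≤ r →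
      -- smallness threshold of the first estimate, depending on `r` but not on `s` and `c`
      ∃ ρ₁ : ℝ, 0 < ρ₁ ∧
      ∀ s c : ℝ, (d : ℝ) < s → 1 < c →
      ∃ K ρ₀ : ℝ, 0 < K ∧ 0 < ρ₀ ∧
      ∀ (T ρ : ℝ) (u : ℝ → (Fin d → ℤ) → ℂ), 0 < T → 0 < ρ →
        NLSTorus.IsNLSSolution G f s T u →
        NLSTorus.hsNorm s (u 0) ≤ ρ →
        (∀ t ∈ Set.Icc 0 T, NLSTorus.hsNorm s (u t) ≤ c * ρ) →
        -- variation of the high super-actions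
        (ρ ≤ ρ₁ →
          ∀ P : Setoid (Fin d → ℤ), NLSTorus.IsClusterDecomposition G δ C₀ P →
          ∀ M : ℝ, 2 ≤ M → ∀ t ∈ Set.Icc 0 T,
            Summable (fun υ : {υ : Quotient P // M ≤ NLSTorus.clusterMin P υ} =>
              NLSTorus.clusterMin P υ.1 ^ (2 * s) *
                |NLSTorus.superAction P υ.1 (u t) - NLSTorus.superAction P υ.1 (u 0)|) ∧
            ∑' υ : {υ : Quotient P // M ≤ NLSTorus.clusterMin P υ},
              NLSTorus.clusterMin P υ.1 ^ (2 * s) *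
                |NLSTorus.superAction P υ.1 (u t) - NLSTorus.superAction P υ.1 (u 0)| ≤
              K * (ρ ^ 4 + T * M ^ (-(δ / 2) * (s - d)) * ρ ^ 4 + T * ρ ^ (2 * (r + 1)))) ∧
        -- growth of the high modes
        (ρ ≤ ρ₀ →
          ∀ N : ℝ, N₀ ≤ N → ∀ t ∈ Set.Icc 0 T,
            NLSTorus.hsNorm s (NLSTorus.projHigh N (u t)) ^ 2 ≤
              2 ^ (2 * s) * NLSTorus.hsNorm s (u 0) ^ 2 + ρ ^ 3 +
                T * N ^ (-(δ / 2) * (s - d)) * ρ ^ 3 + T * ρ ^ (2 * r + 1)) := by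
  obtain ⟨δ, hδ0, hδ1, hcl⟩ := NLSTorus.exists_isClusterDecomposition d
  refine ⟨δ, hδ0, hδ1, fun G hG => ?_⟩
  obtain ⟨C₀, hC₀, P₀, hP₀⟩ := hcl G hG
  -- `C₀ + 4` ensures N > C₀, so that high modes avoid the exceptional cluster, and N / 2 ≥ 2, so
  -- that the variation bound may be used with M = N / 2.
  refine ⟨C₀, C₀ + 4, hC₀, by linarith, ⟨P₀, hP₀⟩, fun f hf hf0 _ r _ => ⟨1, one_pos, fun s c hs hc => ?_⟩⟩
  obtain ⟨K, hK, hvar⟩ := NLSTorus.exists_superAction_variation_bound hd hG hδ0 hδ1 hs hf hf0 (r := r) hc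
  have hs0 : 0 ≤ s := (Nat.cast_nonneg d).trans hs.le
  set a := δ / 2 * (s - d) with ha
  have ha0 : 0 ≤ a := mul_nonneg (by linarith) (by linarith)
  have h2a : (1 : ℝ) ≤ 2 ^ a := Real.one_le_rpow (by norm_num) ha0
  -- `Λ` collects all constants of the second estimate, 2^a being the cost of replacing (N/2)^{-a}
  -- by N^{-a}. The second estimate asks for one power of ρ less than the first provides, and Λ ρ ≤
  -- 1 absorbs the constants.
  set Λ : ℝ := 2 ^ (2 * s) * 2 ^ s * (K * 2 ^ a) with hΛ
  have hΛ0 : 0 < Λ := by positivity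
  refine ⟨K, min 1 Λ⁻¹, hK, lt_min one_pos (inv_pos.2 hΛ0), ?_⟩
  intro T ρ u hT hρ hu hu0 hub
  refine ⟨fun hρ1 P hP M hM t ht => ?_, fun hρ1 N hN t ht => ?_⟩
  · have hnn : ∀ υ : {υ : Quotient P // M ≤ NLSTorus.clusterMin P υ},
        0 ≤ NLSTorus.clusterMin P υ.1 ^ (2 * s) *
          |NLSTorus.superAction P υ.1 (u t) - NLSTorus.superAction P υ.1 (u 0)| := fun υ =>
      mul_nonneg (Real.rpow_nonneg (NLSTorus.clusterMin_nonneg _) _) (abs_nonneg _)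
    have hfin : ∀ F : Finset {υ : Quotient P // M ≤ NLSTorus.clusterMin P υ},
        ∑ υ ∈ F, NLSTorus.clusterMin P υ.1 ^ (2 * s) *
          |NLSTorus.superAction P υ.1 (u t) - NLSTorus.superAction P υ.1 (u 0)| ≤
        K * (ρ ^ 4 + T * M ^ (-(δ / 2) * (s - d)) * ρ ^ 4 + T * ρ ^ (2 * (r + 1))) := fun F => by
      have h := hvar C₀ P hP T ρ u hρ hρ1 hu hu0 hub M hM t ht
        (F.map (Function.Embedding.subtype _)) (by
          intro υ hυ
          obtain ⟨υ', -, rfl⟩ := Finset.mem_map.1 hυ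
          exact υ'.2)
      rwa [Finset.sum_map] at h
    have hsum := summable_of_sum_le hnn hfin
    exact ⟨hsum, hsum.tsum_le_of_sum_le hfin⟩
  · have hN0 : 0 < N := by linarith
    have hρ2 : ρ ≤ 1 := hρ1.trans (min_le_left _ _)
    have hΛρ : Λ * ρ ≤ 1 := by
      have := mul_le_mul_of_nonneg_left (hρ1.trans (min_le_right _ _)) hΛ0.le
      rwa [mul_inv_cancel₀ hΛ0.ne'] at this
    have h := NLSTorus.hsNorm_projHigh_sq_le hP₀ hs0 (hu.mem 0 ⟨le_rfl, hT.le⟩) (v := u t)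
      (by linarith : C₀ < N) (by linarith) fun F hF =>
        hvar C₀ P₀ hP₀ T ρ u hρ hρ2 hu hu0 hub (N / 2) (by linarith) t ht F hF
    have hMN : (N / 2) ^ (-(δ / 2) * (s - d)) = 2 ^ a * N ^ (-(δ / 2) * (s - d)) := by
      rw [show -(δ / 2) * (s - d) = -a by rw [ha]; ring, Real.div_rpow hN0.le two_pos.le,
        Real.rpow_neg two_pos.le, div_inv_eq_mul, mul_comm]
    have hr : ρ ^ (2 * (r + 1)) = ρ * ρ ^ (2 * r + 1) := by
      rw [show 2 * (r + 1) = 1 + (2 * r + 1) by ring, Real.rpow_add hρ, Real.rpow_one]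
    rw [hMN, hr] at h
    have hμ : 0 ≤ N ^ (-(δ / 2) * (s - d)) := Real.rpow_nonneg hN0.le _
    have hν : 0 ≤ ρ ^ (2 * r + 1) := Real.rpow_nonneg hρ.le _
    generalize N ^ (-(δ / 2) * (s - d)) = μ at *
    generalize ρ ^ (2 * r + 1) = ν at *
    have h1 : 2 ^ (2 * s) * 2 ^ s * (K * (ρ ^ 4 + T * (2 ^ a * μ) * ρ ^ 4 + T * (ρ * ν))) ≤
        Λ * ρ * (ρ ^ 3 + T * μ * ρ ^ 3 + T * ν) := by
      calc _ ≤ 2 ^ (2 * s) * 2 ^ s * (K * (2 ^ a * ρ ^ 4 + T * (2 ^ a * μ) * ρ ^ 4 +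
            T * (2 ^ a * (ρ * ν)))) := by
            have e1 : ρ ^ 4 ≤ 2 ^ a * ρ ^ 4 := le_mul_of_one_le_left (by positivity) h2a
            have e2 : ρ * ν ≤ 2 ^ a * (ρ * ν) := le_mul_of_one_le_left (by positivity) h2a
            exact mul_le_mul_of_nonneg_left (mul_le_mul_of_nonneg_left (add_le_add
              (add_le_add e1 le_rfl) (mul_le_mul_of_nonneg_left e2 hT.le)) hK.le) (by positivity)
        _ = _ := by rw [hΛ]; ring
    have h2 : Λ * ρ * (ρ ^ 3 + T * μ * ρ ^ 3 + T * ν) ≤ ρ ^ 3 + T * μ * ρ ^ 3 + T * ν :=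
      mul_le_of_le_one_left (by positivity) hΛρ
    linarith
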